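/- For $m\ge 1$ let $\mathbb H^{2m+1}=\{(z,w)\in\mathbb C^{m}\times\mathbb C:\operatorname{Im} w=\|z\|^2\}$. Let $N\ge 2$ and let $H=(f,g)=(f_1,\dots,f_{N-1},g):\mathbb H^3\to\mathbb H^{2N-1}$ be a smooth CR map. Let $\mathcal M=\{(z,w,\chi,\tau):w-\tau=2iz\chi\}$ be the complexification of $\mathbb H^3$ and $L=\partial_\chi-2iz\,\partial_\tau$. For $q=(\bar\chi,\bar\tau)\in\mathbb H^3$ let $S_q=\{(z,w)\in\mathbb C^2:w=\tau+2iz\chi\}$ be its Segre variety, and for $p\in S_q$ put $$d(p,\bar q)=N-1-\dim_{\mathbb C}\operatorname{span}\{(L^k\bar f)(p,\bar q):k\ge 1\},$$ where $\bar f$ is regarded as a function of $(\chi,\tau)$ (only its jet at $\bar q$ is used). The tangential degeneracy $\operatorname{tdeg}_H(q)$ is the generic, that is the minimal, value of $d(p,\bar q)$ for $p\in S_q$. If $\operatorname{tdeg}_H(q)=N-2$ for some $q\in\mathbb H^3$, then $H$ is equivalent to the linear embedding $\mathcal L(z,w)=(z,0,\dots,0,w)$: there are automorphisms (invertible linear fractional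 maps preserving the hypersurface) $\psi$ of $\mathbb H^3$ and $\psi'$ of $\mathbb H^{2N-1}$ such that $H=\psi'\circ\mathcal L\circ\psi^{-1}$ (at every point of $\mathbb H^3$ at which $\psi^{-1}$ is defined; $\psi'$ has no pole at the corresponding point). -/

import Mathlib

open Complex
open scoped ContDiff ComplexConjugate

noncomputable section

/-- Coordinates `(z, w) = (z₁, …, z_m, w)` on `ℂ^{m+1} = ℂ^m × ℂ`. -/
abbrev CSpace (m : ℕ) : Type := (Fin m → ℂ) × ℂ

/-- The Heisenberg hypersurface `{(z, w) ∈ ℂ^m × ℂ : Im w = ‖z‖²}`, of real dimension `2m + 1`.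
Thus `ℍ³` is `heisenberg 1` and `ℍ^{2N-1}` is `heisenberg (N - 1)`. -/
def heisenberg (m : ℕ) : Set (CSpace m) :=
  {Z | Z.2.im = ∑ i, ‖Z.1 i‖ ^ 2}

/-! ### Automorphisms and spherical equivalence -/

/-- The denominator at `Z` of the linear fractional map given, in homogeneous coordinates
`(Z, 1)`, by the invertible linear map `A`; its zeros are the poles of that map. -/
def lfDen {m : ℕ} (A : (CSpace m × ℂ) ≃ₗ[ℂ] (CSpace m × ℂ)) (Z : CSpace m) : ℂ :=
  (A (Z, 1)).2

/-- The linear fractional map given by `A`, at a point `Z` that is not a pole. -/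
def linFrac {m : ℕ} (A : (CSpace m × ℂ) ≃ₗ[ℂ] (CSpace m × ℂ)) (Z : CSpace m) : CSpace m :=
  (lfDen A Z)⁻¹ • (A (Z, 1)).1

/-- `A` represents an automorphism of the Heisenberg hypersurface: an invertible linear fractional
map that takes the hypersurface into itself, away from its poles. -/
def IsHeisAut {m : ℕ} (A : (CSpace m × ℂ) ≃ₗ[ℂ] (CSpace m × ℂ)) : Prop :=
  ∀ Z ∈ heisenberg m, lfDen A Z ≠ 0 → linFrac A Z ∈ heisenberg m

/-- Spherical equivalence of two maps defined on the whole of the source hypersurface (only their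
values there matter): `H₂ = ψ' ∘ H₁ ∘ ψ⁻¹` for automorphisms `ψ`, `ψ'` of the source and the
target hypersurface. It is written as `H₂ ∘ ψ = ψ' ∘ H₁`, at all points of the source hypersurface
that are not poles of `ψ`; there `H₁ Z` is required not to be a pole of `ψ'`. -/
def SphericallyEquivalent {n m : ℕ} (H₁ H₂ : CSpace n → CSpace m) : Prop :=
  ∃ (A : (CSpace n × ℂ) ≃ₗ[ℂ] (CSpace n × ℂ)) (A' : (CSpace m × ℂ) ≃ₗ[ℂ] (CSpace m × ℂ)),
    IsHeisAut A ∧ IsHeisAut A' ∧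
      ∀ Z ∈ heisenberg n, lfDen A Z ≠ 0 →
        lfDen A' (H₁ Z) ≠ 0 ∧ H₂ (linFrac A Z) = linFrac A' (H₁ Z)

/-- The linear embedding `(z, w) ↦ (z, 0, …, 0, w)` of `ℂ²` into `ℂ^m × ℂ` (for `m ≥ 1`). -/
def linearEmbedding (m : ℕ) (Z : CSpace 1) : CSpace m :=
  (fun i => if (i : ℕ) = 0 then Z.1 0 else 0, Z.2)

/-! ### Smooth CR maps -/

/-- The global chart `(z, u) ↦ (z, u + i |z|²)` of `ℍ³`. -/
def heisPt (p : ℂ × ℝ) : CSpace 1 :=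
  (fun _ => p.1, (p.2 : ℂ) + I * ((‖p.1‖ ^ 2 : ℝ) : ℂ))

section Fields

variable {E : Type*} [NormedAddCommGroup E] [NormedSpace ℂ E]

/-- `∂h/∂z̄` for a function `h` of `(z, u) ∈ ℂ × ℝ`. -/
def dzbar (h : ℂ × ℝ → E) (p : ℂ × ℝ) : E :=
  (1 / 2 : ℂ) • (fderiv ℝ h p (1, 0) + I • fderiv ℝ h p (I, 0))

/-- `∂h/∂u` for a function `h` of `(z, u) ∈ ℂ × ℝ`. -/
def du (h : ℂ × ℝ → E) (p : ℂ × ℝ) : E :=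
  fderiv ℝ h p (0, 1)

/-- The CR vector field `L = ∂/∂z̄ - 2 i z ∂/∂w̄` of `ℍ³`; in the chart `heisPt` it reads
`∂/∂z̄ - i z ∂/∂u`. -/
def crL (h : ℂ × ℝ → E) (p : ℂ × ℝ) : E :=
  dzbar h p - (I * p.1) • du h p

/-- `H` is a smooth CR map of `ℍ³` into the Heisenberg hypersurface of `ℂ^m × ℂ`
(only the values of `H` on `ℍ³` matter). -/
structure IsSmoothCRMap {m : ℕ} (H : CSpace 1 → CSpace m) : Prop where
  mapsTo : Set.MapsTo H (heisenberg 1) (heisenberg m)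
  smooth : ContDiff ℝ ∞ (fun p => H (heisPt p))
  cr : ∀ p, crL (fun p => H (heisPt p)) p = 0

/-! ### Tangential degeneracy -/

/-- Write `χ = z̄`, `τ = w̄`, and let `h` be (in the chart `heisPt`) the conjugate of a CR function,
so that to infinite order at each point of `ℍ³` it is a function of `(χ, τ)`. This is `∂h/∂χ`. -/
def dchi (h : ℂ × ℝ → E) (p : ℂ × ℝ) : E :=
  dzbar h p + (I * p.1) • du h p

/-- For `h` as in `dchi`, this is `∂h/∂τ`. -/
def dtau (h : ℂ × ℝ → E) (p : ℂ × ℝ) : E :=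
  du h p

/-- The extension `L = ∂/∂χ - 2 i z ∂/∂τ` of the CR vector field to the complexification
`{w - τ = 2 i z χ}` of `ℍ³`, acting on functions of `(χ, τ)` for a fixed value `z = a`. -/
def segreL (a : ℂ) (h : ℂ × ℝ → E) (p : ℂ × ℝ) : E :=
  dchi h p - (2 * I * a) • dtau h p

/-- On the diagonal, the extended field is the CR vector field. -/
theorem segreL_diag (h : ℂ × ℝ → E) (p : ℂ × ℝ) : segreL p.1 h p = crL h p := by
  simp only [segreL, dchi, dtau, crL]
  module

end Fields

/-- If `f` is holomorphic near a point of `ℍ³`, then `dchi` of the conjugate of `f` is the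
conjugate of `∂f/∂z`, that is `∂f̄/∂χ`; and `dtau` of it is the conjugate of `∂f/∂w`. -/
theorem dchi_dtau_conj_holomorphic (f : ℂ × ℂ → ℂ) (p : ℂ × ℝ)
    (hf : DifferentiableAt ℂ f ((heisPt p).1 0, (heisPt p).2)) :
    dchi (fun p => conj (f ((heisPt p).1 0, (heisPt p).2))) p =
        conj (fderiv ℂ f ((heisPt p).1 0, (heisPt p).2) (1, 0)) ∧
      dtau (fun p => conj (f ((heisPt p).1 0, (heisPt p).2))) p =
        conj (fderiv ℂ f ((heisPt p).1 0, (heisPt p).2) (0, 1)) := by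
  set D := fderiv ℂ f ((heisPt p).1 0, (heisPt p).2) with hD
  have h1 : HasFDerivAt (fun q : ℂ × ℝ => q.1) (ContinuousLinearMap.fst ℝ ℂ ℝ) p :=
    hasFDerivAt_fst
  have h2 : HasFDerivAt (fun q : ℂ × ℝ => q.2) (ContinuousLinearMap.snd ℝ ℂ ℝ) p :=
    hasFDerivAt_snd
  have h4 := ((ofRealCLM.hasFDerivAt (x := p.2)).comp p h2).add
    (((ofRealCLM.hasFDerivAt (x := ‖p.1‖ ^ 2)).comp p h1.norm_sq).const_smul I)
  have h5 := h1.prodMk h4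
  have h6 : HasFDerivAt f (D.restrictScalars ℝ) ((heisPt p).1 0, (heisPt p).2) :=
    hf.hasFDerivAt.restrictScalars ℝ
  have h7 := (conjCLE.toContinuousLinearMap.hasFDerivAt
    (x := f ((heisPt p).1 0, (heisPt p).2))).comp p (HasFDerivAt.comp p h6 h5)
  have h8 := HasFDerivAt.fderiv h7
  have lin : ∀ a b : ℂ, D (a, b) = a * D (1, 0) + b * D (0, 1) := by
    intro a b
    have : ((a, b) : ℂ × ℂ) = a • ((1, 0) : ℂ × ℂ) + b • ((0, 1) : ℂ × ℂ) := by simp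
    rw [this, map_add, map_smul, map_smul]
    simp
  have key : ∀ v : ℂ × ℝ,
      fderiv ℝ (fun p => conj (f ((heisPt p).1 0, (heisPt p).2))) p v =
        conj (v.1 * D (1, 0) +
          ((v.2 : ℂ) + I * ((2 * (p.1.re * v.1.re + p.1.im * v.1.im) : ℝ) : ℂ)) * D (0, 1)) := by
    intro v
    rw [← lin]
    refine (congrArg (fun T => T v) h8).trans ?_
    simp [inner]
    ring_nf
  refine ⟨?_, ?_⟩
  · simp only [dchi, dzbar, du, key]
    simp
    apply Complex.ext <;> simp <;> ring
  · simp [dtau, du, key]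

/-- The tangential components `f̄` of the conjugate of `H = (f, g)` along `ℍ³`, in the chart. -/
def conjTang {m : ℕ} (H : CSpace 1 → CSpace m) (p : ℂ × ℝ) : Fin m → ℂ :=
  fun i => conj ((H (heisPt p)).1 i)

/-- The space `Ẽ(P, Q̄) ⊆ ℂ^m` spanned by the vectors `(L^k f̄)(P, Q̄)`, `k ≥ 1`, for `Q ∈ ℍ³` and
`P` in the Segre variety of `Q`. -/
def segreSpan {m : ℕ} (H : CSpace 1 → CSpace m) (P Q : CSpace 1) : Submodule ℂ (Fin m → ℂ) :=
  Submodule.span ℂ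
    {v | ∃ k : ℕ, 1 ≤ k ∧ v = ((segreL (P.1 0))^[k] (conjTang H)) (Q.1 0, Q.2.re)}

/-- The degeneracy `d(P, Q̄) = m - dim Ẽ(P, Q̄)` of `H` at `(P, Q̄)`. -/
def degeneracyAt {m : ℕ} (H : CSpace 1 → CSpace m) (P Q : CSpace 1) : ℕ :=
  m - Module.finrank ℂ (segreSpan H P Q)

/-- The Segre variety of `Q = (χ̄, τ̄)`: the complex line `w = τ + 2 i z χ`. -/
def segreVariety (Q : CSpace 1) : Set (CSpace 1) :=
  {P | P.2 = conj Q.2 + 2 * I * P.1 0 * conj (Q.1 0)}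

/-- The tangential degeneracy of `H` at `Q ∈ ℍ³`: the generic value of `d(P, Q̄)` for `P` in the
Segre variety of `Q`. As the rank of finitely many vectors that depend polynomially on `P` is
generically maximal, the generic value is the minimum. -/
def tdeg {m : ℕ} (H : CSpace 1 → CSpace m) (Q : CSpace 1) : ℕ :=
  sInf ((fun P => degeneracyAt H P Q) '' segreVariety Q)

end

/-! Translate the distinguished point to the origin and homogenise: `(f, g, 1)` is a CR map into the
null cone of the Hermitian form `Im (y t̄) - ‖x‖²`, and linear isometries of that form act on the
target as automorphisms. Up to conjugation, the hypothesis says that the derivatives of `f` of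
positive order along each Segre direction span at most a line, and that they are not all zero.

Formal part. The null equation carries the rank bound from `f` to all of `(f, g, 1)`
(`rankOne_of_tangential`). The Hopf lemma (`hopf`) makes `∂g/∂u` nonzero at the origin, since
otherwise `f` would be constant; an isometry then brings the first-order jet to that of the linear
embedding, up to a scale `l` (`Normalised`). Now the line for the parameter `b` is spanned by the
first derivative, so the derivatives of order `k` satisfy `x i = 0` for `i ≠ 0` and `y = 2 i b x₀`.
These are identities between polynomials in `b`, and their two leading coefficients give, along `z =
0`, the jets `x = 0`, `∂x i/∂z = 0` for `i ≠ 0`, and `y = w q` with `q = ∂x₀/∂z`. The null equation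
and its derivatives turn `δ = t / q` into a real solution of `δ - w δ' = 1`, hence `δ = 1 + r w`,
and a parabolic isometry removes `r` (`jet_T_t_eq`).

Analytic part. The map is only smooth, so equality of jets must be promoted to equality by boundary
rigidity. After a Cayley transform of the target the map `(F0, F)` takes values in the unit sphere.
Means over the circles `|z|² = Im w`, `u = Re w` turn `F0` and `F 0 / z` into functions `G` and `Φ`
holomorphic on the upper half-plane; they play the role of the value and the `z`-derivative at `z =
0` of a holomorphic extension. The Burns–Krantz argument (`eq_cayley_of_flat`) identifies `G`; the
inequality `|G|² + |Φ|² Im w ≤ 1` and a second flatness argument identify `Φ`. The mean square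
distance to the model map then vanishes on every circle, so the two maps agree (`sphere_rigidity`,
`proportional_of_jet`). -/

noncomputable section

/-! ### Smooth functions on the Heisenberg chart and the CR vector fields. -/

/-- The algebra of smooth complex-valued functions on `ℂ × ℝ`. -/
def smoothAlg : Subalgebra ℂ (ℂ × ℝ → ℂ) where
  carrier := {h | ContDiff ℝ ∞ h}
  mul_mem' := fun ha hb => (show ContDiff ℝ ∞ _ from ha).mul (show ContDiff ℝ ∞ _ from hb)
  add_mem' := fun ha hb => (show ContDiff ℝ ∞ _ from ha).add (show ContDiff ℝ ∞ _ from hb)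
  algebraMap_mem' := fun c => show ContDiff ℝ ∞ (fun _ => c) from contDiff_const

namespace smoothAlg

theorem mem_iff {h : ℂ × ℝ → ℂ} : h ∈ smoothAlg ↔ ContDiff ℝ ∞ h := Iff.rfl

theorem contDiff (h : smoothAlg) : ContDiff ℝ ∞ (h : ℂ × ℝ → ℂ) := h.2

theorem differentiable (h : smoothAlg) : Differentiable ℝ (h : ℂ × ℝ → ℂ) :=
  (contDiff h).differentiable (by simp)

@[fun_prop]
theorem continuous (h : smoothAlg) : Continuous (h : ℂ × ℝ → ℂ) := (contDiff h).continuous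

theorem ext_apply {a b : smoothAlg} (h : ∀ p, (a : ℂ × ℝ → ℂ) p = (b : ℂ × ℝ → ℂ) p) : a = b :=
  Subtype.ext (funext h)

@[simp] theorem coe_add_apply (a b : smoothAlg) (p : ℂ × ℝ) : (↑(a + b) : ℂ × ℝ → ℂ) p = a.1 p + b.1 p := rfl
@[simp] theorem coe_sub_apply (a b : smoothAlg) (p : ℂ × ℝ) : (↑(a - b) : ℂ × ℝ → ℂ) p = a.1 p - b.1 p := rfl
@[simp] theorem coe_mul_apply (a b : smoothAlg) (p : ℂ × ℝ) : (↑(a * b) : ℂ × ℝ → ℂ) p = a.1 p * b.1 p := rfl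
@[simp] theorem coe_smul_apply (c : ℂ) (a : smoothAlg) (p : ℂ × ℝ) : (↑(c • a) : ℂ × ℝ → ℂ) p = c * a.1 p := rfl
@[simp] theorem coe_neg_apply (a : smoothAlg) (p : ℂ × ℝ) : (↑(-a) : ℂ × ℝ → ℂ) p = -a.1 p := rfl
@[simp] theorem coe_zero_apply (p : ℂ × ℝ) : (↑(0 : smoothAlg) : ℂ × ℝ → ℂ) p = 0 := rfl
@[simp] theorem coe_one_apply (p : ℂ × ℝ) : (↑(1 : smoothAlg) : ℂ × ℝ → ℂ) p = 1 := rfl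
@[simp] theorem coe_algebraMap_apply (c : ℂ) (p : ℂ × ℝ) :
    (↑(algebraMap ℂ smoothAlg c) : ℂ × ℝ → ℂ) p = c := rfl

/-- Evaluation at a point. -/
def evalAt (p : ℂ × ℝ) : smoothAlg →ₐ[ℂ] ℂ where
  toFun h := h.1 p
  map_one' := rfl
  map_mul' _ _ := rfl
  map_zero' := rfl
  map_add' _ _ := rfl
  commutes' _ := rfl

@[simp] theorem evalAt_apply (p : ℂ × ℝ) (h : smoothAlg) : evalAt p h = h.1 p := rfl

theorem coe_sum_apply {ι : Type*} (s : Finset ι) (a : ι → smoothAlg) (p : ℂ × ℝ) :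
    (↑(∑ i ∈ s, a i) : ℂ × ℝ → ℂ) p = ∑ i ∈ s, (a i).1 p :=
  map_sum (evalAt p) a s

/-- Complex conjugation of functions. -/
def cj : smoothAlg →+* smoothAlg where
  toFun h := ⟨fun p => conj (h.1 p), mem_iff.2 (conjCLE.contDiff.comp (contDiff h))⟩
  map_one' := ext_apply fun _ => map_one _
  map_mul' _ _ := ext_apply fun _ => map_mul _ _ _
  map_zero' := ext_apply fun _ => map_zero _
  map_add' _ _ := ext_apply fun _ => map_add _ _ _

@[simp] theorem cj_apply (h : smoothAlg) (p : ℂ × ℝ) : (cj h).1 p = conj (h.1 p) := rfl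
@[simp] theorem cj_cj (h : smoothAlg) : cj (cj h) = h := ext_apply fun _ => by simp
@[simp] theorem cj_smul (c : ℂ) (h : smoothAlg) : cj (c • h) = conj c • cj h :=
  ext_apply fun _ => by simp

/-- The derivative in a fixed direction. -/
def dirD (v : ℂ × ℝ) : Derivation ℂ smoothAlg smoothAlg where
  toFun h := ⟨fun p => fderiv ℝ h.1 p v,
    mem_iff.2 (((contDiff h).fderiv_right (m := ∞) (by simp)).clm_apply contDiff_const)⟩
  map_add' a b := ext_apply fun p => by
    change fderiv ℝ (a.1 + b.1) p v = fderiv ℝ a.1 p v + fderiv ℝ b.1 p v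
    rw [fderiv_add (differentiable a p) (differentiable b p)]; rfl
  map_smul' c a := ext_apply fun p => by
    change fderiv ℝ (c • a.1) p v = c * fderiv ℝ a.1 p v
    rw [fderiv_const_smul (differentiable a p)]; rfl
  map_one_eq_zero' := ext_apply fun p => by
    change fderiv ℝ (fun _ : ℂ × ℝ => (1 : ℂ)) p v = 0
    simp
  leibniz' a b := ext_apply fun p => by
    change fderiv ℝ (a.1 * b.1) p v = a.1 p * fderiv ℝ b.1 p v + b.1 p * fderiv ℝ a.1 p v
    rw [fderiv_mul (differentiable a p) (differentiable b p)]; rfl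

@[simp] theorem dirD_apply (v : ℂ × ℝ) (h : smoothAlg) (p : ℂ × ℝ) :
    (dirD v h).1 p = fderiv ℝ h.1 p v := rfl

theorem dirD_comm (v w : ℂ × ℝ) (h : smoothAlg) : dirD v (dirD w h) = dirD w (dirD v h) := by
  have key : ∀ (v w : ℂ × ℝ) (p : ℂ × ℝ),
      (dirD v (dirD w h)).1 p = fderiv ℝ (fderiv ℝ h.1) p v w := by
    intro v w p
    have hd : DifferentiableAt ℝ (fderiv ℝ h.1) p :=
      ((contDiff h).fderiv_right (m := ∞) (by simp)).differentiable (by simp) p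
    change fderiv ℝ (fun q => fderiv ℝ h.1 q w) p v = _
    rw [fderiv_clm_apply hd (differentiableAt_const w)]
    simp
  refine ext_apply fun p => ?_
  rw [key, key]
  exact ((contDiff h).contDiffAt.isSymmSndFDerivAt (by simpa using WithTop.coe_le_coe.2 (le_top (a := (2 : ℕ∞))))) v w

theorem dirD_cj (v : ℂ × ℝ) (h : smoothAlg) : dirD v (cj h) = cj (dirD v h) := by
  refine ext_apply fun p => ?_
  have := (conjCLE.toContinuousLinearMap.hasFDerivAt (x := h.1 p)).comp p
    (differentiable h p).hasFDerivAt
  exact congrArg (fun T => T v) this.fderiv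

/-- The coordinate function `z`. -/
def zS : smoothAlg := ⟨fun p => p.1, mem_iff.2 contDiff_fst⟩
/-- The coordinate function `u`. -/
def uS : smoothAlg := ⟨fun p => (p.2 : ℂ), mem_iff.2 (ofRealCLM.contDiff.comp contDiff_snd)⟩

@[simp] theorem zS_apply (p : ℂ × ℝ) : zS.1 p = p.1 := rfl
@[simp] theorem uS_apply (p : ℂ × ℝ) : uS.1 p = (p.2 : ℂ) := rfl

/-- The function `w = u + i |z|²`. -/
def wS : smoothAlg := uS + I • (zS * cj zS)

theorem dirD_zS (v : ℂ × ℝ) : dirD v zS = algebraMap ℂ _ v.1 := ext_apply fun p => by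
  have : HasFDerivAt (fun q : ℂ × ℝ => q.1) (ContinuousLinearMap.fst ℝ ℂ ℝ) p := hasFDerivAt_fst
  exact congrArg (fun T => T v) this.fderiv

theorem dirD_uS (v : ℂ × ℝ) : dirD v uS = algebraMap ℂ _ (v.2 : ℂ) := ext_apply fun p => by
  have h2 : HasFDerivAt (fun q : ℂ × ℝ => q.2) (ContinuousLinearMap.snd ℝ ℂ ℝ) p :=
    hasFDerivAt_snd
  have := (ofRealCLM.hasFDerivAt (x := p.2)).comp p h2
  exact congrArg (fun T => T v) this.fderiv

/-- `∂/∂u`. -/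
def T : Derivation ℂ smoothAlg smoothAlg := dirD (0, 1)
/-- `∂/∂z̄ = (∂/∂x + i ∂/∂y) / 2` at fixed `u`. -/
def dbar : Derivation ℂ smoothAlg smoothAlg := (1 / 2 : ℂ) • (dirD (1, 0) + I • dirD (I, 0))
/-- `∂/∂z = (∂/∂x - i ∂/∂y) / 2` at fixed `u`. -/
def dhol : Derivation ℂ smoothAlg smoothAlg := (1 / 2 : ℂ) • (dirD (1, 0) - I • dirD (I, 0))
/-- The CR vector field. -/
def Lb : Derivation ℂ smoothAlg smoothAlg := dbar - (I • zS) • T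
/-- The conjugate of the CR vector field. -/
def Lz : Derivation ℂ smoothAlg smoothAlg := dhol + (I • cj zS) • T
/-- `∂/∂z` at fixed `w`, on CR functions. -/
def dz : Derivation ℂ smoothAlg smoothAlg := dhol - (I • cj zS) • T
/-- `∂/∂χ` at fixed `τ`, on conjugates of CR functions. -/
def dx : Derivation ℂ smoothAlg smoothAlg := dbar + (I • zS) • T

theorem T_apply (h : smoothAlg) : T h = dirD (0, 1) h := rfl
theorem dbar_apply (h : smoothAlg) :
    dbar h = (1 / 2 : ℂ) • (dirD (1, 0) h + I • dirD (I, 0) h) := rfl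
theorem dhol_apply (h : smoothAlg) :
    dhol h = (1 / 2 : ℂ) • (dirD (1, 0) h - I • dirD (I, 0) h) := rfl
theorem Lb_apply (h : smoothAlg) : Lb h = dbar h - (I • zS) * T h := rfl
theorem Lz_apply (h : smoothAlg) : Lz h = dhol h + (I • cj zS) * T h := rfl
theorem dz_apply (h : smoothAlg) : dz h = dhol h - (I • cj zS) * T h := rfl
theorem dx_apply (h : smoothAlg) : dx h = dbar h + (I • zS) * T h := rfl

@[simp] theorem T_zS : T zS = 0 := by rw [T_apply, dirD_zS]; exact map_zero _
@[simp] theorem T_cj (h : smoothAlg) : T (cj h) = cj (T h) := dirD_cj _ _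
@[simp] theorem T_uS : T uS = 1 := by
  rw [T_apply, dirD_uS]; exact ext_apply fun p => by simp
@[simp] theorem dbar_cj (h : smoothAlg) : dbar (cj h) = cj (dhol h) := by
  simp [dbar_apply, dhol_apply, dirD_cj, sub_eq_add_neg, Complex.conj_ofNat]
@[simp] theorem dhol_cj (h : smoothAlg) : dhol (cj h) = cj (dbar h) := by
  simp [dbar_apply, dhol_apply, dirD_cj, sub_eq_add_neg, Complex.conj_ofNat]
theorem Lb_cj (h : smoothAlg) : Lb (cj h) = cj (Lz h) := by
  simp [Lb_apply, Lz_apply, sub_eq_add_neg]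
theorem Lz_cj (h : smoothAlg) : Lz (cj h) = cj (Lb h) := by
  simp [Lb_apply, Lz_apply]
theorem dx_cj (h : smoothAlg) : dx (cj h) = cj (dz h) := by
  simp [dx_apply, dz_apply, sub_eq_add_neg]
@[simp] theorem dbar_zS : dbar zS = 0 := by
  rw [dbar_apply, dirD_zS, dirD_zS]; exact ext_apply fun p => by simp
@[simp] theorem dhol_zS : dhol zS = 1 := by
  rw [dhol_apply, dirD_zS, dirD_zS]; exact ext_apply fun p => by simp; norm_num
@[simp] theorem dbar_uS : dbar uS = 0 := by
  rw [dbar_apply, dirD_uS, dirD_uS]; exact ext_apply fun p => by simp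

theorem T_dhol (h : smoothAlg) : T (dhol h) = dhol (T h) := by
  simp only [T_apply, dhol_apply, Derivation.map_smul, map_sub, dirD_comm (0, 1)]
theorem T_dbar (h : smoothAlg) : T (dbar h) = dbar (T h) := by
  simp only [T_apply, dbar_apply, Derivation.map_smul, map_add, dirD_comm (0, 1)]
theorem dbar_dhol (h : smoothAlg) : dbar (dhol h) = dhol (dbar h) := by
  simp only [dhol_apply, dbar_apply, Derivation.map_smul, map_add, map_sub, dirD_comm (I, 0) (1, 0)]
  module

theorem T_Lb (h : smoothAlg) : T (Lb h) = Lb (T h) := by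
  simp [Lb_apply, T_dbar]
theorem T_Lz (h : smoothAlg) : T (Lz h) = Lz (T h) := by
  simp [Lz_apply, T_dhol]
theorem T_dz (h : smoothAlg) : T (dz h) = dz (T h) := by
  simp [dz_apply, T_dhol]

/-- This makes `dz` an operator on CR functions, as is `T`; `Lz` is not one, by the commutator that
follows. -/
theorem Lb_dz (h : smoothAlg) : Lb (dz h) = dz (Lb h) := by
  simp only [Lb_apply, dz_apply, map_sub, Derivation.leibniz, Derivation.map_smul, dbar_dhol, T_dhol, T_dbar,
    smul_eq_mul, dbar_cj, dhol_zS, T_zS, T_cj, map_zero, map_one]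
  simp only [Algebra.smul_def]
  ring

/-- The Levi form of the hypersurface: the commutator of the two CR directions is a nonzero multiple
of `T`. -/
theorem Lb_Lz (h : smoothAlg) : Lb (Lz h) = Lz (Lb h) + (2 * I) • T h := by
  simp only [Lb_apply, Lz_apply, map_sub, map_add, Derivation.leibniz, Derivation.map_smul, dbar_dhol, T_dhol,
    T_dbar, smul_eq_mul, dbar_cj, dhol_zS, T_zS, T_cj, map_zero, map_one]
  simp only [Algebra.smul_def, map_mul, map_ofNat]
  ring

/-- On CR functions `Lz` is the Segre derivative `dz + 2 i b T` with the constant `b` replaced by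
the variable `z̄`. This links differentiation of the null equation with the Segre directions. -/
theorem Lz_eq_dz (h : smoothAlg) : Lz h = dz h + (2 * I) • (cj zS * T h) := by
  simp only [Lz_apply, dz_apply, Algebra.smul_def, map_mul, map_ofNat]
  ring
theorem dx_eq_Lb (h : smoothAlg) : dx h = Lb h + (2 * I) • (zS * T h) := by
  simp only [Lb_apply, dx_apply, Algebra.smul_def, map_mul, map_ofNat]
  ring

@[simp] theorem Lb_zS : Lb zS = 0 := by simp [Lb_apply]
@[simp] theorem Lz_zS : Lz zS = 1 := by simp [Lz_apply]
@[simp] theorem dz_zS : dz zS = 1 := by simp [dz_apply]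
@[simp] theorem dx_zS : dx zS = 0 := by simp [dx_apply]
@[simp] theorem Lz_cj_zS : Lz (cj zS) = 0 := by simp [Lz_cj]
@[simp] theorem dx_cj_zS : dx (cj zS) = 1 := by simp [dx_cj]
@[simp] theorem T_wS : T wS = 1 := by simp [wS]
@[simp] theorem Lb_wS : Lb wS = 0 := by simp [wS, Lb_apply]

theorem wS_apply (p : ℂ × ℝ) : wS.1 p = p.2 + I * (‖p.1‖ ^ 2 : ℝ) := by
  simp [wS, Complex.mul_conj, Complex.normSq_eq_norm_sq]

end smoothAlg
end

/-! ### Formal jets at the origin and Segre polynomials. -/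

noncomputable section

namespace smoothAlg

/-- The formal Taylor series at the origin along the derivation `D`, as a ring homomorphism. -/
def jet (D : Derivation ℂ smoothAlg smoothAlg) : smoothAlg →+* PowerSeries ℂ where
  toFun h := PowerSeries.mk fun n => ((⇑D)^[n] h).1 0 / n.factorial
  map_one' := by
    ext n
    rw [PowerSeries.coeff_mk, PowerSeries.coeff_one]
    rcases n with _ | n
    · simp
    · simp [Function.iterate_succ_apply, iterate_map_zero]
  map_zero' := by
    ext n
    simp [iterate_map_zero]
  map_add' a b := by
    ext n
    simp [iterate_map_add, add_div]
  map_mul' := by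
    have hd : ∀ (n : ℕ) (h : smoothAlg),
        ((⇑D)^[n + 1] h).1 0 / ((n + 1).factorial : ℂ) =
          (((⇑D)^[n] (D h)).1 0 / (n.factorial : ℂ)) / (n + 1) := by
      intro n h
      rw [Function.iterate_succ_apply, Nat.factorial_succ]
      push_cast
      rw [div_div, mul_comm]
    have hs : ∀ h : smoothAlg,
        PowerSeries.derivative ℂ
            (PowerSeries.mk fun n => ((⇑D)^[n] h).1 0 / (n.factorial : ℂ)) =
          PowerSeries.mk fun n => ((⇑D)^[n] (D h)).1 0 / (n.factorial : ℂ) := by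
      intro h
      ext n
      rw [PowerSeries.coeff_derivative, PowerSeries.coeff_mk, PowerSeries.coeff_mk, hd,
        div_mul_cancel₀ _ (Nat.cast_add_one_ne_zero n)]
    intro a b
    ext n
    -- `D` and the derivative of power series both obey the Leibniz rule, so the coefficient of
    -- degree `n + 1` of a product reduces to coefficients of degree `n` of products with one factor
    -- differentiated.
    induction n generalizing a b with
    | zero => simp [PowerSeries.coeff_mul]
    | succ n ih =>
      have h1 := hd n (a * b)
      rw [Derivation.leibniz, iterate_map_add, coe_add_apply, add_div] at h1
      have h2 := ih a (D b)
      have h3 := ih b (D a)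
      rw [PowerSeries.coeff_mk] at h2 h3
      rw [PowerSeries.coeff_mk, h1, smul_eq_mul, smul_eq_mul, h2, h3, ← map_add,
        div_eq_iff (Nat.cast_add_one_ne_zero n), ← PowerSeries.coeff_derivative,
        Derivation.leibniz, smul_eq_mul, smul_eq_mul, hs, hs]

variable {D : Derivation ℂ smoothAlg smoothAlg}

theorem coeff_jet (h : smoothAlg) (n : ℕ) :
    PowerSeries.coeff n (jet D h) = ((⇑D)^[n] h).1 0 / n.factorial :=
  PowerSeries.coeff_mk n fun n => ((⇑D)^[n] h).1 0 / (n.factorial : ℂ)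

theorem constantCoeff_jet (h : smoothAlg) : PowerSeries.constantCoeff (jet D h) = h.1 0 := by
  rw [← PowerSeries.coeff_zero_eq_constantCoeff_apply, coeff_jet]
  simp

theorem jet_deriv (h : smoothAlg) : jet D (D h) = PowerSeries.derivative ℂ (jet D h) := by
  ext n
  rw [PowerSeries.coeff_derivative, coeff_jet, coeff_jet, Function.iterate_succ_apply,
    Nat.factorial_succ]
  push_cast
  field_simp

theorem jet_smul (c : ℂ) (h : smoothAlg) : jet D (c • h) = c • jet D h := by
  ext n
  have : (⇑D)^[n] (c • h) = c • (⇑D)^[n] h := by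
    induction n generalizing h with
    | zero => rfl
    | succ n ih => rw [Function.iterate_succ_apply, Derivation.map_smul, ih]; rfl
  rw [PowerSeries.coeff_smul, coeff_jet, coeff_jet, this]
  simp [mul_div_assoc]

theorem jet_eq_C (h : smoothAlg) (hD : jet D (D h) = 0) : jet D h = PowerSeries.C (h.1 0) := by
  rw [jet_deriv] at hD
  apply PowerSeries.derivative.ext
  · rw [hD]; simp
  · simp [constantCoeff_jet]

theorem jet_eq_zero_iff (h : smoothAlg) : jet D h = 0 ↔ ∀ n, ((⇑D)^[n] h).1 0 = 0 := by
  rw [PowerSeries.ext_iff]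
  refine forall_congr' fun n => ?_
  rw [coeff_jet]
  simp [Nat.factorial_ne_zero]

theorem jet_dx_cj_zS : jet dx (cj zS) = PowerSeries.X := by
  apply PowerSeries.derivative.ext
  · rw [← jet_deriv]; simp
  · simp [constantCoeff_jet]

theorem jet_dx_zS : jet dx zS = 0 := by
  rw [jet_eq_C _ (by simp)]; simp

theorem jet_T_zS : jet T zS = 0 := by
  rw [jet_eq_C _ (by simp)]; simp

theorem jet_T_wS : jet T wS = PowerSeries.X := by
  apply PowerSeries.derivative.ext
  · rw [← jet_deriv]; simp
  · simp [constantCoeff_jet, wS_apply]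

theorem jet_T_cj (h : smoothAlg) : jet T (cj h) = PowerSeries.map (starRingEnd ℂ) (jet T h) := by
  ext n
  have : ∀ h, (⇑T)^[n] (cj h) = cj ((⇑T)^[n] h) := by
    induction n with
    | zero => simp
    | succ n ih => intro h; rw [Function.iterate_succ_apply, T_cj, ih]; rfl
  rw [PowerSeries.coeff_map, coeff_jet, coeff_jet, this]
  simp

/-- `jet T` is formal restriction to `z = z̄ = 0`, where the term with factor `z̄` disappears. -/
theorem jet_T_Lz (h : smoothAlg) : jet T (Lz h) = jet T (dz h) := by
  rw [Lz_eq_dz, map_add, jet_smul, map_mul, jet_T_cj, jet_T_zS]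
  simp

/-- For a CR function `h`, the jet at the origin along the Segre direction of parameter `b`:
`sL b h = h_z + 2 i b h_w`. -/
def sL (b : ℂ) (h : smoothAlg) : smoothAlg := dz h + (2 * I * b) • T h

theorem sL_add (b : ℂ) (h k : smoothAlg) : sL b (h + k) = sL b h + sL b k := by
  simp only [sL, map_add, smul_add]; abel

theorem sL_smul (b c : ℂ) (h : smoothAlg) : sL b (c • h) = c • sL b h := by
  simp only [sL, Derivation.map_smul]; module

/-- `sL b` as a linear map. -/
def sLm (b : ℂ) : smoothAlg →ₗ[ℂ] smoothAlg where
  toFun := sL b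
  map_add' := sL_add b
  map_smul' := sL_smul b

theorem sLm_pow_apply (b : ℂ) (k : ℕ) (h : smoothAlg) : ((sLm b) ^ k) h = (sL b)^[k] h := by
  rw [Module.End.pow_apply]; rfl

/-- The polynomial in `b` whose values are `((sL b)^k h)(0)`. -/
def segrePoly : ℕ → smoothAlg → Polynomial ℂ
  | 0, h => Polynomial.C (h.1 0)
  | k + 1, h => segrePoly k (dz h) + Polynomial.C (2 * I) * Polynomial.X * segrePoly k (T h)

theorem eval_segrePoly (b : ℂ) (k : ℕ) (h : smoothAlg) :
    (segrePoly k h).eval b = ((sL b)^[k] h).1 0 := by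
  induction k generalizing h with
  | zero => simp [segrePoly]
  | succ k ih =>
    rw [Function.iterate_succ_apply, ← sLm_pow_apply, sL, map_add, map_smul, sLm_pow_apply,
      sLm_pow_apply, coe_add_apply, coe_smul_apply, ← ih, ← ih]
    simp [segrePoly]

/-- `jet dx` is formal restriction to `z = w = τ = 0` with `χ` as variable, and a CR function
depends only on `z` and `w` there. -/
theorem jet_dx_of_CR {h : smoothAlg} (hh : Lb h = 0) :
    jet dx h = PowerSeries.C (h.1 0) := by
  apply jet_eq_C
  rw [dx_eq_Lb, hh, zero_add, jet_smul, map_mul, jet_dx_zS, zero_mul, smul_zero]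

theorem Lz_iterate_cj_mul (k : ℕ) (h : smoothAlg) :
    (⇑Lz)^[k] (cj zS * h) = cj zS * (⇑Lz)^[k] h := by
  induction k generalizing h with
  | zero => rfl
  | succ k ih =>
    rw [Function.iterate_succ_apply, Derivation.leibniz, Lz_cj_zS, smul_zero, add_zero, smul_eq_mul,
      ih]
    rfl

/-- `Lz` kills `z̄`, so iterating `Lz = dz + 2 i z̄ T` treats `z̄` as a constant; restriction to `z
= w = 0` then yields the Segre polynomial with `b = χ`. -/
theorem jet_dx_Lz_iterate (k : ℕ) {h : smoothAlg} (hh : Lb h = 0) :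
    jet dx ((⇑Lz)^[k] h) = (segrePoly k h : PowerSeries ℂ) := by
  induction k generalizing h with
  | zero => simp [segrePoly, jet_dx_of_CR hh]
  | succ k ih =>
    have h1 : Lb (dz h) = 0 := by rw [Lb_dz, hh, map_zero]
    have h2 : Lb (T h) = 0 := by rw [← T_Lb, hh, map_zero]
    have e : (⇑Lz)^[k] ((2 * I) • (cj zS * T h)) = (2 * I) • (cj zS * (⇑Lz)^[k] (T h)) := by
      rw [← Lz_iterate_cj_mul]
      have := map_smul ((Lz.toLinearMap) ^ k) (2 * I) (cj zS * T h)
      rwa [Module.End.pow_apply, Module.End.pow_apply] at this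
    rw [Function.iterate_succ_apply, Lz_eq_dz, iterate_map_add, e, map_add, jet_smul, map_mul,
      jet_dx_cj_zS, ih h1, ih h2]
    simp only [segrePoly, Polynomial.coe_add, Polynomial.coe_mul, Polynomial.coe_C,
      Polynomial.coe_X, PowerSeries.smul_eq_C_mul]
    ring

theorem coeff_segrePoly_of_gt (k j : ℕ) (hj : k < j) (h : smoothAlg) :
    (segrePoly k h).coeff j = 0 := by
  induction k generalizing h j with
  | zero => simp [segrePoly, Polynomial.coeff_C, hj.ne']
  | succ k ih =>
    obtain ⟨j, rfl⟩ : ∃ i, j = i + 1 := ⟨j - 1, by omega⟩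
    rw [segrePoly, Polynomial.coeff_add, mul_assoc, Polynomial.coeff_C_mul,
      Polynomial.coeff_X_mul, ih _ (by omega), ih _ (by omega)]
    simp

theorem coeff_segrePoly_self (k : ℕ) (h : smoothAlg) :
    (segrePoly k h).coeff k = (2 * I) ^ k * ((⇑T)^[k] h).1 0 := by
  induction k generalizing h with
  | zero => simp [segrePoly]
  | succ k ih =>
    rw [segrePoly, Polynomial.coeff_add, mul_assoc, Polynomial.coeff_C_mul,
      Polynomial.coeff_X_mul, ih, coeff_segrePoly_of_gt _ _ (by omega), pow_succ,
      Function.iterate_succ_apply]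
    ring

/-- In the expansion of `(dz + 2 i b T)^(k+1)` the factor `dz` is chosen exactly once, in one of `k
+ 1` places; `dz` and `T` commute. -/
theorem coeff_segrePoly_succ (k : ℕ) (h : smoothAlg) :
    (segrePoly (k + 1) h).coeff k = (k + 1) * (2 * I) ^ k * ((⇑T)^[k] (dz h)).1 0 := by
  induction k generalizing h with
  | zero => simp [segrePoly, mul_assoc]
  | succ k ih =>
    rw [segrePoly, Polynomial.coeff_add, mul_assoc, Polynomial.coeff_C_mul,
      Polynomial.coeff_X_mul, ih, coeff_segrePoly_self, pow_succ,
      Function.iterate_succ_apply, T_dz]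
    push_cast
    ring

end smoothAlg
end

/-! ### The rank-one condition and the formal normal form. -/

noncomputable section

namespace smoothAlg

variable {m : ℕ}

/-- A CR map `(x, y, t)` into `ℂ^m × ℂ × ℂ` with values in the null cone of the Hermitian form
`Im (y t̄) - ‖x‖²`. -/
structure NullCR (x : Fin m → smoothAlg) (y t : smoothAlg) : Prop where
  crx : ∀ i, Lb (x i) = 0
  cry : Lb y = 0
  crt : Lb t = 0
  null : y * cj t - cj y * t = (2 * I) • ∑ i, x i * cj (x i)

/-- For every `b`, the derivatives of positive order along the Segre direction of parameter `b`
span at most a line. -/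
def RankOne (x : Fin m → smoothAlg) (y t : smoothAlg) : Prop :=
  ∀ b : ℂ, ∃ (v : Fin m → ℂ) (v₁ v₂ : ℂ), ∀ k : ℕ, 1 ≤ k → ∃ c : ℂ,
    (∀ i, ((sL b)^[k] (x i)).1 0 = c * v i) ∧
      ((sL b)^[k] y).1 0 = c * v₁ ∧ ((sL b)^[k] t).1 0 = c * v₂

theorem Lz_iterate_mul_cj (k : ℕ) {a : smoothAlg} (ha : Lb a = 0) (h : smoothAlg) :
    (⇑Lz)^[k] (h * cj a) = (⇑Lz)^[k] h * cj a := by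
  induction k generalizing h with
  | zero => rfl
  | succ k ih =>
    rw [Function.iterate_succ_apply, Derivation.leibniz, Lz_cj, ha, map_zero, smul_zero, zero_add,
      smul_eq_mul, mul_comm, ih]
    rfl

theorem Lz_iterate_smul (k : ℕ) (c : ℂ) (h : smoothAlg) :
    (⇑Lz)^[k] (c • h) = c • (⇑Lz)^[k] h := by
  have := map_smul ((Lz.toLinearMap) ^ k) c h
  rwa [Module.End.pow_apply, Module.End.pow_apply] at this

theorem Lz_iterate_sum (k : ℕ) (h : Fin m → smoothAlg) :
    (⇑Lz)^[k] (∑ i, h i) = ∑ i, (⇑Lz)^[k] (h i) := by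
  have := map_sum ((Lz.toLinearMap) ^ k) h Finset.univ
  simp only [Module.End.pow_apply] at this
  exact this

/-- Apply `Lz` to the null equation `g - ḡ = 2 i ∑ f f̄`: it passes through conjugates of CR
functions, and for `k ≥ 1` it kills `ḡ`. Restricting to `z = w = 0` leaves an identity of series in
`χ` whose coefficients `jet dx (cj (f i))` do not depend on `k`. -/
theorem segrePoly_eq_sum {f : Fin m → smoothAlg} {g : smoothAlg} (hX : NullCR f g 1)
    {k : ℕ} (hk : 1 ≤ k) :
    (segrePoly k g : PowerSeries ℂ) =
      (2 * I) • ∑ i, (segrePoly k (f i) : PowerSeries ℂ) * jet dx (cj (f i)) := by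
  have h0 : (⇑Lz)^[k] (cj g) = 0 := by
    obtain ⟨j, rfl⟩ : ∃ j, k = j + 1 := ⟨k - 1, by omega⟩
    rw [Function.iterate_succ_apply, Lz_cj, hX.cry, map_zero, iterate_map_zero]
  have h1 := congrArg (⇑Lz)^[k] hX.null
  rw [map_one, mul_one, mul_one, iterate_map_sub, h0, sub_zero, Lz_iterate_smul,
    Lz_iterate_sum] at h1
  simp only [Lz_iterate_mul_cj k (hX.crx _)] at h1
  have h2 := congrArg (jet dx) h1
  simpa only [jet_smul, map_sum, map_mul, jet_dx_Lz_iterate k hX.cry,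
    jet_dx_Lz_iterate k (hX.crx _)] using h2

/-- The `2 × 2` minors of the tangential vectors vanish for every `b`, hence as polynomials. As `g`
is a combination of the `f i` with factors independent of `k`, the minors that involve `g` vanish
too. -/
theorem rankOne_of_tangential {f : Fin m → smoothAlg} {g : smoothAlg} (hX : NullCR f g 1)
    (hf : ∀ b : ℂ, ∃ v : Fin m → ℂ, ∀ k : ℕ, 1 ≤ k → ∃ c : ℂ,
      ∀ i, ((sL b)^[k] (f i)).1 0 = c * v i) :
    RankOne f g 1 := by
  have one : ∀ b : ℂ, ∀ k : ℕ, 1 ≤ k → ((sL b)^[k] 1).1 0 = 0 := by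
    intro b k hk
    obtain ⟨j, rfl⟩ : ∃ j, k = j + 1 := ⟨k - 1, by omega⟩
    have : sL b 1 = 0 := by simp [sL]
    rw [Function.iterate_succ_apply, this, ← sLm_pow_apply, map_zero]
    rfl
  have minor : ∀ k l : ℕ, 1 ≤ k → 1 ≤ l → ∀ i j,
      segrePoly k (f i) * segrePoly l (f j) = segrePoly l (f i) * segrePoly k (f j) := by
    intro k l hk hl i j
    refine Polynomial.funext fun b => ?_
    obtain ⟨v, hv⟩ := hf b
    obtain ⟨c, hc⟩ := hv k hk
    obtain ⟨d, hd⟩ := hv l hl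
    simp only [Polynomial.eval_mul, eval_segrePoly, hc, hd]
    ring
  have minor' : ∀ k l : ℕ, 1 ≤ k → 1 ≤ l → ∀ j,
      segrePoly k g * segrePoly l (f j) = segrePoly l g * segrePoly k (f j) := by
    intro k l hk hl j
    apply Polynomial.coe_injective
    rw [Polynomial.coe_mul, Polynomial.coe_mul, segrePoly_eq_sum hX hk, segrePoly_eq_sum hX hl,
      smul_mul_assoc, smul_mul_assoc, Finset.sum_mul, Finset.sum_mul]
    congr 1
    refine Finset.sum_congr rfl fun i _ => ?_
    have := congrArg (fun p : Polynomial ℂ => (p : PowerSeries ℂ)) (minor k l hk hl i j)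
    simp only [Polynomial.coe_mul] at this
    linear_combination (jet dx (cj (f i))) * this
  intro b
  -- A nonzero tangential component spans the line and gives the ratios. If all tangential
  -- components vanish at this `b`, the line is the `g`-axis.
  by_cases h : ∃ k, 1 ≤ k ∧ ∃ j, ((sL b)^[k] (f j)).1 0 ≠ 0
  · obtain ⟨l, hl, j, hj⟩ := h
    refine ⟨fun i => ((sL b)^[l] (f i)).1 0, ((sL b)^[l] g).1 0, 0, fun k hk =>
      ⟨((sL b)^[k] (f j)).1 0 / ((sL b)^[l] (f j)).1 0, fun i => ?_, ?_, ?_⟩⟩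
    · have := congrArg (Polynomial.eval b) (minor k l hk hl i j)
      simp only [Polynomial.eval_mul, eval_segrePoly] at this
      field_simp
      linear_combination this
    · have := congrArg (Polynomial.eval b) (minor' k l hk hl j)
      simp only [Polynomial.eval_mul, eval_segrePoly] at this
      field_simp
      linear_combination this
    · rw [one b k hk, mul_zero]
  · push Not at h
    refine ⟨0, 1, 0, fun k hk => ⟨((sL b)^[k] g).1 0, fun i => ?_, ?_, ?_⟩⟩
    · simp [h k hk i]
    · simp
    · simp [one b k hk]

/-- The first-order normalisation of a null CR map at the origin. -/
structure Normalised {n : ℕ} (x : Fin (n + 1) → smoothAlg) (y t : smoothAlg) (l : ℂ) : Prop where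
  ne : l ≠ 0
  x0 : ∀ i, (x i).1 0 = 0
  y0 : y.1 0 = 0
  t0 : t.1 0 = l
  dx0 : (dz (x 0)).1 0 = l
  dxi : ∀ i, i ≠ 0 → (dz (x i)).1 0 = 0
  Tx : ∀ i, (T (x i)).1 0 = 0
  dy : (dz y).1 0 = 0
  Ty : (T y).1 0 = l

variable {n : ℕ} {x : Fin (n + 1) → smoothAlg} {y t : smoothAlg} {l : ℂ}

/-- For `k = 1` the normalised `x`-part is `l e₀` and the `y`-part is `2 i b l`. This vector is
nonzero, so it spans the line for every `b`, and every other derivative is a multiple of it. -/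
theorem segrePoly_of_normalised (hN : Normalised x y t l) (hR : RankOne x y t) (k : ℕ)
    (hk : 1 ≤ k) :
    (∀ i, i ≠ 0 → segrePoly k (x i) = 0) ∧
      segrePoly k y = Polynomial.C (2 * I) * (Polynomial.X * segrePoly k (x 0)) := by
  have key : ∀ b : ℂ, (∀ i, i ≠ 0 → ((sL b)^[k] (x i)).1 0 = 0) ∧
      ((sL b)^[k] y).1 0 = 2 * I * (b * ((sL b)^[k] (x 0)).1 0) := by
    intro b
    obtain ⟨v, v₁, v₂, hv⟩ := hR b
    obtain ⟨c, hc, hc', -⟩ := hv k hk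
    obtain ⟨d, hd, hd', -⟩ := hv 1 le_rfl
    simp only [Function.iterate_one, sL, coe_add_apply, coe_smul_apply, hN.Tx, hN.dy, hN.Ty,
      mul_zero, add_zero, zero_add] at hd hd'
    have h0 := hd 0
    rw [hN.dx0] at h0
    have hd0 : d ≠ 0 := by rintro rfl; exact hN.ne (by simpa using h0)
    refine ⟨fun i hi => ?_, ?_⟩
    · have := hd i
      rw [hN.dxi i hi] at this
      rw [hc i, (mul_eq_zero.1 this.symm).resolve_left hd0, mul_zero]
    · have : v₁ = 2 * I * b * v 0 := by
        apply mul_left_cancel₀ hd0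
        rw [← hd', h0]; ring
      rw [hc 0, hc', this]; ring
  refine ⟨fun i hi => Polynomial.funext fun b => ?_, Polynomial.funext fun b => ?_⟩
  · rw [eval_segrePoly, (key b).1 i hi, Polynomial.eval_zero]
  · simp only [Polynomial.eval_mul, Polynomial.eval_C, Polynomial.eval_X, eval_segrePoly]
    exact (key b).2

/-- For `i = 0`, the polynomial of `y` has degree at most `k` while it equals `2 i b` times that of
`x 0`, so the coefficient of degree `k` of the latter, a multiple of `T^k (x 0)` at the origin, is
zero. For `i ≠ 0` the whole polynomial is zero. -/
theorem jet_T_x_eq_zero (hN : Normalised x y t l) (hR : RankOne x y t) (i : Fin (n + 1)) :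
    jet T (x i) = 0 := by
  rw [jet_eq_zero_iff]
  rintro (_ | k)
  · exact hN.x0 i
  have hI : (2 * I) ^ (k + 1) ≠ 0 := pow_ne_zero _ (by simp)
  obtain ⟨h1, h2⟩ := segrePoly_of_normalised hN hR (k + 1) (by omega)
  by_cases hi : i = 0
  · subst hi
    have := congrArg (fun p => Polynomial.coeff p (k + 2)) h2
    simp only [Polynomial.coeff_C_mul, Polynomial.coeff_X_mul, coeff_segrePoly_self] at this
    rw [coeff_segrePoly_of_gt _ _ (by omega)] at this
    simpa [hI] using this.symm
  · have := congrArg (fun p => Polynomial.coeff p (k + 1)) (h1 i hi)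
    simp only [coeff_segrePoly_self] at this
    simpa [hI] using this

theorem jet_T_dz_x_eq_zero (hN : Normalised x y t l) (hR : RankOne x y t) (i : Fin (n + 1))
    (hi : i ≠ 0) : jet T (dz (x i)) = 0 := by
  rw [jet_eq_zero_iff]
  intro k
  obtain ⟨h1, -⟩ := segrePoly_of_normalised hN hR (k + 1) (by omega)
  have := congrArg (fun p => Polynomial.coeff p k) (h1 i hi)
  simp only [coeff_segrePoly_succ] at this
  simpa [Nat.cast_add_one_ne_zero] using this

/-- The next coefficient of the same identity: the top one for `y` against the subleading one for `x
0`. The factor `k + 1` cancels between `(k + 1)!` and `k!`. -/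
theorem jet_T_y_eq (hN : Normalised x y t l) (hR : RankOne x y t) :
    jet T y = PowerSeries.X * jet T (dz (x 0)) := by
  ext k
  rcases k with _ | k
  · simp [coeff_jet, hN.y0]
  rw [mul_comm, PowerSeries.coeff_succ_mul_X, coeff_jet, coeff_jet]
  obtain ⟨-, h2⟩ := segrePoly_of_normalised hN hR (k + 1) (by omega)
  have := congrArg (fun p => Polynomial.coeff p (k + 1)) h2
  simp only [Polynomial.coeff_C_mul, Polynomial.coeff_X_mul, coeff_segrePoly_self,
    coeff_segrePoly_succ] at this
  have h3 : ((⇑T)^[k + 1] y).1 0 = (k + 1) * ((⇑T)^[k] (dz (x 0))).1 0 := by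
    apply mul_left_cancel₀ (pow_ne_zero (k + 1) (by simp : 2 * I ≠ 0))
    rw [this]; ring
  rw [h3, Nat.factorial_succ]
  push_cast
  have := Nat.cast_add_one_ne_zero (R := ℂ) k
  field_simp

theorem NullCR.Lz_null {x : Fin m → smoothAlg} (hX : NullCR x y t) :
    Lz y * cj t - cj y * Lz t = (2 * I) • ∑ i, Lz (x i) * cj (x i) := by
  have h := congrArg Lz hX.null
  simp only [map_sub, Derivation.map_smul, map_sum, Derivation.leibniz, Lz_cj, hX.crt, hX.cry,
    hX.crx, map_zero, zero_add, add_zero, smul_eq_mul, mul_zero] at h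
  simpa only [mul_comm (Lz y), mul_comm (Lz (x _))] using h

/-- The Levi form identity of the map. The terms with factor `2 * I` inside come from the commutator
of `Lb` and `Lz`. -/
theorem NullCR.Lb_Lz_null {x : Fin m → smoothAlg} (hX : NullCR x y t) :
    (2 * I) • (T y * cj t - cj y * T t) + Lz y * cj (Lz t) - cj (Lz y) * Lz t =
      (2 * I) • ∑ i, ((2 * I) • (T (x i) * cj (x i)) + Lz (x i) * cj (Lz (x i))) := by
  have h := congrArg Lb hX.Lz_null
  simp only [map_sub, Derivation.map_smul, map_sum, Derivation.leibniz, Lb_cj, Lb_Lz, hX.crt,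
    hX.cry, hX.crx, map_zero, zero_add, smul_eq_mul] at h
  have e : ∀ i, (2 * I) • (T (x i) * cj (x i)) + Lz (x i) * cj (Lz (x i)) =
      Lz (x i) * cj (Lz (x i)) + cj (x i) * (2 * I) • T (x i) := by
    intro i
    rw [mul_smul_comm, mul_comm (cj _), add_comm]
  simp only [e]
  rw [← h]
  simp only [Algebra.smul_def]
  ring

/-- The null equation and its `Lz` and `Lb Lz` derivatives are restricted to `z = 0`. They show in
turn that `δ = t / p` is real, that the unknown jets of `Lz y` and `Lz t` are proportional, and that
`δ` satisfies a first-order equation. -/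
theorem jet_T_t_eq (hX : NullCR x y t) (hN : Normalised x y t l) (hR : RankOne x y t) :
    ∃ r : ℝ, jet T t = (1 + PowerSeries.C (r : ℂ) * PowerSeries.X) * jet T (dz (x 0)) := by
  have hx := jet_T_x_eq_zero hN hR
  have hxi := jet_T_dz_x_eq_zero hN hR
  have hy := jet_T_y_eq hN hR
  set p := jet T (dz (x 0)) with hp
  set σ := PowerSeries.map (starRingEnd ℂ) with hσ
  have hσX : σ PowerSeries.X = PowerSeries.X := PowerSeries.map_X _
  have hpc : PowerSeries.constantCoeff p = l := by rw [hp, constantCoeff_jet, hN.dx0]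
  have hp0 : p ≠ 0 := by
    intro h
    rw [h, map_zero] at hpc
    exact hN.ne hpc.symm
  have hpc0 : PowerSeries.constantCoeff p ≠ 0 := by rw [hpc]; exact hN.ne
  have hσp0 : σ p ≠ 0 := by
    intro h
    have := congrArg PowerSeries.constantCoeff h
    rw [hσ, ← PowerSeries.coeff_zero_eq_constantCoeff_apply, PowerSeries.coeff_map,
      PowerSeries.coeff_zero_eq_constantCoeff_apply, hpc] at this
    exact hN.ne (by simpa using this)
  have hX0 : (PowerSeries.X : PowerSeries ℂ) ≠ 0 := PowerSeries.X_ne_zero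
  have e0 := congrArg (jet T) hX.null
  simp only [map_sub, map_mul, map_sum, jet_smul, hx, hy, jet_T_cj, zero_mul,
    Finset.sum_const_zero, smul_zero] at e0
  have e1 := congrArg (jet T) hX.Lz_null
  simp only [map_sub, map_mul, map_sum, jet_smul, hx, hy, jet_T_cj, map_zero, mul_zero,
    Finset.sum_const_zero, smul_zero] at e1
  have e2 := congrArg (jet T) hX.Lb_Lz_null
  simp only [map_sub, map_add, map_mul (jet T), map_sum, jet_smul, hx, hy, jet_T_cj, map_zero, mul_zero,
    smul_zero, zero_add, jet_deriv, jet_T_Lz (x _)] at e2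
  rw [Finset.sum_eq_single (0 : Fin (n + 1)) (fun i _ hi => by rw [hxi i hi, zero_mul])
    (by simp), ← hp, ← hσ] at e2
  rw [← hσ, hσX] at e0 e1
  rw [map_mul σ, hσX] at e2
  obtain ⟨δ, hδ⟩ : ∃ δ, jet T t = δ * p := ⟨jet T t * p⁻¹, by
    rw [mul_assoc, PowerSeries.inv_mul_cancel _ hpc0, mul_one]⟩
  rw [hδ] at e0 e1 e2 ⊢
  rw [map_mul σ] at e0 e1 e2
  have hδσ : σ δ = δ := by
    have : PowerSeries.X * p * σ p * (σ δ - δ) = 0 := by linear_combination e0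
    exact sub_eq_zero.1 ((mul_eq_zero.1 this).resolve_left
      (mul_ne_zero (mul_ne_zero hX0 hp0) hσp0))
  rw [hδσ] at e1 e2
  have f1 : jet T (Lz y) * δ = PowerSeries.X * jet T (Lz t) := by
    have : σ p * (jet T (Lz y) * δ - PowerSeries.X * jet T (Lz t)) = 0 := by
      linear_combination e1
    exact sub_eq_zero.1 ((mul_eq_zero.1 this).resolve_left hσp0)
  have f2 := congrArg σ f1
  rw [map_mul, map_mul, hσX, hδσ] at f2
  simp only [Derivation.leibniz, smul_eq_mul, PowerSeries.derivative_X, mul_one,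
    PowerSeries.smul_eq_C_mul] at e2
  have hC : (PowerSeries.C (2 * I) : PowerSeries ℂ) ≠ 0 := by
    rw [Ne, ← map_zero (PowerSeries.C (R := ℂ)), PowerSeries.C_injective.eq_iff]; simp
  -- After multiplication by `δ`, the relations `f1` and `f2` cancel the terms containing `Lz y` and
  -- `Lz t`; the derivative of `p` cancels as well.
  have f3 : δ - PowerSeries.X * PowerSeries.derivative ℂ δ = 1 := by
    have : PowerSeries.C (2 * I) * σ p * p * δ *
        (δ - PowerSeries.X * PowerSeries.derivative ℂ δ - 1) = 0 := by
      linear_combination δ * e2 - σ (jet T (Lz t)) * f1 + jet T (Lz t) * f2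
    refine sub_eq_zero.1 ((mul_eq_zero.1 this).resolve_left
      (mul_ne_zero (mul_ne_zero (mul_ne_zero hC hσp0) hp0) ?_))
    rintro rfl
    have := congrArg PowerSeries.constantCoeff hδ
    rw [zero_mul, map_zero, constantCoeff_jet, hN.t0] at this
    exact hN.ne this
  -- The equation is singular at degree `1`, so exactly that coefficient stays free; `δ` being real
  -- makes it real.
  have hr : ∀ k, PowerSeries.coeff k δ * (1 - k) = if k = 0 then 1 else 0 := by
    intro k
    have := congrArg (PowerSeries.coeff k) f3
    rw [map_sub, PowerSeries.coeff_one, mul_comm PowerSeries.X] at this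
    rw [← this]
    rcases k with _ | k
    · simp
    · rw [PowerSeries.coeff_succ_mul_X, PowerSeries.coeff_derivative]
      push_cast; ring
  have hreal : conj (PowerSeries.coeff 1 δ) = PowerSeries.coeff 1 δ := by
    conv_rhs => rw [← hδσ, hσ, PowerSeries.coeff_map]
  refine ⟨(PowerSeries.coeff 1 δ).re, ?_⟩
  rw [Complex.conj_eq_iff_re.1 hreal]
  congr 1
  ext k
  rw [map_add, PowerSeries.coeff_one, PowerSeries.coeff_C_mul, PowerSeries.coeff_X]
  rcases k with _ | _ | k
  · simpa using hr 0
  · simp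
  · have := hr (k + 2)
    have hk : (1 - ((k + 2 : ℕ) : ℂ)) ≠ 0 := by
      push_cast
      have := Nat.cast_add_one_ne_zero (R := ℂ) k
      intro h
      apply this
      linear_combination -h
    rw [if_neg (by omega)] at this
    simpa using (mul_eq_zero.1 this).resolve_right hk

end smoothAlg
end

/-! ### Boundary rigidity in the upper half-plane. -/

noncomputable section

/-- The upper half-plane. -/
def uhp : Set ℂ := {w | 0 < w.im}

theorem isOpen_uhp : IsOpen uhp := isOpen_lt continuous_const Complex.continuous_im

theorem convex_uhp : Convex ℝ uhp := convex_halfSpace_im_gt 0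

theorem ne_zero_of_mem_uhp {w : ℂ} (hw : w ∈ uhp) : w ≠ 0 := by
  rintro rfl; exact lt_irrefl (0 : ℝ) hw

theorem I_add_ne_zero_of_im_nonneg {w : ℂ} (hw : 0 ≤ w.im) : I + w ≠ 0 := by
  intro h
  have := congrArg Complex.im h
  simp at this
  linarith

theorem I_add_ne_zero {w : ℂ} (hw : w ∈ uhp) : I + w ≠ 0 :=
  I_add_ne_zero_of_im_nonneg (le_of_lt hw)

/-- `Q` vanishes to order `n` at the origin, as a function on the upper half-plane. -/
def FlatAt (Q : ℂ → ℂ) (n : ℕ) : Prop :=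
  ∃ C ε : ℝ, 0 < ε ∧ ∀ w ∈ uhp, ‖w‖ < ε → ‖Q w‖ ≤ C * ‖w‖ ^ n

theorem cayley_inv_mem_uhp {ζ : ℂ} (hζ : ‖ζ‖ < 1) : I * (1 + ζ) / (1 - ζ) ∈ uhp := by
  have h1 : (1 : ℂ) - ζ ≠ 0 := by
    intro h
    rw [sub_eq_zero] at h
    rw [← h] at hζ; simp at hζ
  have h2 : Complex.normSq ζ < 1 := by
    rw [Complex.normSq_eq_norm_sq]; nlinarith [norm_nonneg ζ]
  have h3 : 0 < Complex.normSq (1 - ζ) := Complex.normSq_pos.2 h1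
  change 0 < (I * (1 + ζ) / (1 - ζ)).im
  rw [Complex.div_im]
  have : (I * (1 + ζ)).im * (1 - ζ).re / normSq (1 - ζ) -
      (I * (1 + ζ)).re * (1 - ζ).im / normSq (1 - ζ) =
      (1 - normSq ζ) / normSq (1 - ζ) := by
    rw [← sub_div]
    congr 1
    simp [Complex.normSq_apply]
    ring
  rw [this]
  exact div_pos (by linarith) h3

/-- A holomorphic function with positive real part cannot decay faster than linearly at a boundary
point, by the Schwarz lemma (Harnack). Only the values on the imaginary axis near `0` enter. -/
theorem eq_zero_of_flat_of_re_nonneg {Q : ℂ → ℂ} (hQ : DifferentiableOn ℂ Q uhp)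
    (hre : ∀ w ∈ uhp, 0 ≤ (Q w).re) (hflat : FlatAt Q 2) : ∀ w ∈ uhp, Q w = 0 := by
  obtain ⟨C, ε, hε, hC⟩ := hflat
  have hI : I ∈ uhp := by change 0 < I.im; simp
  have hy : ∀ y : ℝ, 0 < y → y < ε → ‖Q (y * I)‖ ≤ C * y ^ 2 := by
    intro y hy hyε
    have hn : ‖(y * I : ℂ)‖ = y := by simp [abs_of_pos hy]
    have := hC (y * I) (by change 0 < (y * I : ℂ).im; simpa using hy) (by rwa [hn])
    rwa [hn] at this
  have hcont : ∀ a : ℝ, (∀ y : ℝ, 0 < y → y < ε → y < 1 → a ≤ C * y) → a ≤ 0 := by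
    intro a ha
    have h1 : Filter.Tendsto (fun y : ℝ => C * y) (nhdsWithin 0 (Set.Ioi 0)) (nhds (C * 0)) :=
      (Filter.tendsto_id.const_mul C).mono_left nhdsWithin_le_nhds
    rw [mul_zero] at h1
    refine ge_of_tendsto h1 ?_
    filter_upwards [Ioo_mem_nhdsGT (lt_min hε one_pos)] with y hy
    exact ha y hy.1 (lt_of_lt_of_le hy.2 (min_le_left _ _))
      (lt_of_lt_of_le hy.2 (min_le_right _ _))
  rcases (hre I hI).eq_or_lt with h0 | h0
  -- If the real part attains its minimum `0` at `I`, then `Q` is constant by the maximum principle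
  -- for `1 / (1 + Q - Q I)`, and a flat constant is zero.
  · have hconst : ∀ w ∈ uhp, Q w = Q I := by
      have hden : ∀ w ∈ uhp, 1 ≤ (1 + (Q w - Q I)).re := by
        intro w hw
        simp only [Complex.add_re, Complex.one_re, Complex.sub_re, ← h0]
        linarith [hre w hw]
      have hne : ∀ w ∈ uhp, 1 + (Q w - Q I) ≠ 0 := by
        intro w hw h
        have := hden w hw
        rw [h] at this; simp at this; linarith
      have hd : DifferentiableOn ℂ (fun w => (1 + (Q w - Q I))⁻¹) uhp :=
        ((hQ.sub_const _).const_add _).inv hne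
      have hmax : IsMaxOn (norm ∘ fun w => (1 + (Q w - Q I))⁻¹) uhp I := by
        intro w hw
        simp only [Set.mem_ofPred_eq, Function.comp, sub_self, add_zero, inv_one, norm_one, norm_inv]
        exact inv_le_one_of_one_le₀ ((hden w hw).trans (Complex.re_le_norm _))
      have := Complex.eqOn_of_isPreconnected_of_isMaxOn_norm convex_uhp.isPreconnected
        isOpen_uhp hd hI hmax
      intro w hw
      have h1 := this hw
      simp only [Function.const_apply, sub_self, add_zero, inv_one] at h1
      have h2 := inv_eq_one.1 h1
      linear_combination h2
    have h1 : ‖Q I‖ ≤ 0 := by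
      refine hcont _ fun y hy0 hy1 hy2 => ?_
      have h2 := hy y hy0 hy1
      rw [hconst (y * I) (by change 0 < (y * I : ℂ).im; simpa using hy0)] at h2
      have hC0 : 0 ≤ C := by
        by_contra hneg
        have := (norm_nonneg _).trans h2
        nlinarith [pow_pos hy0 2]
      have h3 : y ^ 2 ≤ y := by nlinarith
      exact h2.trans (mul_le_mul_of_nonneg_left h3 hC0)
    intro w hw
    rw [hconst w hw]
    exact norm_le_zero_iff.1 h1
  · exfalso
    set c : ℂ → ℂ := fun ζ => I * (1 + ζ) / (1 - ζ) with hc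
    have hcd : DifferentiableOn ℂ c (Metric.ball 0 1) := by
      refine DifferentiableOn.div (by fun_prop) (by fun_prop) fun ζ hζ h => ?_
      rw [sub_eq_zero] at h
      rw [← h] at hζ; simp at hζ
    have hcm : Set.MapsTo c (Metric.ball 0 1) uhp := fun ζ hζ =>
      cayley_inv_mem_uhp (by simpa using hζ)
    have hne : ∀ w ∈ uhp, Q w + conj (Q I) ≠ 0 := by
      intro w hw h
      have := congrArg Complex.re h
      simp at this
      linarith [hre w hw]
    -- Both sides are carried to the disc: `c` sends `0` to `I`, and the outer map sends the right
    -- half-plane to the disc and `Q I` to `0`.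
    set S : ℂ → ℂ := fun ζ => (Q (c ζ) - Q I) / (Q (c ζ) + conj (Q I)) with hS
    have hSd : DifferentiableOn ℂ S (Metric.ball 0 1) :=
      ((hQ.comp hcd hcm).sub_const _).div ((hQ.comp hcd hcm).add_const _)
        fun ζ hζ => hne _ (hcm hζ)
    have hc0 : c 0 = I := by simp [hc]
    have hS0 : S 0 = 0 := by simp [hS, hc0]
    have hSm : Set.MapsTo S (Metric.ball 0 1) (Metric.closedBall 0 1) := by
      intro ζ hζ
      rw [mem_closedBall_zero_iff, hS, norm_div]
      refine div_le_one_of_le₀ ?_ (norm_nonneg _)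
      have h1 := hre _ (hcm hζ)
      rw [← sq_le_sq₀ (norm_nonneg _) (norm_nonneg _), ← Complex.normSq_eq_norm_sq,
        ← Complex.normSq_eq_norm_sq, Complex.normSq_apply, Complex.normSq_apply]
      simp
      nlinarith
    have hSch : ∀ ζ : ℂ, ‖ζ‖ < 1 → ‖S ζ‖ ≤ ‖ζ‖ := fun ζ hζ =>
      Complex.norm_le_norm_of_mapsTo_ball hSd hSm hS0 hζ
    have h1 : ‖Q I‖ ≤ 0 := by
      have : ‖Q I‖ / 2 ≤ 0 := by
        refine hcont _ fun y hy0 hy1 hy2 => ?_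
        have hy0' : (y : ℂ) + 1 ≠ 0 := by
          exact_mod_cast (by positivity : y + 1 ≠ 0)
        have hζn : ‖(((y - 1) / (y + 1) : ℝ) : ℂ)‖ = (1 - y) / (1 + y) := by
          rw [Complex.norm_real, Real.norm_eq_abs, abs_div, abs_of_neg (by linarith : y - 1 < 0),
            abs_of_pos (by linarith : 0 < y + 1)]
          congr 1 <;> ring
        have hζ1 : ‖(((y - 1) / (y + 1) : ℝ) : ℂ)‖ < 1 := by
          rw [hζn, div_lt_one (by linarith)]; linarith
        -- The point `(y - 1) / (y + 1)` of the disc corresponds to `y I`. The Schwarz inequality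
        -- there reads `‖Q I‖ * y ≤ ‖Q (y I)‖`, against the bound `C * y ^ 2`.
        have hcζ : c (((y - 1) / (y + 1) : ℝ) : ℂ) = y * I := by
          have : (1 : ℂ) - (y - 1) / (y + 1) ≠ 0 := by
            intro h
            field_simp at h
            ring_nf at h
            norm_num at h
          simp only [hc]
          push_cast
          rw [div_eq_iff this]
          field_simp
          ring
        have h2 := hSch _ hζ1
        have hyI : (y * I : ℂ) ∈ uhp := by change 0 < (y * I : ℂ).im; simpa using hy0
        rw [hζn, hS] at h2
        simp only [hcζ] at h2
        rw [norm_div, div_le_div_iff₀ (norm_pos_iff.2 (hne _ hyI)) (by linarith)] at h2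
        have h3 := hy y hy0 hy1
        have h4 : ‖Q (y * I) + conj (Q I)‖ ≤ ‖Q (y * I)‖ + ‖Q I‖ := by
          simpa using norm_add_le (Q (y * I)) (conj (Q I))
        have h5 : ‖Q I‖ - ‖Q (y * I)‖ ≤ ‖Q (y * I) - Q I‖ := by
          rw [norm_sub_rev]; exact norm_sub_norm_le _ _
        have h6 : (‖Q I‖ - ‖Q (y * I)‖) * (1 + y) ≤ (1 - y) * (‖Q (y * I)‖ + ‖Q I‖) := by
          calc _ ≤ ‖Q (y * I) - Q I‖ * (1 + y) := by gcongr
            _ ≤ _ := h2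
            _ ≤ _ := by
              have : 0 ≤ 1 - y := by linarith
              gcongr
        have h7 : ‖Q I‖ * y ≤ C * y ^ 2 := by nlinarith
        have h8 : ‖Q I‖ ≤ C * y := by
          have : ‖Q I‖ * y ≤ (C * y) * y := by linarith
          exact le_of_mul_le_mul_right this hy0
        linarith [norm_nonneg (Q I)]
      linarith
    have := norm_le_zero_iff.1 h1
    rw [this] at h0
    simp at h0

/-- The Cayley transform of the upper half-plane onto the disc. -/
def cayley (w : ℂ) : ℂ := (I - w) / (I + w)

theorem one_sub_cayley {w : ℂ} (hw : I + w ≠ 0) : 1 - cayley w = 2 * w / (I + w) := by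
  rw [cayley]; field_simp; ring

theorem one_add_cayley {w : ℂ} (hw : I + w ≠ 0) : 1 + cayley w = 2 * I / (I + w) := by
  rw [cayley]; field_simp; ring

theorem norm_le_norm_one_sub_cayley {w : ℂ} (hw : w ∈ uhp) (h1 : ‖w‖ ≤ 1) :
    ‖w‖ ≤ ‖1 - cayley w‖ := by
  have h0 := I_add_ne_zero hw
  rw [one_sub_cayley h0, norm_div, le_div_iff₀ (norm_pos_iff.2 h0)]
  have : ‖I + w‖ ≤ 2 := by
    calc _ ≤ ‖I‖ + ‖w‖ := norm_add_le _ _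
      _ ≤ 2 := by simp; linarith
  simp
  nlinarith [norm_nonneg w]

theorem re_I_div (w : ℂ) : (I / w).re = w.im / ‖w‖ ^ 2 := by
  rw [Complex.div_re, ← Complex.normSq_eq_norm_sq]; simp

theorem norm_one_sub_cayley_ge_of_flat {G : ℂ → ℂ} (hflat : FlatAt (fun w => G w - cayley w) 4) :
    ∃ C ε : ℝ, 0 < ε ∧ 0 ≤ C ∧ ε ≤ 1 ∧ (∀ w ∈ uhp, ‖w‖ < ε → ‖w‖ / 2 ≤ ‖1 - G w‖) ∧
      ∀ w ∈ uhp, ‖w‖ < ε → ‖G w - cayley w‖ ≤ C * ‖w‖ ^ 4 := by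
  obtain ⟨C, ε, hε, hC⟩ := hflat
  set D := max C 1 with hD
  have hD1 : 1 ≤ D := le_max_right _ _
  have hC' : ∀ w ∈ uhp, ‖w‖ < ε → ‖G w - cayley w‖ ≤ D * ‖w‖ ^ 4 := fun w hw h =>
    (hC w hw h).trans (mul_le_mul_of_nonneg_right (le_max_left _ _) (by positivity))
  -- The bound `1 / (2 * D)` ensures `D * ‖w‖ ^ 4 ≤ ‖w‖ / 2`, so the error is at most half of the
  -- lower bound for `1 - cayley w`.
  refine ⟨D, min ε (1 / (2 * D)), lt_min hε (by positivity), by linarith,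
    (min_le_right _ _).trans ?_, ?_, fun w hw h => hC' w hw (h.trans_le (min_le_left _ _))⟩
  · rw [div_le_one (by positivity)]; linarith
  · intro w hw h
    have h1 := hC' w hw (h.trans_le (min_le_left _ _))
    have h2 : ‖w‖ < 1 / (2 * D) := h.trans_le (min_le_right _ _)
    rw [lt_div_iff₀ (by positivity)] at h2
    have h3 : ‖w‖ ≤ 1 := by nlinarith [norm_nonneg w]
    have h4 := norm_le_norm_one_sub_cayley hw h3
    have h5 : ‖1 - cayley w‖ - ‖G w - cayley w‖ ≤ ‖1 - G w‖ := by
      have := norm_sub_norm_le (1 - cayley w) (G w - cayley w)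
      rwa [sub_sub_sub_cancel_right] at this
    have h6 : D * ‖w‖ ^ 4 ≤ ‖w‖ / 2 := by
      have : ‖w‖ ^ 4 ≤ ‖w‖ ^ 2 := pow_le_pow_of_le_one (norm_nonneg _) h3 (by norm_num)
      nlinarith [norm_nonneg w]
    linarith

/-- A Burns–Krantz rigidity theorem in the upper half-plane. -/
theorem eq_cayley_of_flat {G : ℂ → ℂ} (hG : DifferentiableOn ℂ G uhp)
    (hle : ∀ w ∈ uhp, ‖G w‖ ≤ 1) (hflat : FlatAt (fun w => G w - cayley w) 4) :
    ∀ w ∈ uhp, G w = cayley w := by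
  obtain ⟨C, ε, hε, hC0, hε1, hlow, hC⟩ := norm_one_sub_cayley_ge_of_flat hflat
  have hG1 : ∀ w ∈ uhp, 1 - G w ≠ 0 := by
    intro w₀ hw₀ h
    have h1 : G w₀ = 1 := by linear_combination -h
    have hmax : IsMaxOn (norm ∘ G) uhp w₀ := by
      intro w hw
      simp only [Set.mem_ofPred_eq, Function.comp, h1, norm_one]
      exact hle w hw
    have h2 := Complex.eqOn_of_isPreconnected_of_isMaxOn_norm convex_uhp.isPreconnected
      isOpen_uhp hG hw₀ hmax
    have hn : ‖((ε / 2 : ℝ) * I : ℂ)‖ = ε / 2 := by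
      rw [norm_mul, Complex.norm_real, norm_I, mul_one, Real.norm_eq_abs, abs_of_pos (by linarith)]
    have hm : ((ε / 2 : ℝ) * I : ℂ) ∈ uhp := by
      change 0 < ((ε / 2 : ℝ) * I : ℂ).im
      rw [Complex.im_ofReal_mul]; simpa using hε
    have h3 := hlow _ hm (by rw [hn]; linarith)
    have h4 := h2 hm
    simp only [Function.const_apply, h1] at h4
    rw [h4, hn] at h3
    simp at h3
    linarith
  -- Since `I / w = (1 + cayley w) / (1 - cayley w)`, this compares `G` and `cayley` after the disc
  -- is mapped to the right half-plane.
  set Q : ℂ → ℂ := fun w => (1 + G w) / (1 - G w) - I / w with hQ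
  have hQd : DifferentiableOn ℂ Q uhp :=
    ((hG.const_add _).div (hG.const_sub _) hG1).sub
      ((differentiableOn_const _).div differentiableOn_id fun w hw => ne_zero_of_mem_uhp hw)
  have hqre : ∀ w ∈ uhp, 0 ≤ ((1 + G w) / (1 - G w)).re := by
    intro w hw
    rw [Complex.div_re, ← add_div]
    refine div_nonneg ?_ (Complex.normSq_nonneg _)
    have := hle w hw
    have h2 : normSq (G w) ≤ 1 := by
      rw [Complex.normSq_eq_norm_sq]; nlinarith [norm_nonneg (G w)]
    rw [Complex.normSq_apply] at h2
    simp
    nlinarith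
  have hQeq : ∀ w ∈ uhp, Q w = 2 * (G w - cayley w) / ((1 - G w) * (1 - cayley w)) := by
    intro w hw
    have h0 := ne_zero_of_mem_uhp hw
    have h1 := I_add_ne_zero hw
    have h2 := hG1 w hw
    have h3 : I / w = (1 + cayley w) / (1 - cayley w) := by
      rw [one_add_cayley h1, one_sub_cayley h1]; field_simp
    have h4 : 1 - cayley w ≠ 0 := by
      rw [one_sub_cayley h1]; simp [h0, h1]
    simp only [hQ]
    rw [h3, div_sub_div _ _ h2 h4]
    congr 1
    ring
  -- Each of `1 - G` and `1 - cayley` is at least of order `‖w‖`, so flatness of order `4` leaves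
  -- order `2`.
  have hQflat : ∀ w ∈ uhp, ‖w‖ < ε → ‖Q w‖ ≤ 4 * C * ‖w‖ ^ 2 := by
    intro w hw h
    have hpos : 0 < ‖w‖ := norm_pos_iff.2 (ne_zero_of_mem_uhp hw)
    have h1 := hlow w hw h
    have h2 := norm_le_norm_one_sub_cayley hw (by linarith)
    rw [hQeq w hw, norm_div, norm_mul, norm_mul]
    have h3 : ‖w‖ / 2 * ‖w‖ ≤ ‖1 - G w‖ * ‖1 - cayley w‖ := by gcongr
    rw [div_le_iff₀ (lt_of_lt_of_le (by positivity) h3)]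
    calc ‖(2 : ℂ)‖ * ‖G w - cayley w‖ ≤ 2 * (C * ‖w‖ ^ 4) := by
          rw [Complex.norm_ofNat]; gcongr; exact hC w hw h
      _ = 4 * C * ‖w‖ ^ 2 * (‖w‖ / 2 * ‖w‖) := by ring
      _ ≤ _ := by gcongr
  have hQre : ∀ w ∈ uhp, 0 ≤ (Q w).re := by
    intro w₀ hw₀
    have hpos : 0 < ‖w₀‖ := norm_pos_iff.2 (ne_zero_of_mem_uhp hw₀)
    -- On the horocycle `η * ‖w‖ ^ 2 = Im w` the real part of `I / w` is exactly `η`, so `Re Q ≥ -η`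
    -- there. The maximum principle extends this to the horodisc; letting `η` tend to `0` gives `Re
    -- Q ≥ 0`.
    have key : ∀ η : ℝ, 0 < η → η * ‖w₀‖ ^ 2 < w₀.im → -η ≤ (Q w₀).re := by
      intro η hη hηw
      set a : ℂ := ((1 / (2 * η) : ℝ) : ℂ) * I with ha
      have hdist : ∀ w : ℂ, dist w a ^ 2 = (1 / (2 * η)) ^ 2 + (η * ‖w‖ ^ 2 - w.im) / η := by
        intro w
        rw [Complex.dist_eq, ← Complex.normSq_eq_norm_sq, ← Complex.normSq_eq_norm_sq,
          Complex.normSq_apply, Complex.normSq_apply, ha]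
        simp
        field_simp
        ring
      have hr : 0 < 1 / (2 * η) := by positivity
      have hball : ∀ w, w ∈ Metric.ball a (1 / (2 * η)) ↔ η * ‖w‖ ^ 2 < w.im := by
        intro w
        rw [Metric.mem_ball, ← sq_lt_sq₀ dist_nonneg hr.le, hdist, add_lt_iff_neg_left,
          div_neg_iff]
        constructor
        · rintro (h | h) <;> linarith [h.1, h.2]
        · intro h; right; exact ⟨by linarith, hη⟩
      have hcball : ∀ w, w ∈ Metric.closedBall a (1 / (2 * η)) → η * ‖w‖ ^ 2 ≤ w.im := by
        intro w hw
        rw [Metric.mem_closedBall, ← sq_le_sq₀ dist_nonneg hr.le, hdist, add_le_iff_nonpos_right,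
          div_le_iff₀ hη] at hw
        linarith
      have hcm : ∀ w, w ∈ Metric.closedBall a (1 / (2 * η)) → w ≠ 0 → w ∈ uhp := by
        intro w hw h0
        have := norm_pos_iff.2 h0
        exact lt_of_lt_of_le (by positivity) (hcball w hw)
      have hsph : ∀ w, w ∈ Metric.sphere a (1 / (2 * η)) → η * ‖w‖ ^ 2 = w.im := by
        intro w hw
        have h := hdist w
        rw [Metric.mem_sphere.1 hw] at h
        have : (η * ‖w‖ ^ 2 - w.im) / η = 0 := by linarith
        rw [div_eq_zero_iff] at this
        rcases this with h | h <;> linarith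
      -- The horocycle touches the boundary at `0`. Flatness gives `Q → 0` there, so the value `1 =
      -- exp 0` makes `exp (-Q)` continuous on the closed disc.
      set U : ℂ → ℂ := fun w => if w = 0 then 1 else cexp (-Q w) with hU
      have hUat : ∀ w ∈ uhp, DifferentiableAt ℂ U w := by
        intro w hw
        have h1 : DifferentiableAt ℂ (fun w => cexp (-Q w)) w :=
          ((hQd.differentiableAt (isOpen_uhp.mem_nhds hw)).neg).cexp
        refine h1.congr_of_eventuallyEq ?_
        filter_upwards [isOpen_uhp.mem_nhds hw] with v hv
        simp [hU, ne_zero_of_mem_uhp hv]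
      have hUc : DiffContOnCl ℂ U (Metric.ball a (1 / (2 * η))) := by
        refine ⟨fun w hw => (hUat w ?_).differentiableWithinAt, ?_⟩
        · have := (hball w).1 hw
          exact lt_of_le_of_lt (by positivity) this
        · rw [closure_ball _ hr.ne']
          intro w hw
          by_cases h0 : w = 0
          · subst h0
            rw [ContinuousWithinAt]
            have hQ0 : Filter.Tendsto (fun w => if w = 0 then (0 : ℂ) else Q w)
                (nhdsWithin 0 (Metric.closedBall a (1 / (2 * η)))) (nhds 0) := by
              have hlim : Filter.Tendsto (fun w : ℂ => 4 * C * ‖w‖ ^ 2)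
                  (nhdsWithin 0 (Metric.closedBall a (1 / (2 * η)))) (nhds 0) := by
                have : Continuous fun w : ℂ => 4 * C * ‖w‖ ^ 2 := by fun_prop
                simpa using (this.tendsto 0).mono_left nhdsWithin_le_nhds
              refine squeeze_zero_norm' ?_ hlim
              filter_upwards [self_mem_nhdsWithin,
                nhdsWithin_le_nhds (Metric.ball_mem_nhds (0 : ℂ) hε)] with v hv hvε
              by_cases hv0 : v = 0
              · simp [hv0]
              · rw [if_neg hv0]
                exact hQflat v (hcm v hv hv0) (by simpa using hvε)
            have h2 := ((Complex.continuous_exp.comp continuous_neg).tendsto 0).comp hQ0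
            have h3 : U 0 = (cexp ∘ Neg.neg) (0 : ℂ) := by simp [hU]
            rw [h3]
            refine h2.congr fun v => ?_
            by_cases hv : v = 0 <;> simp [hU, hv]
          · exact (hUat w (hcm w hw h0)).continuousAt.continuousWithinAt
      have hbd := Complex.norm_le_of_forall_mem_frontier_norm_le Metric.isBounded_ball hUc
        (C := Real.exp η) (fun w hw => by
          rw [frontier_ball _ hr.ne'] at hw
          by_cases h0 : w = 0
          · simp only [hU, h0, if_true, norm_one]
            exact Real.one_le_exp hη.le
          · have hwu := hcm w (Metric.sphere_subset_closedBall hw) h0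
            simp only [hU, h0, if_false, Complex.norm_exp]
            apply Real.exp_le_exp.2
            have h1 := hqre w hwu
            have h2 := hsph w hw
            have h3 : (I / w).re = η := by
              rw [re_I_div, ← h2, mul_div_cancel_right₀]
              have := norm_pos_iff.2 h0
              positivity
            simp only [hQ, Complex.neg_re, Complex.sub_re, h3]
            linarith)
        (subset_closure ((hball w₀).2 hηw))
      simp only [hU, ne_zero_of_mem_uhp hw₀, if_false, Complex.norm_exp] at hbd
      have := Real.exp_le_exp.1 hbd
      simp at this
      linarith
    by_contra hneg
    push Not at hneg
    have him : 0 < w₀.im := hw₀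
    set η := min (-(Q w₀).re / 2) (w₀.im / (2 * ‖w₀‖ ^ 2)) with hη
    have h1 : 0 < η := lt_min (by linarith) (by positivity)
    have h2 : η * ‖w₀‖ ^ 2 < w₀.im := by
      have : η ≤ w₀.im / (2 * ‖w₀‖ ^ 2) := min_le_right _ _
      rw [le_div_iff₀ (by positivity)] at this
      nlinarith [mul_pos h1 (pow_pos hpos 2)]
    have h3 := key η h1 h2
    have h4 : η ≤ -(Q w₀).re / 2 := min_le_left _ _
    linarith
  have hfin := eq_zero_of_flat_of_re_nonneg hQd hQre ⟨4 * C, ε, hε, hQflat⟩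
  intro w hw
  have h1 := hfin w hw
  have h2 : 1 - cayley w ≠ 0 := by
    rw [one_sub_cayley (I_add_ne_zero hw)]
    simp [ne_zero_of_mem_uhp hw, I_add_ne_zero hw]
  rw [hQeq w hw, div_eq_zero_iff] at h1
  rcases h1 with h | h
  · rcases mul_eq_zero.1 h with h | h
    · norm_num at h
    · exact sub_eq_zero.1 h
  · exact absurd h (mul_ne_zero (hG1 w hw) h2)

/-- If the derivatives of `M 0` of order less than `n` tend to zero at the origin and the one of
order `n` is bounded there, then `M 0` vanishes to order `n`. -/
theorem flatAt_of_tendsto (n : ℕ) (M : ℕ → ℂ → ℂ)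
    (hM : ∀ j, ∀ w ∈ uhp, HasDerivAt (M j) (M (j + 1) w) w)
    (h0 : ∀ j < n, Filter.Tendsto (M j) (nhdsWithin 0 uhp) (nhds 0)) (hb : FlatAt (M n) 0) :
    FlatAt (M 0) n := by
  induction n generalizing M with
  | zero => exact hb
  | succ n ih =>
    obtain ⟨C, ε, hε, hC⟩ := ih (fun j => M (j + 1)) (fun j => hM (j + 1))
      (fun j hj => h0 (j + 1) (by omega)) hb
    refine ⟨C, ε, hε, fun w hw hwε => ?_⟩
    have hwpos : 0 < ‖w‖ := norm_pos_iff.2 (ne_zero_of_mem_uhp hw)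
    have hC0 : 0 ≤ C := by
      have := (norm_nonneg _).trans (hC w hw hwε)
      exact nonneg_of_mul_nonneg_left this (by positivity)
    -- The origin is not in the half-plane, so the mean value inequality is used between `s * w` and
    -- `w`, on a convex set where the derivative is `O(‖w‖ ^ n)`; then `s` tends to `0`.
    have key : ∀ s ∈ Set.Ioo (0 : ℝ) 1, ‖M 0 w - M 0 (s * w)‖ ≤ C * ‖w‖ ^ (n + 1) := by
      intro s hs
      have hsw : (s * w : ℂ) ∈ uhp := by
        change 0 < (s * w : ℂ).im
        rw [Complex.im_ofReal_mul]; exact mul_pos hs.1 hw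
      have hconv : Convex ℝ (uhp ∩ Metric.closedBall 0 ‖w‖) :=
        convex_uhp.inter (convex_closedBall _ _)
      have h1 := hconv.norm_image_sub_le_of_norm_hasDerivWithin_le
        (f := M 0) (f' := M 1) (C := C * ‖w‖ ^ n)
        (fun v hv => (hM 0 v hv.1).hasDerivWithinAt)
        (fun v hv => by
          have hv2 : ‖v‖ ≤ ‖w‖ := by simpa using hv.2
          refine (hC v hv.1 (hv2.trans_lt hwε)).trans ?_
          gcongr)
        (x := s * w) (y := w)
        ⟨hsw, by
          rw [mem_closedBall_zero_iff, norm_mul, Complex.norm_real, Real.norm_eq_abs,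
            abs_of_pos hs.1]
          nlinarith [hs.2]⟩ ⟨hw, by simp⟩
      refine h1.trans ?_
      have h2 : ‖w - s * w‖ ≤ ‖w‖ := by
        have : w - s * w = ((1 - s : ℝ) : ℂ) * w := by push_cast; ring
        rw [this, norm_mul, Complex.norm_real, Real.norm_eq_abs, abs_of_pos (by linarith [hs.2])]
        nlinarith [hs.1]
      calc C * ‖w‖ ^ n * ‖w - s * w‖ ≤ C * ‖w‖ ^ n * ‖w‖ := by gcongr
        _ = _ := by ring
    have hlim : Filter.Tendsto (fun s : ℝ => ‖M 0 w - M 0 (s * w)‖)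
        (nhdsWithin 0 (Set.Ioi 0)) (nhds ‖M 0 w - 0‖) := by
      refine ((h0 0 (by omega)).comp ?_ |>.const_sub _).norm
      refine tendsto_nhdsWithin_iff.2 ⟨?_, ?_⟩
      · have : Continuous fun s : ℝ => (s * w : ℂ) := by fun_prop
        simpa using (this.tendsto 0).mono_left nhdsWithin_le_nhds
      · filter_upwards [self_mem_nhdsWithin] with s hs
        change 0 < (s * w : ℂ).im
        rw [Complex.im_ofReal_mul]; exact mul_pos hs hw
    rw [sub_zero] at hlim
    refine le_of_tendsto hlim ?_
    filter_upwards [Ioo_mem_nhdsGT (zero_lt_one (α := ℝ))] with s hs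
    exact key s hs

end

/-! ### Means of CR functions over circles are holomorphic. -/

noncomputable section

/-- Differentiation under the integral sign for an integrand of class `C¹`. -/
theorem hasFDerivAt_intervalIntegral_of_contDiffAt {G : ℂ × ℝ → ℂ} {U : Set ℂ} (hU : IsOpen U)
    (hG : ∀ w ∈ U, ∀ θ : ℝ, ContDiffAt ℝ 1 G (w, θ)) {w₀ : ℂ} (hw₀ : w₀ ∈ U) (a b : ℝ) :
    HasFDerivAt (fun w => ∫ θ in a..b, G (w, θ))
      (∫ θ in a..b, (fderiv ℝ G (w₀, θ)).comp (ContinuousLinearMap.inl ℝ ℂ ℝ)) w₀ := by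
  obtain ⟨ε, hε, hball⟩ := Metric.nhds_basis_closedBall.mem_iff.1 (hU.mem_nhds hw₀)
  have hc : ∀ w ∈ U, Continuous fun θ : ℝ => G (w, θ) := fun w hw =>
    continuous_iff_continuousAt.2 fun θ =>
      (hG w hw θ).continuousAt.comp (f := fun θ : ℝ => (w, θ)) (by fun_prop)
  have hfc : ∀ w ∈ U, ∀ θ, ContinuousAt
      (fun q : ℂ × ℝ => (fderiv ℝ G q).comp (ContinuousLinearMap.inl ℝ ℂ ℝ)) (w, θ) :=
    fun w hw θ => (((hG w hw θ).fderiv_right (m := 0) (by simp)).continuousAt).clm_comp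
      continuousAt_const
  have hK : IsCompact (Metric.closedBall w₀ ε ×ˢ Set.uIcc a b) :=
    (isCompact_closedBall _ _).prod isCompact_uIcc
  obtain ⟨B, hB⟩ := hK.exists_bound_of_continuousOn
    (f := fun q : ℂ × ℝ => (fderiv ℝ G q).comp (ContinuousLinearMap.inl ℝ ℂ ℝ))
    (fun q hq => (hfc q.1 (hball hq.1) q.2).continuousWithinAt)
  refine intervalIntegral.hasFDerivAt_integral_of_dominated_of_fderiv_le (𝕜 := ℝ)
    (F := fun w θ => G (w, θ))
    (F' := fun w θ => (fderiv ℝ G (w, θ)).comp (ContinuousLinearMap.inl ℝ ℂ ℝ))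
    (bound := fun _ => B) (s := Metric.ball w₀ ε) (Metric.ball_mem_nhds _ hε) ?_ ?_ ?_ ?_ ?_ ?_
  · filter_upwards [hU.mem_nhds hw₀] with w hw
    exact (hc w hw).aestronglyMeasurable
  · exact (hc w₀ hw₀).intervalIntegrable _ _
  · have : Continuous fun θ : ℝ =>
        (fderiv ℝ G (w₀, θ)).comp (ContinuousLinearMap.inl ℝ ℂ ℝ) :=
      continuous_iff_continuousAt.2 fun θ =>
        (hfc w₀ hw₀ θ).comp (f := fun θ : ℝ => (w₀, θ)) (by fun_prop)
    exact this.aestronglyMeasurable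
  · refine Filter.Eventually.of_forall fun θ hθ w hw => ?_
    exact hB (w, θ) ⟨Metric.ball_subset_closedBall hw, Set.uIoc_subset_uIcc hθ⟩
  · exact intervalIntegrable_const
  · refine Filter.Eventually.of_forall fun θ _ w hw => ?_
    have h1 := ((hG w (hball (Metric.ball_subset_closedBall hw)) θ).differentiableAt
      (by simp)).hasFDerivAt
    have h2 : HasFDerivAt (fun w : ℂ => (w, θ)) (ContinuousLinearMap.inl ℝ ℂ ℝ) w :=
      hasFDerivAt_prodMk_left w θ
    exact HasFDerivAt.comp (f := fun w : ℂ => (w, θ)) w h1 h2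

/-- The mean of `k` over the circle `|z|² = Im w`, `u = Re w`. -/
def circMean (k : ℂ × ℝ → ℂ) (w : ℂ) : ℂ :=
  Real.circleAverage (fun z => k (z, w.re)) 0 (√w.im)

/-- The CR equation with `∂/∂z̄` written in a rotated and scaled direction `v`; it is used with `v`
radial, so that `I * v` is tangent to the circle. -/
theorem fderiv_add_I_of_crL {k : ℂ × ℝ → ℂ} {p : ℂ × ℝ} (h : crL k p = 0) (v : ℂ) :
    fderiv ℝ k p (v, 0) + I * fderiv ℝ k p (I * v, 0) = 2 * conj v * (I * p.1) * du k p := by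
  have h1 : fderiv ℝ k p (1, 0) + I * fderiv ℝ k p (I, 0) = 2 * (I * p.1) * du k p := by
    simp only [crL, dzbar, smul_eq_mul] at h
    linear_combination 2 * h
  have e : ∀ a : ℂ, fderiv ℝ k p (a, 0) =
      a.re * fderiv ℝ k p (1, 0) + a.im * fderiv ℝ k p (I, 0) := by
    intro a
    have : ((a, 0) : ℂ × ℝ) = a.re • ((1, 0) : ℂ × ℝ) + a.im • ((I, 0) : ℂ × ℝ) := by
      ext <;> simp
    rw [this, map_add, map_smul, map_smul]
    simp
  have hv : conj v = v.re - v.im * I := by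
    apply Complex.ext <;> simp
  rw [e v, e (I * v), hv]
  simp only [Complex.mul_re, Complex.mul_im, I_re, I_im, zero_mul, one_mul, zero_sub, zero_add]
  push_cast
  linear_combination (v.re - v.im * I) * h1 + (v.im * fderiv ℝ k p (I, 0)) * I_sq

/-- Differentiation in `Re w` acts as `∂/∂u`, and in `Im w` it moves the radius. The CR equation
turns the radial derivative into `I` times `∂/∂u` plus an angular derivative, whose integral over
the circle is zero: these are the Cauchy–Riemann equations. The circles avoid `z = 0`, so a
singularity of `k` there is allowed. -/
theorem hasDerivAt_circMean {k : ℂ × ℝ → ℂ} (hk : ∀ p : ℂ × ℝ, p.1 ≠ 0 → ContDiffAt ℝ 1 k p)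
    (hcr : ∀ p : ℂ × ℝ, p.1 ≠ 0 → crL k p = 0) {w : ℂ} (hw : w ∈ uhp) :
    HasDerivAt (circMean k) (circMean (du k) w) w := by
  set Ψ : ℂ × ℝ → ℂ × ℝ := fun q => (circleMap 0 (√q.1.im) q.2, q.1.re) with hΨ
  have hΨc : ∀ v ∈ uhp, ∀ θ : ℝ, ContDiffAt ℝ 1 Ψ (v, θ) := by
    intro v hv θ
    have h1 : ContDiffAt ℝ 1 (fun q : ℂ × ℝ => √q.1.im) (v, θ) :=
      ContDiffAt.sqrt (imCLM.contDiff.contDiffAt.comp _ contDiffAt_fst) (ne_of_gt hv)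
    have h2 : ContDiffAt ℝ 1 (fun q : ℂ × ℝ => cexp (q.2 * I)) (v, θ) :=
      ContDiffAt.cexp ((ofRealCLM.contDiff.contDiffAt.comp _ contDiffAt_snd).mul contDiffAt_const)
    have h3 : ContDiffAt ℝ 1 (fun q : ℂ × ℝ => q.1.re) (v, θ) :=
      reCLM.contDiff.contDiffAt.comp _ contDiffAt_fst
    refine ContDiffAt.prodMk ?_ h3
    simp only [circleMap, zero_add]
    exact (ofRealCLM.contDiff.contDiffAt.comp _ h1).mul h2
  have hΨ0 : ∀ v ∈ uhp, ∀ θ : ℝ, (Ψ (v, θ)).1 ≠ 0 := by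
    intro v hv θ
    exact circleMap_ne_center (Real.sqrt_pos.2 hv).ne'
  set G : ℂ × ℝ → ℂ := k ∘ Ψ with hG
  have hGc : ∀ v ∈ uhp, ∀ θ : ℝ, ContDiffAt ℝ 1 G (v, θ) := fun v hv θ =>
    (hk _ (hΨ0 v hv θ)).comp _ (hΨc v hv θ)
  have hmain := hasFDerivAt_intervalIntegral_of_contDiffAt isOpen_uhp hGc hw 0 (2 * Real.pi)
  set D := ∫ θ in (0 : ℝ)..(2 * Real.pi),
    (fderiv ℝ G (w, θ)).comp (ContinuousLinearMap.inl ℝ ℂ ℝ) with hD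
  have hDc : Continuous fun θ : ℝ =>
      (fderiv ℝ G (w, θ)).comp (ContinuousLinearMap.inl ℝ ℂ ℝ) :=
    continuous_iff_continuousAt.2 fun θ =>
      ((((hGc w hw θ).fderiv_right (m := 0) (by simp)).continuousAt).clm_comp
        continuousAt_const).comp (f := fun θ : ℝ => (w, θ)) (by fun_prop)
  have hDapp : ∀ v, D v = ∫ θ in (0 : ℝ)..(2 * Real.pi), fderiv ℝ G (w, θ) (v, 0) := by
    intro v
    rw [hD, ContinuousLinearMap.intervalIntegral_apply (hDc.intervalIntegrable _ _)]
    rfl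
  set r := √w.im with hr
  have hr0 : 0 < r := Real.sqrt_pos.2 hw
  have hr0' : (r : ℂ) ≠ 0 := by exact_mod_cast hr0.ne'
  have hkd : ∀ θ : ℝ, HasFDerivAt k (fderiv ℝ k (circleMap 0 r θ, w.re))
      (circleMap 0 r θ, w.re) := fun θ =>
    ((hk _ (hΨ0 w hw θ)).differentiableAt (by simp)).hasFDerivAt
  have hG1 : ∀ θ : ℝ, fderiv ℝ G (w, θ) (1, 0) = du k (circleMap 0 r θ, w.re) := by
    intro θ
    have h1 : HasDerivAt (fun s : ℝ => ((w, θ) : ℂ × ℝ) + s • ((1, 0) : ℂ × ℝ)) (1, 0) 0 := by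
      simpa using ((hasDerivAt_id (0 : ℝ)).smul_const ((1, 0) : ℂ × ℝ)).const_add (w, θ)
    have h2 : HasFDerivAt G (fderiv ℝ G (w, θ)) (((w, θ) : ℂ × ℝ) + (0 : ℝ) • ((1, 0) : ℂ × ℝ)) := by
      simpa using ((hGc w hw θ).differentiableAt (by simp)).hasFDerivAt
    have h3 := h2.comp_hasDerivAt (0 : ℝ) h1
    have h4 : HasDerivAt (fun s : ℝ => ((circleMap 0 r θ, w.re) : ℂ × ℝ) + s • ((0, 1) : ℂ × ℝ))
        (0, 1) 0 := by
      simpa using ((hasDerivAt_id (0 : ℝ)).smul_const ((0, 1) : ℂ × ℝ)).const_add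
        (circleMap 0 r θ, w.re)
    have h5 : HasFDerivAt k (fderiv ℝ k (circleMap 0 r θ, w.re))
        (((circleMap 0 r θ, w.re) : ℂ × ℝ) + (0 : ℝ) • ((0, 1) : ℂ × ℝ)) := by
      simpa using hkd θ
    have h6 := h5.comp_hasDerivAt (0 : ℝ) h4
    have h7 : (G ∘ fun s : ℝ => ((w, θ) : ℂ × ℝ) + s • ((1, 0) : ℂ × ℝ)) =
        k ∘ fun s : ℝ => ((circleMap 0 r θ, w.re) : ℂ × ℝ) + s • ((0, 1) : ℂ × ℝ) := by
      funext s
      simp [hG, hΨ, hr]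
    rw [h7] at h3
    exact h3.unique h6
  -- Since `√(Im w)` has derivative `1 / (2 r)`, increasing `Im w` moves the point radially with
  -- velocity `exp (θ I) / (2 r)`.
  have hGI : ∀ θ : ℝ, fderiv ℝ G (w, θ) (I, 0) =
      fderiv ℝ k (circleMap 0 r θ, w.re) (cexp (θ * I) / (2 * r), 0) := by
    intro θ
    have h1 : HasDerivAt (fun s : ℝ => ((w, θ) : ℂ × ℝ) + s • ((I, 0) : ℂ × ℝ)) (I, 0) 0 := by
      simpa using ((hasDerivAt_id (0 : ℝ)).smul_const ((I, 0) : ℂ × ℝ)).const_add (w, θ)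
    have h2 : HasFDerivAt G (fderiv ℝ G (w, θ)) (((w, θ) : ℂ × ℝ) + (0 : ℝ) • ((I, 0) : ℂ × ℝ)) := by
      simpa using ((hGc w hw θ).differentiableAt (by simp)).hasFDerivAt
    have h3 := h2.comp_hasDerivAt (0 : ℝ) h1
    have h4 : HasDerivAt (fun s : ℝ => (((√(w.im + s) : ℝ) * cexp (θ * I), w.re) : ℂ × ℝ))
        (cexp (θ * I) / (2 * r), 0) 0 := by
      have h41 : HasDerivAt (fun s : ℝ => √(w.im + s)) (1 / (2 * r)) 0 := by
        have := (((hasDerivAt_id (0 : ℝ)).const_add w.im).sqrt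
          (by simpa using (ne_of_gt hw : w.im ≠ 0)))
        simpa using this
      have h42 := (h41.ofReal_comp.mul_const (cexp (θ * I))).prodMk (hasDerivAt_const (0 : ℝ) w.re)
      convert h42 using 2
      push_cast
      ring
    have h5 : HasFDerivAt k (fderiv ℝ k (circleMap 0 r θ, w.re))
        (((√(w.im + 0) : ℝ) * cexp (θ * I), w.re) : ℂ × ℝ) := by
      simpa [circleMap] using hkd θ
    have h6 := h5.comp_hasDerivAt (0 : ℝ) h4
    have h7 : (G ∘ fun s : ℝ => ((w, θ) : ℂ × ℝ) + s • ((I, 0) : ℂ × ℝ)) =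
        k ∘ fun s : ℝ => (((√(w.im + s) : ℝ) * cexp (θ * I), w.re) : ℂ × ℝ) := by
      funext s
      simp [hG, hΨ, circleMap]
    rw [h7] at h3
    exact h3.unique h6
  have hθ : ∀ θ : ℝ, HasDerivAt (fun θ : ℝ => k (circleMap 0 r θ, w.re))
      (fderiv ℝ k (circleMap 0 r θ, w.re) (circleMap 0 r θ * I, 0)) θ := by
    intro θ
    have h1 := (hasDerivAt_circleMap 0 r θ).prodMk (hasDerivAt_const θ w.re)
    exact (hkd θ).comp_hasDerivAt θ h1
  have hcm : Continuous (fun θ : ℝ => (circleMap 0 r θ, w.re)) := by fun_prop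
  have hfk : Continuous fun θ : ℝ => fderiv ℝ k (circleMap 0 r θ, w.re) :=
    continuous_iff_continuousAt.2 fun θ =>
      (((hk _ (hΨ0 w hw θ)).fderiv_right (m := 0) (by simp)).continuousAt).comp
        (f := fun θ : ℝ => (circleMap 0 r θ, w.re)) hcm.continuousAt
  have hθc : Continuous fun θ : ℝ =>
      fderiv ℝ k (circleMap 0 r θ, w.re) (circleMap 0 r θ * I, 0) :=
    hfk.clm_apply (by fun_prop)
  have hduc : Continuous fun θ : ℝ => du k (circleMap 0 r θ, w.re) :=
    hfk.clm_apply continuous_const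
  have hzero : ∫ θ in (0 : ℝ)..(2 * Real.pi),
      fderiv ℝ k (circleMap 0 r θ, w.re) (circleMap 0 r θ * I, 0) = 0 := by
    rw [intervalIntegral.integral_eq_sub_of_hasDerivAt (fun θ _ => hθ θ)
      (hθc.intervalIntegrable _ _)]
    have := (periodic_circleMap 0 r) 0
    rw [zero_add] at this
    rw [this, sub_self]
  have hD1 : D 1 = ∫ θ in (0 : ℝ)..(2 * Real.pi), du k (circleMap 0 r θ, w.re) := by
    rw [hDapp]; simp only [hG1]
  have hDI : D I = I * D 1 := by
    rw [hDapp, hD1]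
    simp only [hGI]
    have e : ∀ θ : ℝ, fderiv ℝ k (circleMap 0 r θ, w.re) (cexp (θ * I) / (2 * r), 0) =
        I * du k (circleMap 0 r θ, w.re) -
          (I / (2 * r ^ 2)) * fderiv ℝ k (circleMap 0 r θ, w.re) (circleMap 0 r θ * I, 0) := by
      intro θ
      have h1 := fderiv_add_I_of_crL (hcr _ (hΨ0 w hw θ)) (cexp (θ * I) / (2 * r))
      have h2 : ((I * (cexp (θ * I) / (2 * r)), 0) : ℂ × ℝ) =
          (1 / (2 * r ^ 2) : ℝ) • ((circleMap 0 r θ * I, 0) : ℂ × ℝ) := by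
        ext
        · simp [circleMap]
          field_simp
        · simp
      have h3 : conj (cexp (θ * I) / (2 * r)) * circleMap 0 r θ = 1 / 2 := by
        have h4 : conj (cexp (θ * I)) * cexp (θ * I) = 1 := by
          rw [mul_comm, Complex.mul_conj, Complex.normSq_eq_norm_sq, Complex.norm_exp_ofReal_mul_I]
          simp
        simp only [circleMap, zero_add, map_div₀, map_mul, Complex.conj_ofReal, Complex.conj_ofNat]
        field_simp
        linear_combination h4
      simp only [hΨ] at h1
      rw [← hr, h2, map_smul] at h1
      simp only [Complex.real_smul] at h1
      push_cast at h1
      linear_combination h1 + 2 * I * du k (circleMap 0 r θ, w.re) * h3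
    simp only [e]
    rw [intervalIntegral.integral_sub ((hduc.const_mul I).intervalIntegrable _ _)
      ((hθc.const_mul _).intervalIntegrable _ _), intervalIntegral.integral_const_mul,
      intervalIntegral.integral_const_mul, hzero, mul_zero, sub_zero]
  have hlin : ((1 : ℂ →L[ℂ] ℂ).smulRight (D 1)).restrictScalars ℝ = D := by
    ext v
    have : v = v.re • (1 : ℂ) + v.im • I := by simp
    conv_rhs => rw [this, map_add, map_smul, map_smul, hDI]
    simp
    linear_combination -(D 1) * Complex.re_add_im v
  have hC : HasFDerivAt (fun v => ∫ θ in (0 : ℝ)..(2 * Real.pi), G (v, θ))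
      ((1 : ℂ →L[ℂ] ℂ).smulRight (D 1)) w := hasFDerivAt_of_restrictScalars ℝ hmain hlin
  have hC2 := hC.hasDerivAt.const_smul ((2 * Real.pi)⁻¹ : ℝ)
  simp only [ContinuousLinearMap.smulRight_apply, one_apply_eq_self, one_smul,
    hD1] at hC2
  exact hC2

end

/-! ### Flatness of circle means at the origin and the Hopf lemma. -/

noncomputable section

namespace smoothAlg

theorem coe_Lb (h : smoothAlg) (p : ℂ × ℝ) : (Lb h).1 p = crL h.1 p := rfl

theorem coe_T (h : smoothAlg) : (T h).1 = du h.1 := rfl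

theorem hasDerivAt_circMean_coe {h : smoothAlg} (hh : Lb h = 0) {w : ℂ} (hw : w ∈ uhp) :
    HasDerivAt (circMean h.1) (circMean (T h).1 w) w :=
  hasDerivAt_circMean (fun _ _ => ((contDiff h).of_le (by simp)).contDiffAt)
    (fun p _ => by rw [← coe_Lb, hh]; rfl) hw

theorem circMean_congr {k k' : ℂ × ℝ → ℂ} {w : ℂ}
    (h : ∀ z : ℂ, ‖z‖ = √w.im → k (z, w.re) = k' (z, w.re)) : circMean k w = circMean k' w := by
  apply Real.circleAverage_congr_sphere
  intro z hz
  apply h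
  rwa [mem_sphere_zero_iff_norm, abs_of_nonneg (Real.sqrt_nonneg _)] at hz

theorem hasDerivAt_circMean_div {h : smoothAlg} (hh : Lb h = 0) {w : ℂ} (hw : w ∈ uhp) :
    HasDerivAt (circMean fun p => h.1 p / p.1) (circMean (fun p => (T h).1 p / p.1) w) w := by
  have hfd : ∀ p : ℂ × ℝ, p.1 ≠ 0 → ∀ v, fderiv ℝ (fun p : ℂ × ℝ => h.1 p / p.1) p v =
      p.1⁻¹ * fderiv ℝ h.1 p v - h.1 p * (p.1 ^ 2)⁻¹ * v.1 := by
    intro p hp v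
    have h1 : HasFDerivAt (fun q : ℂ × ℝ => q.1) (ContinuousLinearMap.fst ℝ ℂ ℝ) p := hasFDerivAt_fst
    have h2 := ((hasDerivAt_inv hp).hasFDerivAt.restrictScalars ℝ).comp p h1
    have h3 := ((differentiable h p).hasFDerivAt).mul h2
    have h4 : (fun p : ℂ × ℝ => h.1 p / p.1) = h.1 * (Inv.inv ∘ fun q : ℂ × ℝ => q.1) := by
      funext q; simp [div_eq_mul_inv]
    rw [h4, h3.fderiv]
    simp
    ring
  have hmain := hasDerivAt_circMean (k := fun p : ℂ × ℝ => h.1 p / p.1)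
    (fun p hp => by
      simp only [div_eq_mul_inv]
      exact ((contDiff h).of_le (by simp)).contDiffAt.mul (contDiffAt_fst.inv hp))
    (fun p hp => by
      have h0 : crL h.1 p = 0 := by rw [← coe_Lb, hh]; rfl
      simp only [crL, dzbar, du, smul_eq_mul, hfd p hp] at h0 ⊢
      linear_combination p.1⁻¹ * h0 - (1 / 2) * (h.1 p * (p.1 ^ 2)⁻¹) * I_sq) hw
  convert hmain using 1
  refine circMean_congr fun z hz => ?_
  have hz0 : z ≠ 0 := norm_pos_iff.1 (by rw [hz]; exact Real.sqrt_pos.2 hw)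
  rw [coe_T, du, du, hfd _ hz0]
  simp [div_eq_mul_inv, mul_comm]

theorem norm_circMean_le {k : ℂ × ℝ → ℂ} {w : ℂ} {C : ℝ}
    (h : ∀ z : ℂ, ‖z‖ = √w.im → ‖k (z, w.re)‖ ≤ C) : ‖circMean k w‖ ≤ C := by
  rw [circMean, Real.circleAverage, norm_smul]
  have h1 : ‖∫ θ in (0 : ℝ)..(2 * Real.pi), k (circleMap 0 (√w.im) θ, w.re)‖ ≤
      C * |2 * Real.pi - 0| :=
    intervalIntegral.norm_integral_le_of_norm_le_const fun θ _ => h _ (by simp)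
  have hpi : 0 < 2 * Real.pi := Real.two_pi_pos
  rw [sub_zero, abs_of_pos hpi] at h1
  rw [Real.norm_eq_abs, abs_of_pos (inv_pos.2 hpi), inv_mul_le_iff₀ hpi]
  linarith

theorem eventually_circle {P : ℂ × ℝ → Prop} (hP : ∀ᶠ p in nhds (0 : ℂ × ℝ), P p) :
    ∀ᶠ w in nhdsWithin (0 : ℂ) uhp, ∀ z : ℂ, ‖z‖ = √w.im → P (z, w.re) := by
  obtain ⟨ε, hε, hball⟩ := Metric.eventually_nhds_iff.1 hP
  have h1 : ∀ᶠ w in nhds (0 : ℂ), √w.im < ε := by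
    have : Continuous fun w : ℂ => √w.im := by fun_prop
    exact this.continuousAt.eventually_lt continuousAt_const (by simpa using hε)
  have h2 : ∀ᶠ w in nhds (0 : ℂ), |w.re| < ε := by
    have : Continuous fun w : ℂ => |w.re| := by fun_prop
    exact this.continuousAt.eventually_lt continuousAt_const (by simpa using hε)
  filter_upwards [nhdsWithin_le_nhds h1, nhdsWithin_le_nhds h2] with w hw1 hw2 z hz
  apply hball
  rw [dist_zero_right, Prod.norm_def, max_lt_iff]
  exact ⟨by simpa [hz] using hw1, by simpa using hw2⟩

theorem tendsto_circMean_of_eventually {k : ℂ × ℝ → ℂ}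
    (hk : ∀ ε > 0, ∀ᶠ w in nhdsWithin (0 : ℂ) uhp, ‖circMean k w‖ ≤ ε) :
    Filter.Tendsto (circMean k) (nhdsWithin 0 uhp) (nhds 0) := by
  rw [Metric.tendsto_nhds]
  intro ε hε
  filter_upwards [hk (ε / 2) (by linarith)] with w hw
  rw [dist_zero_right]
  linarith

theorem tendsto_circMean {k : ℂ × ℝ → ℂ} (hk : Continuous k) (h0 : k 0 = 0) :
    Filter.Tendsto (circMean k) (nhdsWithin 0 uhp) (nhds 0) := by
  refine tendsto_circMean_of_eventually fun ε hε => ?_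
  have h1 : ∀ᶠ p in nhds (0 : ℂ × ℝ), ‖k p‖ < ε :=
    hk.norm.continuousAt.eventually_lt continuousAt_const (by simpa [h0] using hε)
  filter_upwards [eventually_circle h1] with w hw
  exact norm_circMean_le fun z hz => (hw z hz).le

theorem flatAt_zero_of_eventually {Q : ℂ → ℂ} {C : ℝ}
    (h : ∀ᶠ w in nhdsWithin (0 : ℂ) uhp, ‖Q w‖ ≤ C) : FlatAt Q 0 := by
  rw [Filter.Eventually, Metric.mem_nhdsWithin_iff] at h
  obtain ⟨ε, hε, h⟩ := h
  refine ⟨C, ε, hε, fun w hw hwε => ?_⟩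
  have := h ⟨by simpa using hwε, hw⟩
  simpa using this

theorem flatAt_zero_of_tendsto {Q : ℂ → ℂ}
    (h : Filter.Tendsto Q (nhdsWithin 0 uhp) (nhds 0)) : FlatAt Q 0 := by
  refine flatAt_zero_of_eventually (C := 1) ?_
  filter_upwards [h.norm.eventually (gt_mem_nhds (by simp : ‖(0 : ℂ)‖ < 1))] with w hw using hw.le

theorem flatAt_zero_circMean {k : ℂ × ℝ → ℂ} (hk : Continuous k) : FlatAt (circMean k) 0 := by
  refine flatAt_zero_of_eventually (C := ‖k 0‖ + 1) ?_
  have h1 : ∀ᶠ p in nhds (0 : ℂ × ℝ), ‖k p‖ < ‖k 0‖ + 1 :=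
    hk.norm.continuousAt.eventually_lt continuousAt_const (by simp)
  filter_upwards [eventually_circle h1] with w hw
  exact norm_circMean_le fun z hz => (hw z hz).le

theorem Lb_T_iterate {h : smoothAlg} (hh : Lb h = 0) (j : ℕ) : Lb ((⇑T)^[j] h) = 0 := by
  induction j generalizing h with
  | zero => exact hh
  | succ j ih => exact ih (by rw [← T_Lb, hh, map_zero])

theorem flatAt_circMean {h : smoothAlg} (hh : Lb h = 0) (hj : jet T h = 0) (n : ℕ) :
    FlatAt (circMean h.1) n := by
  rw [jet_eq_zero_iff] at hj
  refine flatAt_of_tendsto n (fun j => circMean ((⇑T)^[j] h).1) (fun j w hw => ?_)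
    (fun j _ => tendsto_circMean (continuous _) (hj j))
    (flatAt_zero_of_tendsto (tendsto_circMean (continuous _) (hj n)))
  rw [Function.iterate_succ_apply']
  exact hasDerivAt_circMean_coe (Lb_T_iterate hh j) hw

theorem flatAt_circMean_two {h : smoothAlg} (hh : Lb h = 0) (h0 : h.1 0 = 0)
    (h1 : (T h).1 0 = 0) : FlatAt (circMean h.1) 2 := by
  refine flatAt_of_tendsto 2 (fun j => circMean ((⇑T)^[j] h).1) (fun j w hw => ?_)
    (fun j hj => ?_) (flatAt_zero_circMean (continuous _))
  · rw [Function.iterate_succ_apply']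
    exact hasDerivAt_circMean_coe (Lb_T_iterate hh j) hw
  · interval_cases j
    · exact tendsto_circMean (continuous _) h0
    · exact tendsto_circMean (continuous _) h1

theorem circleIntegrable_of_continuousOn {k : ℂ → ℂ} {r : ℝ} (hr : 0 < r)
    (hk : ContinuousOn k {z | z ≠ 0}) : CircleIntegrable k 0 r :=
  ContinuousOn.circleIntegrable hr.le <| hk.mono fun z hz => by
    rw [mem_sphere_zero_iff_norm] at hz
    exact norm_pos_iff.1 (by rw [hz]; exact hr)

theorem circMean_sub {k k' : ℂ × ℝ → ℂ} {w : ℂ} (hw : w ∈ uhp)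
    (hk : ContinuousOn k {p | p.1 ≠ 0}) (hk' : ContinuousOn k' {p | p.1 ≠ 0}) :
    circMean (fun p => k p - k' p) w = circMean k w - circMean k' w := by
  have hr : 0 < √w.im := Real.sqrt_pos.2 hw
  exact Real.circleAverage_fun_sub
    (circleIntegrable_of_continuousOn hr (hk.comp (by fun_prop) fun z hz => hz))
    (circleIntegrable_of_continuousOn hr (hk'.comp (by fun_prop) fun z hz => hz))

theorem circMean_const {w c : ℂ} {k : ℂ × ℝ → ℂ}
    (h : ∀ z : ℂ, ‖z‖ = √w.im → k (z, w.re) = c) : circMean k w = c := by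
  rw [circMean_congr (k' := fun _ => c) h]
  exact Real.circleAverage_const c _ _

/-- On a fixed circle `c` is constant, and `1 / z` has mean zero. -/
theorem circMean_div_eq_zero (c : ℝ → ℂ) {w : ℂ} (hw : w ∈ uhp) :
    circMean (fun p => c p.2 / p.1) w = 0 := by
  have hr : 0 < √w.im := Real.sqrt_pos.2 hw
  rw [circMean, Real.circleAverage_eq_circleIntegral hr.ne']
  have h1 : ∀ z : ℂ, (z - 0)⁻¹ • (c w.re / z) = c w.re * (z - 0) ^ (-2 : ℤ) := by
    intro z
    rw [sub_zero, zpow_neg, smul_eq_mul, div_eq_mul_inv]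
    norm_cast
    rw [pow_two, mul_inv]
    ring
  simp only [h1]
  rw [circleIntegral.integral_const_mul, circleIntegral.integral_sub_zpow_of_ne (by norm_num)]
  simp

theorem fderiv_eq_zero_of_CR {h : smoothAlg} (hh : Lb h = 0) (h0 : (Lz h).1 0 = 0) (v : ℂ) :
    fderiv ℝ h.1 0 (v, 0) = 0 := by
  have h1 : (Lb h).1 0 = 0 := by rw [hh]; rfl
  have e1 : (Lb h).1 0 = (1 / 2) * (fderiv ℝ h.1 0 (1, 0) + I * fderiv ℝ h.1 0 (I, 0)) := by
    simp [Lb_apply, dbar_apply, mul_add]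
  have e2 : (Lz h).1 0 = (1 / 2) * (fderiv ℝ h.1 0 (1, 0) - I * fderiv ℝ h.1 0 (I, 0)) := by
    simp [Lz_apply, dhol_apply]
  rw [e1] at h1
  rw [e2] at h0
  have a1 : fderiv ℝ h.1 0 (1, 0) = 0 := by linear_combination h1 + h0
  have a2 : fderiv ℝ h.1 0 (I, 0) = 0 := by
    linear_combination (-I) * (h1 - h0) + fderiv ℝ h.1 0 (I, 0) * I_sq
  have : ((v, 0) : ℂ × ℝ) = v.re • ((1, 0) : ℂ × ℝ) + v.im • ((I, 0) : ℂ × ℝ) := by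
    ext <;> simp
  rw [this, map_add, map_smul, map_smul, a1, a2]
  simp

/-- Subtracting `h (0, u) / z`, which has mean zero, replaces `h / z` by a difference quotient in
`z`. Strict differentiability makes it uniformly close to the `z`-part of the derivative at the
origin, which vanishes by the CR equation and the hypothesis on `Lz h`. -/
theorem tendsto_circMean_div {h : smoothAlg} (hh : Lb h = 0) (h0 : (Lz h).1 0 = 0) :
    Filter.Tendsto (circMean fun p => h.1 p / p.1) (nhdsWithin 0 uhp) (nhds 0) := by
  refine tendsto_circMean_of_eventually fun ε hε => ?_
  have hs : HasStrictFDerivAt h.1 (fderiv ℝ h.1 0) 0 :=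
    (contDiff h).contDiffAt.hasStrictFDerivAt (by simp)
  have h1 := hs.isLittleO.def hε
  rw [Prod.zero_eq_mk] at h1
  have h2 : Filter.Tendsto (fun p : ℂ × ℝ => (p, ((0, p.2) : ℂ × ℝ))) (nhds 0)
      (nhds ((0, 0), (0, 0))) := by
    have : Continuous (fun p : ℂ × ℝ => (p, ((0, p.2) : ℂ × ℝ))) := by fun_prop
    exact this.tendsto 0
  have h3 := h2.eventually h1
  filter_upwards [eventually_circle h3, self_mem_nhdsWithin] with w hw hwu
  have hc : circMean (fun p => h.1 p / p.1) w =
      circMean (fun p => h.1 p / p.1 - h.1 (0, p.2) / p.1) w := by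
    have c1 : ContinuousOn (fun p : ℂ × ℝ => h.1 p / p.1) {p | p.1 ≠ 0} :=
      ContinuousOn.div (by fun_prop) (by fun_prop) fun p hp => hp
    have c2 : ContinuousOn (fun p : ℂ × ℝ => h.1 (0, p.2) / p.1) {p | p.1 ≠ 0} :=
      ContinuousOn.div (by fun_prop) (by fun_prop) fun p hp => hp
    rw [circMean_sub hwu c1 c2,
      circMean_div_eq_zero (fun u => h.1 (0, u)) hwu, sub_zero]
  rw [hc]
  refine norm_circMean_le fun z hz => ?_
  have hz0 : 0 < ‖z‖ := by rw [hz]; exact Real.sqrt_pos.2 hwu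
  have h4 := hw z hz
  simp only [Prod.mk_sub_mk, sub_zero, sub_self] at h4
  rw [← Prod.zero_eq_mk, fderiv_eq_zero_of_CR hh h0, sub_zero] at h4
  rw [← sub_div, norm_div, div_le_iff₀ hz0]
  simpa [Prod.norm_def] using h4

/-- The derivatives of this mean are the means of `T^j h / z`, each of which tends to zero because
`T` commutes with `Lz`. -/
theorem flatAt_circMean_div {h : smoothAlg} (hh : Lb h = 0) (hj : jet T (Lz h) = 0) (n : ℕ) :
    FlatAt (circMean fun p => h.1 p / p.1) n := by
  rw [jet_eq_zero_iff] at hj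
  have e : ∀ j, Lz ((⇑T)^[j] h) = (⇑T)^[j] (Lz h) := by
    intro j
    clear hj hh
    induction j generalizing h with
    | zero => rfl
    | succ j ih => rw [Function.iterate_succ_apply, ih, ← T_Lz]; rfl
  have hlim : ∀ j, Filter.Tendsto (circMean fun p => ((⇑T)^[j] h).1 p / p.1)
      (nhdsWithin 0 uhp) (nhds 0) := fun j =>
    tendsto_circMean_div (Lb_T_iterate hh j) (by rw [e]; exact hj j)
  refine flatAt_of_tendsto n (fun j => circMean fun p => ((⇑T)^[j] h).1 p / p.1)
    (fun j w hw => ?_) (fun j _ => hlim j) (flatAt_zero_of_tendsto (hlim n))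
  rw [Function.iterate_succ_apply']
  exact hasDerivAt_circMean_div (Lb_T_iterate hh j) hw

theorem eq_zero_of_circleAverage_eq_zero {D : ℂ → ℝ} (hD : Continuous D) (h0 : ∀ z, 0 ≤ D z)
    {r : ℝ} (hA : Real.circleAverage D 0 r = 0) {z : ℂ} (hz : ‖z‖ = r) : D z = 0 := by
  by_contra hne
  have hpos : 0 < D z := lt_of_le_of_ne (h0 z) (Ne.symm hne)
  have hzs : z ∈ Metric.sphere (0 : ℂ) |r| := by
    rw [mem_sphere_zero_iff_norm, hz, ← hz, abs_of_nonneg (norm_nonneg _)]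
  rw [← image_circleMap_Ioc] at hzs
  obtain ⟨θ, hθ, rfl⟩ := hzs
  have h1 : 0 < ∫ θ in (0 : ℝ)..(2 * Real.pi), D (circleMap 0 r θ) :=
    intervalIntegral.integral_pos Real.two_pi_pos (hD.comp (by fun_prop)).continuousOn
      (fun θ _ => h0 _) ⟨θ, ⟨hθ.1.le, hθ.2⟩, hpos⟩
  rw [Real.circleAverage, smul_eq_mul] at hA
  have := mul_pos (inv_pos.2 Real.two_pi_pos) h1
  linarith

/-- A continuous function on `ℂ × ℝ` that vanishes on all circles `|z|² = Im w > 0`, `u = Re w`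
vanishes. -/
theorem eq_zero_of_forall_circle {k : ℂ × ℝ → ℂ} (hk : Continuous k)
    (h : ∀ w ∈ uhp, ∀ z : ℂ, ‖z‖ = √w.im → k (z, w.re) = 0) (p : ℂ × ℝ) : k p = 0 := by
  have hd : Dense {p : ℂ × ℝ | p.1 ≠ 0} :=
    (dense_compl_singleton (0 : ℂ)).preimage isOpenMap_fst
  refine congrFun (Continuous.ext_on hd hk continuous_const fun p hp => ?_) p
  have hp' : 0 < ‖p.1‖ := norm_pos_iff.2 hp
  have := h (p.2 + (‖p.1‖ ^ 2 : ℝ) * I)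
    (by change 0 < (p.2 + (‖p.1‖ ^ 2 : ℝ) * I : ℂ).im; rw [Complex.add_im, Complex.im_ofReal_mul]; simpa using pow_pos hp' 2)
    p.1 (by rw [Complex.add_im, Complex.im_ofReal_mul]; simp)
  rw [Complex.add_re, Complex.re_ofReal_mul] at this
  simpa using this

/-- A Hopf lemma: a null CR map that is degenerate in the normal direction vanishes. -/
theorem hopf {m : ℕ} {f : Fin m → smoothAlg} {g : smoothAlg} (hg : Lb g = 0)
    (him : ∀ p, (g.1 p).im = ∑ i, ‖(f i).1 p‖ ^ 2) (h0 : g.1 0 = 0) (h1 : (T g).1 0 = 0)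
    (i : Fin m) (p : ℂ × ℝ) : (f i).1 p = 0 := by
  have hint : ∀ (w : ℂ), CircleIntegrable (fun z => g.1 (z, w.re)) 0 (√w.im) := fun w =>
    ContinuousOn.circleIntegrable (Real.sqrt_nonneg _) (by fun_prop : Continuous _).continuousOn
  have hA : ∀ w, (circMean g.1 w).im =
      Real.circleAverage (fun z => ∑ i, ‖(f i).1 (z, w.re)‖ ^ 2) 0 (√w.im) := by
    intro w
    have := imCLM.circleAverage_comp_comm (hint w)
    rw [circMean]
    simp only [imCLM_apply] at this
    rw [← this]
    congr 1
    funext z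
    exact him _
  -- The mean of `g` has imaginary part equal to the mean of `∑ |f i|² ≥ 0` and is flat of order
  -- `2`, so it is zero; then so is that sum on every circle.
  have hz := eq_zero_of_flat_of_re_nonneg (Q := fun w => -I * circMean g.1 w)
    (fun w hw => ((hasDerivAt_circMean_coe hg hw).differentiableAt.differentiableWithinAt).const_mul _)
    (fun w hw => by
      have : (-I * circMean g.1 w).re = (circMean g.1 w).im := by simp
      rw [this, hA]
      exact Real.circleAverage_nonneg_of_nonneg fun z _ => Finset.sum_nonneg fun i _ => by positivity)
    (by
      obtain ⟨C, ε, hε, hC⟩ := flatAt_circMean_two hg h0 h1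
      exact ⟨C, ε, hε, fun w hw hwε => by simpa using hC w hw hwε⟩)
  refine eq_zero_of_forall_circle (continuous (f i)) (fun w hw z hzn => ?_) p
  have h2 : circMean g.1 w = 0 := by simpa using hz w hw
  have h3 := hA w
  rw [h2, Complex.zero_im] at h3
  have h4 := eq_zero_of_circleAverage_eq_zero (D := fun z => ∑ i, ‖(f i).1 (z, w.re)‖ ^ 2)
    (by fun_prop) (fun z => Finset.sum_nonneg fun i _ => by positivity) h3.symm hzn
  have h5 := (Finset.sum_eq_zero_iff_of_nonneg (fun i _ => by positivity)).1 h4 i (Finset.mem_univ i)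
  simpa using h5

end smoothAlg
end

/-! ### The Cayley transform and rigidity of CR maps into the sphere. -/

noncomputable section

namespace smoothAlg

/-- The pointwise quotient by a nowhere vanishing function. -/
def quot (a d : smoothAlg) (hd : ∀ p, d.1 p ≠ 0) : smoothAlg :=
  ⟨fun p => a.1 p / d.1 p, mem_iff.2 (by
    have h : ContDiff ℝ ∞ fun p => a.1 p * (d.1 p)⁻¹ := (contDiff a).mul ((contDiff d).inv hd)
    simpa only [div_eq_mul_inv] using h)⟩

variable {a d : smoothAlg} {hd : ∀ p, d.1 p ≠ 0}

theorem quot_apply (p : ℂ × ℝ) : (quot a d hd).1 p = a.1 p / d.1 p := rfl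

theorem quot_mul : quot a d hd * d = a := ext_apply fun p => div_mul_cancel₀ _ (hd p)

theorem Lb_quot (ha : Lb a = 0) (hdd : Lb d = 0) : Lb (quot a d hd) = 0 := by
  have h := congrArg Lb (quot_mul (a := a) (d := d) (hd := hd))
  rw [Derivation.leibniz, hdd, ha, smul_zero, zero_add, smul_eq_mul] at h
  refine ext_apply fun p => ?_
  have := congrArg (fun k : smoothAlg => k.1 p) h
  simp only [coe_mul_apply, coe_zero_apply] at this ⊢
  exact (mul_eq_zero.1 this).resolve_left (hd p)

theorem jet_quot {D : Derivation ℂ smoothAlg smoothAlg} : jet D (quot a d hd) * jet D d = jet D a := by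
  rw [← map_mul, quot_mul]

theorem jet_D_quot {D E : Derivation ℂ smoothAlg smoothAlg} :
    jet D (quot a d hd) * jet D (E d) + jet D d * jet D (E (quot a d hd)) = jet D (E a) := by
  have h := congrArg (fun k => jet D (E k)) (quot_mul (a := a) (d := d) (hd := hd))
  simpa only [Derivation.leibniz, map_add, smul_eq_mul, map_mul] using h

/-- The nowhere vanishing CR function `i + w`. -/
def iw : smoothAlg := algebraMap ℂ _ I + wS

@[simp] theorem iw_apply (p : ℂ × ℝ) : iw.1 p = I + wS.1 p := rfl

theorem wS_im (p : ℂ × ℝ) : (wS.1 p).im = ‖p.1‖ ^ 2 := by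
  rw [wS_apply, add_im, ofReal_im, zero_add, mul_comm I, Complex.im_ofReal_mul, I_im, mul_one]

theorem wS_re (p : ℂ × ℝ) : (wS.1 p).re = p.2 := by
  rw [wS_apply, add_re, ofReal_re, mul_comm I, Complex.re_ofReal_mul, I_re, mul_zero, add_zero]

theorem iw_ne (p : ℂ × ℝ) : iw.1 p ≠ 0 :=
  I_add_ne_zero_of_im_nonneg (by rw [wS_im]; positivity)

theorem Lb_iw : Lb iw = 0 := by simp [iw]

/-- The normal component of the Cayley transform, as a CR function. -/
def cay0 : smoothAlg := quot (algebraMap ℂ _ I - wS) iw iw_ne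
/-- The tangential component of the Cayley transform, as a CR function. -/
def cay1 : smoothAlg := quot ((2 : ℂ) • zS) iw iw_ne

theorem Lb_cay0 : Lb cay0 = 0 := Lb_quot (by simp) Lb_iw
theorem Lb_cay1 : Lb cay1 = 0 := Lb_quot (by simp) Lb_iw

theorem cay0_apply (p : ℂ × ℝ) : cay0.1 p = cayley (wS.1 p) := rfl
theorem cay1_apply (p : ℂ × ℝ) : cay1.1 p = 2 * p.1 / (I + wS.1 p) := rfl

theorem jet_const {D : Derivation ℂ smoothAlg smoothAlg} (c : ℂ) :
    jet D (algebraMap ℂ _ c) = PowerSeries.C c := by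
  rw [jet_eq_C _ (by simp)]; rfl

theorem jet_T_iw : jet T iw = PowerSeries.C I + PowerSeries.X := by
  rw [iw, map_add, jet_const, jet_T_wS]

theorem jet_T_iw_ne : jet T iw ≠ 0 := by
  intro h
  have := congrArg PowerSeries.constantCoeff h
  rw [constantCoeff_jet, map_zero] at this
  exact iw_ne 0 this

theorem wS_of_circle {w z : ℂ} (hw : w ∈ uhp) (hz : ‖z‖ = √w.im) : wS.1 (z, w.re) = w := by
  apply Complex.ext
  · rw [wS_re]
  · rw [wS_im]; simp only [hz]; exact Real.sq_sqrt (le_of_lt hw)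

theorem norm_sq_cayley_add {w : ℂ} (hw : w ∈ uhp) :
    ‖cayley w‖ ^ 2 + ‖2 / (I + w)‖ ^ 2 * w.im = 1 := by
  have h0 : ‖I + w‖ ^ 2 ≠ 0 := pow_ne_zero 2 (norm_ne_zero_iff.2 (I_add_ne_zero hw))
  rw [cayley, norm_div, norm_div, div_pow, div_pow, div_mul_eq_mul_div, ← add_div,
    div_eq_one_iff_eq h0, ← Complex.normSq_eq_norm_sq, ← Complex.normSq_eq_norm_sq,
    ← Complex.normSq_eq_norm_sq, Complex.normSq_apply, Complex.normSq_apply, Complex.normSq_apply]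
  simp
  ring

variable {n : ℕ} {F0 : smoothAlg} {F : Fin (n + 1) → smoothAlg}

/-- The squared distance of a map `(F0, F)` to `(c₀, c₁ z, 0, …, 0)`. -/
def sqDist (F0 : smoothAlg) (F : Fin (n + 1) → smoothAlg) (c₀ c₁ : ℂ) (w z : ℂ) : ℝ :=
  ‖F0.1 (z, w.re) - c₀‖ ^ 2 + ‖(F 0).1 (z, w.re) - c₁ * z‖ ^ 2 +
    ∑ i : Fin n, ‖(F i.succ).1 (z, w.re)‖ ^ 2

theorem sqDist_nonneg (c₀ c₁ w z : ℂ) : 0 ≤ sqDist F0 F c₀ c₁ w z := by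
  unfold sqDist; positivity

theorem continuous_sqDist (c₀ c₁ w : ℂ) : Continuous (sqDist F0 F c₀ c₁ w) := by
  unfold sqDist; fun_prop

theorem norm_sub_sq_eq (a b : ℂ) : ‖a - b‖ ^ 2 = ‖a‖ ^ 2 + ‖b‖ ^ 2 - 2 * (conj b * a).re := by
  simp only [← Complex.normSq_eq_norm_sq, Complex.normSq_apply]
  simp
  ring

/-- The sphere equation makes the quadratic terms constant. On the circle `z̄ = Im w / z`, so the
cross term with `c₁ z` is a multiple of the mean of `F 0 / z`. -/
theorem circleAverage_sqDist (hs : ∀ p, ‖F0.1 p‖ ^ 2 + ∑ i, ‖(F i).1 p‖ ^ 2 = 1)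
    (c₀ c₁ : ℂ) {w : ℂ} (hw : w ∈ uhp) :
    Real.circleAverage (sqDist F0 F c₀ c₁ w) 0 (√w.im) =
      1 + ‖c₀‖ ^ 2 + ‖c₁‖ ^ 2 * w.im - 2 * (conj c₀ * circMean F0.1 w +
        w.im * (conj c₁ * circMean (fun p => (F 0).1 p / p.1) w)).re := by
  have hr : 0 < √w.im := Real.sqrt_pos.2 hw
  have hr2 : √w.im ^ 2 = w.im := Real.sq_sqrt (le_of_lt hw)
  set k : ℂ → ℂ := fun z => ((1 + ‖c₀‖ ^ 2 + ‖c₁‖ ^ 2 * w.im : ℝ) : ℂ) -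
    ((2 * conj c₀) • F0.1 (z, w.re) + (2 * w.im * conj c₁) • ((F 0).1 (z, w.re) / z)) with hk
  have i1 : CircleIntegrable (fun z => F0.1 (z, w.re)) 0 (√w.im) :=
    circleIntegrable_of_continuousOn hr (by fun_prop : Continuous _).continuousOn
  have i2 : CircleIntegrable (fun z => (F 0).1 (z, w.re) / z) 0 (√w.im) :=
    circleIntegrable_of_continuousOn hr (ContinuousOn.div (by fun_prop) (by fun_prop) fun p hp => hp)
  have j1 : CircleIntegrable (fun z => (2 * conj c₀) • F0.1 (z, w.re)) 0 (√w.im) :=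
    i1.const_fun_smul
  have j2 : CircleIntegrable (fun z => (2 * w.im * conj c₁) • ((F 0).1 (z, w.re) / z)) 0 (√w.im) :=
    i2.const_fun_smul
  have j0 : CircleIntegrable (fun _ => ((1 + ‖c₀‖ ^ 2 + ‖c₁‖ ^ 2 * w.im : ℝ) : ℂ)) 0 (√w.im) :=
    circleIntegrable_const _ _ _
  have hkA : Real.circleAverage k 0 (√w.im) = ((1 + ‖c₀‖ ^ 2 + ‖c₁‖ ^ 2 * w.im : ℝ) : ℂ) -
      (2 * conj c₀ * circMean F0.1 w +
        2 * w.im * conj c₁ * circMean (fun p => (F 0).1 p / p.1) w) := by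
    have j12 : CircleIntegrable (fun z => (2 * conj c₀) • F0.1 (z, w.re) +
        (2 * w.im * conj c₁) • ((F 0).1 (z, w.re) / z)) 0 (√w.im) := j1.add j2
    rw [hk, Real.circleAverage_fun_sub j0 j12, Real.circleAverage_fun_add j1 j2,
      Real.circleAverage_fun_smul, Real.circleAverage_fun_smul, Real.circleAverage_const]
    rfl
  have hki : CircleIntegrable k 0 (√w.im) := j0.sub (j1.add j2)
  have hre := reCLM.circleAverage_comp_comm hki
  rw [hkA] at hre
  have hcongr : Real.circleAverage (sqDist F0 F c₀ c₁ w) 0 (√w.im) =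
      Real.circleAverage (reCLM ∘ k) 0 (√w.im) := by
    apply Real.circleAverage_congr_sphere
    intro z hz
    rw [mem_sphere_zero_iff_norm, abs_of_pos hr] at hz
    have hz0 : z ≠ 0 := norm_pos_iff.1 (by rw [hz]; exact hr)
    have h1 := hs (z, w.re)
    rw [Fin.sum_univ_succ] at h1
    have hzz : conj z = w.im / z := by
      rw [eq_div_iff hz0, mul_comm, Complex.mul_conj, Complex.normSq_eq_norm_sq, hz, hr2]
    have h2 : conj (c₁ * z) * (F 0).1 (z, w.re) =
        w.im * conj c₁ * ((F 0).1 (z, w.re) / z) := by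
      rw [map_mul, hzz]; ring
    have h3 : (reCLM ∘ k) z = 1 + ‖c₀‖ ^ 2 + ‖c₁‖ ^ 2 * w.im -
        (2 * (conj c₀ * F0.1 (z, w.re)).re +
          2 * (w.im * conj c₁ * ((F 0).1 (z, w.re) / z)).re) := by
      have e1 : (2 * conj c₀) • F0.1 (z, w.re) = ((2 : ℝ) : ℂ) * (conj c₀ * F0.1 (z, w.re)) := by
        rw [smul_eq_mul]; push_cast; ring
      have e2 : (2 * w.im * conj c₁) • ((F 0).1 (z, w.re) / z) =
          ((2 : ℝ) : ℂ) * (w.im * conj c₁ * ((F 0).1 (z, w.re) / z)) := by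
        rw [smul_eq_mul]; push_cast; ring
      simp only [Function.comp, reCLM_apply, hk]
      rw [e1, e2, Complex.sub_re, Complex.add_re, Complex.ofReal_re, Complex.re_ofReal_mul,
        Complex.re_ofReal_mul]
    rw [h3, sqDist, norm_sub_sq_eq, norm_sub_sq_eq, h2, norm_mul, mul_pow, hz, hr2]
    linear_combination h1
  rw [hcongr, hre, reCLM_apply, Complex.sub_re, Complex.ofReal_re]
  have e : 2 * conj c₀ * circMean F0.1 w +
      2 * w.im * conj c₁ * circMean (fun p => (F 0).1 p / p.1) w =
      ((2 : ℝ) : ℂ) * (conj c₀ * circMean F0.1 w +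
        w.im * (conj c₁ * circMean (fun p => (F 0).1 p / p.1) w)) := by
    push_cast; ring
  rw [e, Complex.re_ofReal_mul]

/-- A CR map of the Heisenberg hypersurface into a sphere whose jet at the origin is that of the
Cayley transform composed with the linear embedding coincides with it. -/
theorem sphere_rigidity (h0 : Lb F0 = 0) (h1 : Lb (F 0) = 0)
    (hs : ∀ p, ‖F0.1 p‖ ^ 2 + ∑ i, ‖(F i).1 p‖ ^ 2 = 1)
    (j0 : jet T F0 = jet T cay0) (j1 : jet T (Lz (F 0)) = jet T (Lz cay1)) (p : ℂ × ℝ) :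
    F0.1 p = cay0.1 p ∧ (F 0).1 p = cay1.1 p ∧ ∀ i : Fin n, (F i.succ).1 p = 0 := by
  set G := circMean F0.1 with hG
  set Φ := circMean (fun p => (F 0).1 p / p.1) with hΦ
  have hGd : DifferentiableOn ℂ G uhp := fun w hw =>
    (hasDerivAt_circMean_coe h0 hw).differentiableAt.differentiableWithinAt
  have hΦd : DifferentiableOn ℂ Φ uhp := fun w hw =>
    (hasDerivAt_circMean_div h1 hw).differentiableAt.differentiableWithinAt
  -- A Bessel inequality: with `c₀` and `c₁` equal to the two means, the average squared distance is
  -- `1 - ‖G‖² - ‖Φ‖² Im w`.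
  have hineq : ∀ w ∈ uhp, ‖G w‖ ^ 2 + ‖Φ w‖ ^ 2 * w.im ≤ 1 := by
    intro w hw
    have h2 := circleAverage_sqDist hs (G w) (Φ w) hw
    have h3 : 0 ≤ Real.circleAverage (sqDist F0 F (G w) (Φ w) w) 0 (√w.im) :=
      Real.circleAverage_nonneg_of_nonneg fun z _ => sqDist_nonneg _ _ _ _
    have h4 : (conj (G w) * circMean F0.1 w +
        w.im * (conj (Φ w) * circMean (fun p => (F 0).1 p / p.1) w)).re =
        ‖G w‖ ^ 2 + ‖Φ w‖ ^ 2 * w.im := by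
      rw [← hG, ← hΦ, mul_comm (conj (G w)), mul_comm (conj (Φ w)), Complex.mul_conj,
        Complex.mul_conj, ← Complex.ofReal_mul, ← Complex.ofReal_add, Complex.ofReal_re,
        Complex.normSq_eq_norm_sq, Complex.normSq_eq_norm_sq]
      ring
    rw [h4] at h2
    linarith
  have hGc : ∀ w ∈ uhp, G w = cayley w := by
    refine eq_cayley_of_flat hGd (fun w hw => ?_) ?_
    · have h2 := hineq w hw
      have h3 : 0 ≤ ‖Φ w‖ ^ 2 * w.im := mul_nonneg (by positivity) (le_of_lt hw)
      rw [← sq_le_one_iff₀ (norm_nonneg _)]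
      linarith
    · obtain ⟨C, ε, hε, hC⟩ := flatAt_circMean (h := F0 - cay0) (by rw [map_sub, h0, Lb_cay0, sub_zero])
        (by rw [map_sub, j0, sub_self]) 4
      refine ⟨C, ε, hε, fun w hw hwε => ?_⟩
      have h2 := hC w hw hwε
      have h3 : circMean (F0 - cay0).1 w = G w - cayley w := by
        have := circMean_sub (k := F0.1) (k' := cay0.1) hw (continuous _).continuousOn
          (continuous _).continuousOn
        rw [circMean_const (k := cay0.1) (c := cayley w) fun z hz => by
          rw [cay0_apply, wS_of_circle hw hz]] at this
        exact this
      rwa [h3] at h2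
  have hΦc : ∀ w ∈ uhp, Φ w = 2 / (I + w) := by
    -- With `G` known, the Bessel inequality gives `‖Φ‖ ≤ ‖2 / (I + w)‖`, so the quotient of the two
    -- lies in the closed unit disc.
    have hre : ∀ w ∈ uhp, 0 ≤ (1 - Φ w * (I + w) / 2).re := by
      intro w hw
      have h2 := hineq w hw
      rw [hGc w hw] at h2
      have h3 := norm_sq_cayley_add hw
      have hn : 0 < ‖I + w‖ := norm_pos_iff.2 (I_add_ne_zero hw)
      have h4 : ‖Φ w‖ ^ 2 ≤ ‖2 / (I + w)‖ ^ 2 := by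
        have : ‖Φ w‖ ^ 2 * w.im ≤ ‖2 / (I + w)‖ ^ 2 * w.im := by linarith
        exact le_of_mul_le_mul_right this hw
      have h5 := (sq_le_sq₀ (norm_nonneg _) (norm_nonneg _)).1 h4
      rw [norm_div, le_div_iff₀ hn] at h5
      have h6 : ‖Φ w * (I + w) / 2‖ ≤ 1 := by
        rw [norm_div, norm_mul, div_le_one (by simp)]; exact h5
      have := Complex.re_le_norm (Φ w * (I + w) / 2)
      rw [Complex.sub_re, Complex.one_re]
      linarith
    have hflat : FlatAt (fun w => 1 - Φ w * (I + w) / 2) 2 := by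
      obtain ⟨C, ε, hε, hC⟩ := flatAt_circMean_div (h := F 0 - cay1)
        (by rw [map_sub, h1, Lb_cay1, sub_zero]) (by rw [map_sub, map_sub, j1, sub_self]) 2
      refine ⟨C, min ε 1, lt_min hε one_pos, fun w hw hwε => ?_⟩
      have h2 := hC w hw (hwε.trans_le (min_le_left _ _))
      have hI := I_add_ne_zero hw
      have h3 : circMean (fun p => (F 0 - cay1).1 p / p.1) w = Φ w - 2 / (I + w) := by
        have c1 : ContinuousOn (fun p : ℂ × ℝ => (F 0).1 p / p.1) {p | p.1 ≠ 0} :=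
          ContinuousOn.div (by fun_prop) (by fun_prop) fun p hp => hp
        have c2 : ContinuousOn (fun p : ℂ × ℝ => cay1.1 p / p.1) {p | p.1 ≠ 0} :=
          ContinuousOn.div (by fun_prop) (by fun_prop) fun p hp => hp
        have := circMean_sub hw c1 c2
        rw [circMean_const (k := fun p : ℂ × ℝ => cay1.1 p / p.1) (c := 2 / (I + w)) fun z hz => by
          have hz0 : z ≠ 0 := norm_pos_iff.1 (by rw [hz]; exact Real.sqrt_pos.2 hw)
          rw [cay1_apply, wS_of_circle hw hz]; field_simp] at this
        rw [← this]
        congr 1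
        funext q
        rw [coe_sub_apply, sub_div]
      rw [h3] at h2
      have h4 : 1 - Φ w * (I + w) / 2 = -((I + w) / 2) * (Φ w - 2 / (I + w)) := by
        field_simp; ring
      change ‖1 - Φ w * (I + w) / 2‖ ≤ _
      rw [h4, norm_mul, norm_neg, norm_div]
      have h5 : ‖I + w‖ ≤ 2 := by
        have := norm_add_le I w
        have h6 : ‖w‖ < 1 := hwε.trans_le (min_le_right _ _)
        rw [norm_I] at this
        linarith
      calc ‖I + w‖ / ‖(2 : ℂ)‖ * ‖Φ w - 2 / (I + w)‖ ≤ 1 * ‖Φ w - 2 / (I + w)‖ := by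
            gcongr
            rw [div_le_one (by simp)]; simpa using h5
        _ ≤ _ := by rw [one_mul]; exact h2
    have hz := eq_zero_of_flat_of_re_nonneg (by fun_prop) hre hflat
    intro w hw
    have h2 := hz w hw
    rw [eq_div_iff (I_add_ne_zero hw)]
    linear_combination -2 * h2
  -- The model satisfies the sphere equation, so for these `c₀` and `c₁` the average squared
  -- distance is zero, and hence the distance is zero at each point.
  have hzero : ∀ w ∈ uhp, ∀ z : ℂ, ‖z‖ = √w.im → sqDist F0 F (cayley w) (2 / (I + w)) w z = 0 := by
    intro w hw z hz
    refine eq_zero_of_circleAverage_eq_zero (continuous_sqDist _ _ _)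
      (fun z => sqDist_nonneg _ _ _ _) ?_ hz
    rw [circleAverage_sqDist hs _ _ hw, ← hG, ← hΦ, hGc w hw, hΦc w hw, mul_comm (conj (cayley w)),
      mul_comm (conj (2 / (I + w))), Complex.mul_conj, Complex.mul_conj, ← Complex.ofReal_mul,
      ← Complex.ofReal_add, Complex.ofReal_re, Complex.normSq_eq_norm_sq, Complex.normSq_eq_norm_sq]
    have := norm_sq_cayley_add hw
    linear_combination -this
  have hparts : ∀ w ∈ uhp, ∀ z : ℂ, ‖z‖ = √w.im → F0.1 (z, w.re) = cay0.1 (z, w.re) ∧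
      (F 0).1 (z, w.re) = cay1.1 (z, w.re) ∧ ∀ i : Fin n, (F i.succ).1 (z, w.re) = 0 := by
    intro w hw z hz
    have h2 := hzero w hw z hz
    unfold sqDist at h2
    have p1 : 0 ≤ ‖F0.1 (z, w.re) - cayley w‖ ^ 2 := by positivity
    have p2 : 0 ≤ ‖(F 0).1 (z, w.re) - 2 / (I + w) * z‖ ^ 2 := by positivity
    have p3 : 0 ≤ ∑ i : Fin n, ‖(F i.succ).1 (z, w.re)‖ ^ 2 := by positivity
    have q1 : ‖F0.1 (z, w.re) - cayley w‖ ^ 2 = 0 := by linarith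
    have q2 : ‖(F 0).1 (z, w.re) - 2 / (I + w) * z‖ ^ 2 = 0 := by linarith
    have q3 : ∑ i : Fin n, ‖(F i.succ).1 (z, w.re)‖ ^ 2 = 0 := by linarith
    refine ⟨?_, ?_, fun i => ?_⟩
    · rw [cay0_apply, wS_of_circle hw hz]
      simpa [sub_eq_zero] using q1
    · rw [cay1_apply, wS_of_circle hw hz, mul_div_right_comm]
      simpa [sub_eq_zero] using q2
    · simpa using (Finset.sum_eq_zero_iff_of_nonneg (fun i _ => by positivity)).1 q3 i
        (Finset.mem_univ i)
  refine ⟨?_, ?_, fun i => ?_⟩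
  · exact sub_eq_zero.1 (eq_zero_of_forall_circle (k := fun p => F0.1 p - cay0.1 p) (by fun_prop)
      (fun w hw z hz => sub_eq_zero.2 (hparts w hw z hz).1) p)
  · exact sub_eq_zero.1 (eq_zero_of_forall_circle (k := fun p => (F 0).1 p - cay1.1 p) (by fun_prop)
      (fun w hw z hz => sub_eq_zero.2 (hparts w hw z hz).2.1) p)
  · exact eq_zero_of_forall_circle (continuous _) (fun w hw z hz => (hparts w hw z hz).2.2 i) p

end smoothAlg
end

/-! ### From equal jets to proportional maps. -/

noncomputable section

namespace smoothAlg

theorem NullCR.im_mul_conj {m : ℕ} {x : Fin m → smoothAlg} {y t : smoothAlg} (hX : NullCR x y t)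
    (p : ℂ × ℝ) : (y.1 p * conj (t.1 p)).im = ∑ i, ‖(x i).1 p‖ ^ 2 := by
  have h := congrArg (fun k : smoothAlg => (k.1 p).im) hX.null
  have e : ((∑ i, x i * cj (x i) : smoothAlg) : ℂ × ℝ → ℂ) p =
      ((∑ i, ‖(x i).1 p‖ ^ 2 : ℝ) : ℂ) := by
    rw [coe_sum_apply, Complex.ofReal_sum]
    refine Finset.sum_congr rfl fun i _ => ?_
    rw [coe_mul_apply, cj_apply, Complex.mul_conj, Complex.normSq_eq_norm_sq]
  simp only [coe_sub_apply, coe_mul_apply, cj_apply, coe_smul_apply, e] at h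
  simp only [Complex.sub_im, Complex.mul_im, Complex.conj_re, Complex.conj_im, Complex.ofReal_re,
    Complex.ofReal_im, Complex.mul_re, Complex.I_re, Complex.I_im, Complex.re_ofNat,
    Complex.im_ofNat] at h ⊢
  linear_combination (1 / 2) * h

/-- A null CR map whose jet at the origin is proportional to that of the linear embedding is
proportional to it everywhere. -/
theorem proportional_of_jet {n : ℕ} {x : Fin (n + 1) → smoothAlg} {y t : smoothAlg}
    (hX : NullCR x y t) (hne : ∀ p, (∀ i, (x i).1 p = 0) → y.1 p = 0 → t.1 p ≠ 0)
    (hx : jet T (x 0) = 0) (hq : jet T (dz (x 0)) ≠ 0)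
    (hy : jet T y = PowerSeries.X * jet T (dz (x 0))) (ht : jet T t = jet T (dz (x 0)))
    (p : ℂ × ℝ) :
    ∃ μ : ℂ, μ ≠ 0 ∧ (x 0).1 p = μ * p.1 ∧ (∀ i : Fin n, (x i.succ).1 p = 0) ∧
      y.1 p = μ * wS.1 p ∧ t.1 p = μ := by
  set d : smoothAlg := I • t + y with hd
  have hnorm : ∀ p, ‖I * t.1 p + y.1 p‖ ^ 2 - ‖I * t.1 p - y.1 p‖ ^ 2 =
      4 * ∑ i, ‖(x i).1 p‖ ^ 2 := by
    intro p
    rw [← hX.im_mul_conj p]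
    simp only [← Complex.normSq_eq_norm_sq, Complex.normSq_apply]
    simp
    ring
  -- If `i t + y = 0`, then the identity `hnorm` forces `i t - y` and all `x i` to vanish as well,
  -- against the assumption that the vector has no zero.
  have hdne : ∀ p, d.1 p ≠ 0 := by
    intro p h
    have h0 : I * t.1 p + y.1 p = 0 := h
    have h1 := hnorm p
    rw [h0, norm_zero] at h1
    have h2 : 0 ≤ ∑ i, ‖(x i).1 p‖ ^ 2 := by positivity
    have h3 : ∑ i, ‖(x i).1 p‖ ^ 2 = 0 := by nlinarith [sq_nonneg ‖I * t.1 p - y.1 p‖]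
    have h4 : I * t.1 p - y.1 p = 0 := by
      rw [h3] at h1
      simpa using h1
    have h5 : y.1 p = 0 := by linear_combination (h0 - h4) / 2
    have h6 : t.1 p = 0 := by linear_combination (-I / 2) * (h0 + h4) + t.1 p * I_sq
    refine hne p (fun i => ?_) h5 h6
    simpa using (Finset.sum_eq_zero_iff_of_nonneg (fun i _ => by positivity)).1 h3 i
      (Finset.mem_univ i)
  have hLd : Lb d = 0 := by rw [hd, map_add, Derivation.map_smul, hX.crt, hX.cry]; simp
  set F0 := quot (I • t - y) d hdne with hF0
  set F : Fin (n + 1) → smoothAlg := fun i => quot ((2 : ℂ) • x i) d hdne with hF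
  have hLF0 : Lb F0 = 0 :=
    Lb_quot (by rw [map_sub, Derivation.map_smul, hX.crt, hX.cry]; simp) hLd
  have hLF : ∀ i, Lb (F i) = 0 := fun i =>
    Lb_quot (by rw [Derivation.map_smul, hX.crx, smul_zero]) hLd
  have hs : ∀ p, ‖F0.1 p‖ ^ 2 + ∑ i, ‖(F i).1 p‖ ^ 2 = 1 := by
    intro p
    have h1 := hnorm p
    have h2 : ‖d.1 p‖ ^ 2 ≠ 0 := pow_ne_zero 2 (norm_ne_zero_iff.2 (hdne p))
    simp only [hF0, hF, quot_apply, norm_div, div_pow, ← Finset.sum_div, coe_smul_apply, norm_mul,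
      mul_pow, ← Finset.mul_sum, coe_sub_apply]
    rw [← add_div, div_eq_one_iff_eq h2, hd, coe_add_apply, coe_smul_apply, Complex.norm_ofNat]
    linarith
  set q := jet T (dz (x 0)) with hqd
  have hjd : jet T d = (PowerSeries.C I + PowerSeries.X) * q := by
    rw [hd, map_add, jet_smul, ht, hy, PowerSeries.smul_eq_C_mul]; ring
  have hiw := jet_T_iw_ne
  rw [jet_T_iw] at hiw
  have j0 : jet T F0 = jet T cay0 := by
    have h1 : jet T F0 * jet T d = _ := jet_quot
    have h2 : jet T cay0 * jet T iw = _ := jet_quot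
    rw [hjd, map_sub, jet_smul, ht, hy, PowerSeries.smul_eq_C_mul] at h1
    rw [jet_T_iw, map_sub, jet_const, jet_T_wS] at h2
    apply mul_right_cancel₀ (mul_ne_zero hiw hq)
    linear_combination h1 - q * h2
  -- The jets of `F 0` and `cay1` vanish along `z = 0`, so the product rule loses the terms in which
  -- the denominator is differentiated; the common factor `q` cancels.
  have j1 : jet T (Lz (F 0)) = jet T (Lz cay1) := by
    have a1 : jet T (F 0) = 0 := by
      have : jet T (F 0) * jet T d = _ := jet_quot
      rw [jet_smul, hx, smul_zero, hjd] at this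
      exact (mul_eq_zero.1 this).resolve_right (mul_ne_zero hiw hq)
    have a2 : jet T cay1 = 0 := by
      have : jet T cay1 * jet T iw = _ := jet_quot
      rw [jet_smul, jet_T_zS, smul_zero] at this
      exact (mul_eq_zero.1 this).resolve_right jet_T_iw_ne
    have b1 : jet T (F 0) * jet T (Lz d) + jet T d * jet T (Lz (F 0)) = _ := jet_D_quot
    have b2 : jet T cay1 * jet T (Lz iw) + jet T iw * jet T (Lz cay1) = _ := jet_D_quot
    rw [a1, zero_mul, zero_add, hjd, Derivation.map_smul, jet_smul, jet_T_Lz (x 0), ← hqd,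
      PowerSeries.smul_eq_C_mul] at b1
    rw [a2, zero_mul, zero_add, jet_T_iw, Derivation.map_smul, jet_smul, Lz_zS, map_one,
      PowerSeries.smul_eq_C_mul] at b2
    apply mul_left_cancel₀ (mul_ne_zero hiw hq)
    linear_combination b1 - q * b2
  obtain ⟨r0, r1, r2⟩ := sphere_rigidity hLF0 (hLF 0) hs j0 j1 p
  have hI := iw_ne p
  rw [iw_apply] at hI
  have hdp := hdne p
  have hdv : d.1 p = I * t.1 p + y.1 p := rfl
  have e0 : (I * t.1 p - y.1 p) * (I + wS.1 p) = (I - wS.1 p) * d.1 p := by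
    have : (I * t.1 p - y.1 p) / d.1 p = (I - wS.1 p) / (I + wS.1 p) := r0
    rwa [div_eq_div_iff hdp hI] at this
  have e1 : (2 * (x 0).1 p) * (I + wS.1 p) = 2 * p.1 * d.1 p := by
    have : (2 * (x 0).1 p) / d.1 p = 2 * p.1 / (I + wS.1 p) := r1
    rwa [div_eq_div_iff hdp hI] at this
  refine ⟨d.1 p / (I + wS.1 p), div_ne_zero hdp hI, ?_, fun i => ?_, ?_, ?_⟩
  · rw [div_mul_eq_mul_div, eq_div_iff hI]
    linear_combination e1 / 2
  · have : (2 * (x i.succ).1 p) / d.1 p = 0 := r2 i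
    simpa [hdp] using this
  · rw [div_mul_eq_mul_div, eq_div_iff hI]
    linear_combination (-1 / 2) * e0 - (I / 2 + wS.1 p / 2) * hdv
  · rw [eq_div_iff hI]
    linear_combination (-I / 2) * e0 + (I / 2) * (I + wS.1 p) * hdv +
      (t.1 p * (I + wS.1 p) - d.1 p) * I_sq

end smoothAlg
end

/-! ### Isometries of the Hermitian form and the automorphisms they induce. -/

noncomputable section

/-- The Hermitian form `Im (y t̄) - ‖x‖²` that defines the Heisenberg hypersurface. -/
def heisForm {m : ℕ} (V : CSpace m × ℂ) : ℝ :=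
  (V.1.2 * conj V.2).im - ∑ i, ‖V.1.1 i‖ ^ 2

/-- A linear isomorphism that preserves the Hermitian form. -/
def PreservesForm {m : ℕ} (A : (CSpace m × ℂ) ≃ₗ[ℂ] (CSpace m × ℂ)) : Prop :=
  ∀ V, heisForm (A V) = heisForm V

theorem PreservesForm.trans {m : ℕ} {A B : (CSpace m × ℂ) ≃ₗ[ℂ] (CSpace m × ℂ)}
    (hA : PreservesForm A) (hB : PreservesForm B) : PreservesForm (A.trans B) := fun V => by
  rw [LinearEquiv.trans_apply, hB, hA]

theorem PreservesForm.symm {m : ℕ} {A : (CSpace m × ℂ) ≃ₗ[ℂ] (CSpace m × ℂ)}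
    (hA : PreservesForm A) : PreservesForm A.symm := fun V => by
  rw [← hA (A.symm V), LinearEquiv.apply_symm_apply]

theorem mem_heisenberg_iff {m : ℕ} (Z : CSpace m) : Z ∈ heisenberg m ↔ heisForm (Z, 1) = 0 := by
  simp [heisenberg, heisForm, sub_eq_zero]

theorem heisForm_smul {m : ℕ} (c : ℂ) (V : CSpace m × ℂ) :
    heisForm (c • V) = ‖c‖ ^ 2 * heisForm V := by
  simp only [heisForm, Prod.smul_fst, Prod.smul_snd, smul_eq_mul, Pi.smul_apply, norm_mul, mul_pow,
    ← Finset.mul_sum, mul_sub, map_mul]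
  congr 1
  have : c * V.1.2 * (conj c * conj V.2) = ((‖c‖ ^ 2 : ℝ) : ℂ) * (V.1.2 * conj V.2) := by
    rw [← Complex.normSq_eq_norm_sq, ← Complex.mul_conj]; ring
  rw [this, Complex.im_ofReal_mul]

theorem isHeisAut_of_preservesForm {m : ℕ} {A : (CSpace m × ℂ) ≃ₗ[ℂ] (CSpace m × ℂ)}
    (hA : PreservesForm A) : IsHeisAut A := by
  intro Z hZ hden
  rw [mem_heisenberg_iff] at hZ ⊢
  have h1 : ((linFrac A Z, 1) : CSpace m × ℂ) = (lfDen A Z)⁻¹ • A (Z, 1) := by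
    refine Prod.ext rfl ?_
    change 1 = (lfDen A Z)⁻¹ * lfDen A Z
    rw [inv_mul_cancel₀ hden]
  rw [h1, heisForm_smul, hA, hZ, mul_zero]

/-- A unitary map that takes a vector of norm `l` to `l e₀`. -/
theorem exists_unitary {n : ℕ} (a : Fin (n + 1) → ℂ) {l : ℝ} (hl : 0 < l)
    (ha : ∑ i, ‖a i‖ ^ 2 = l ^ 2) :
    ∃ U : (Fin (n + 1) → ℂ) ≃ₗ[ℂ] (Fin (n + 1) → ℂ),
      (∀ x, ∑ i, ‖U x i‖ ^ 2 = ∑ i, ‖x i‖ ^ 2) ∧ U a = Pi.single 0 (l : ℂ) := by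
  set v : EuclideanSpace ℂ (Fin (n + 1)) := WithLp.toLp 2 a with hv
  have hvn : ‖v‖ = l := by
    rw [← sq_eq_sq₀ (norm_nonneg _) hl.le, EuclideanSpace.norm_sq_eq, ← ha]
  set e : EuclideanSpace ℂ (Fin (n + 1)) := (l : ℂ)⁻¹ • v with he
  have hl0 : (l : ℂ) ≠ 0 := by exact_mod_cast hl.ne'
  have hen : ‖e‖ = 1 := by
    rw [he, norm_smul, norm_inv, Complex.norm_real, Real.norm_eq_abs, abs_of_pos hl, hvn,
      inv_mul_cancel₀ hl.ne']
  have horth : Orthonormal ℂ (Set.domRestrict ({0} : Set (Fin (n + 1))) fun _ => e) := by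
    refine ⟨fun _ => hen, fun i j hij => absurd (Subsingleton.elim i j) hij⟩
  obtain ⟨b, hb⟩ := horth.exists_orthonormalBasis_extension_of_card_eq (by simp)
  have hb0 : b 0 = e := hb 0 rfl
  refine ⟨(WithLp.linearEquiv 2 ℂ (Fin (n + 1) → ℂ)).symm ≪≫ₗ b.repr.toLinearEquiv ≪≫ₗ
    WithLp.linearEquiv 2 ℂ (Fin (n + 1) → ℂ), fun x => ?_, ?_⟩
  · have := b.repr.norm_map (WithLp.toLp 2 x)
    rw [← sq_eq_sq₀ (norm_nonneg _) (norm_nonneg _), EuclideanSpace.norm_sq_eq,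
      EuclideanSpace.norm_sq_eq] at this
    exact this
  · have h1 : v = (l : ℂ) • b 0 := by
      rw [hb0, he, smul_smul, mul_inv_cancel₀ hl0, one_smul]
    change WithLp.ofLp (b.repr v) = _
    rw [h1, map_smul, b.repr_self]
    ext i
    by_cases hi : i = 0
    · subst hi; simp
    · simp [hi]

/-- The translation-type automorphism that sends `(f₀, g₀)` to the origin. -/
def heisTranslate {m : ℕ} (f₀ : Fin m → ℂ) (g₀ : ℂ) : (CSpace m × ℂ) ≃ₗ[ℂ] (CSpace m × ℂ) where
  toFun V := ((V.1.1 - V.2 • f₀,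
    V.1.2 - V.2 * g₀ - 2 * I * ∑ i, (V.1.1 i - V.2 * f₀ i) * conj (f₀ i)), V.2)
  invFun V := ((V.1.1 + V.2 • f₀, V.1.2 + V.2 * g₀ + 2 * I * ∑ i, V.1.1 i * conj (f₀ i)), V.2)
  map_add' V W := by
    refine Prod.ext (Prod.ext ?_ ?_) rfl
    · ext i; simp; ring
    · have : ∀ i, ((V + W).1.1 i - (V + W).2 * f₀ i) * conj (f₀ i) =
          (V.1.1 i - V.2 * f₀ i) * conj (f₀ i) + (W.1.1 i - W.2 * f₀ i) * conj (f₀ i) := by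
        intro i; simp; ring
      simp only [this, Finset.sum_add_distrib]
      simp; ring
  map_smul' c V := by
    refine Prod.ext (Prod.ext ?_ ?_) rfl
    · ext i; simp; ring
    · have : ∀ i, ((c • V).1.1 i - (c • V).2 * f₀ i) * conj (f₀ i) =
          c * ((V.1.1 i - V.2 * f₀ i) * conj (f₀ i)) := by
        intro i; simp; ring
      simp only [this, ← Finset.mul_sum]
      simp; ring
  left_inv V := by
    refine Prod.ext (Prod.ext ?_ ?_) rfl
    · ext i; simp
    · simp; ring
  right_inv V := by
    refine Prod.ext (Prod.ext ?_ ?_) rfl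
    · ext i; simp
    · simp; ring

theorem heisTranslate_apply {m : ℕ} (f₀ : Fin m → ℂ) (g₀ : ℂ) (V : CSpace m × ℂ) :
    heisTranslate f₀ g₀ V = ((V.1.1 - V.2 • f₀,
      V.1.2 - V.2 * g₀ - 2 * I * ∑ i, (V.1.1 i - V.2 * f₀ i) * conj (f₀ i)), V.2) := rfl

theorem preservesForm_heisTranslate {m : ℕ} {f₀ : Fin m → ℂ} {g₀ : ℂ}
    (h : g₀.im = ∑ i, ‖f₀ i‖ ^ 2) : PreservesForm (heisTranslate f₀ g₀) := by
  intro V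
  simp only [heisTranslate_apply, heisForm]
  have e1 : ∀ i, ‖(V.1.1 - V.2 • f₀) i‖ ^ 2 = ‖V.1.1 i‖ ^ 2 - ‖V.2‖ ^ 2 * ‖f₀ i‖ ^ 2 -
      2 * ((V.1.1 i - V.2 * f₀ i) * conj (f₀ i) * conj V.2).re := by
    intro i
    simp only [← Complex.normSq_eq_norm_sq, Complex.normSq_apply]
    simp
    ring
  have e2 : ((V.1.2 - V.2 * g₀ - 2 * I * ∑ i, (V.1.1 i - V.2 * f₀ i) * conj (f₀ i)) *
      conj V.2).im = (V.1.2 * conj V.2).im - ‖V.2‖ ^ 2 * g₀.im -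
        2 * (∑ i, (V.1.1 i - V.2 * f₀ i) * conj (f₀ i) * conj V.2).re := by
    rw [← Finset.sum_mul]
    generalize ∑ i, (V.1.1 i - V.2 * f₀ i) * conj (f₀ i) = s
    simp only [← Complex.normSq_eq_norm_sq, Complex.normSq_apply]
    simp
    ring
  rw [e2]
  simp only [e1, Finset.sum_sub_distrib, ← Finset.mul_sum, Complex.re_sum, h]
  ring

/-- The automorphism fixing the origin that shears the tangential directions along `b`. -/
def heisShear {m : ℕ} (b : Fin m → ℂ) : (CSpace m × ℂ) ≃ₗ[ℂ] (CSpace m × ℂ) where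
  toFun V := ((V.1.1 + V.1.2 • b, V.1.2),
    V.2 - 2 * I * ∑ i, V.1.1 i * conj (b i) - I * (∑ i, b i * conj (b i)) * V.1.2)
  invFun V := ((V.1.1 - V.1.2 • b, V.1.2),
    V.2 + 2 * I * ∑ i, V.1.1 i * conj (b i) - I * (∑ i, b i * conj (b i)) * V.1.2)
  map_add' V W := by
    refine Prod.ext (Prod.ext ?_ rfl) ?_
    · ext i; simp; ring
    · simp [add_mul, Finset.sum_add_distrib]; ring
  map_smul' c V := by
    refine Prod.ext (Prod.ext ?_ rfl) ?_
    · ext i; simp; ring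
    · simp [mul_assoc, ← Finset.mul_sum]; ring
  left_inv V := by
    refine Prod.ext (Prod.ext ?_ rfl) ?_
    · ext i; simp
    · simp [add_mul, Finset.sum_add_distrib, mul_assoc, ← Finset.mul_sum]; ring
  right_inv V := by
    refine Prod.ext (Prod.ext ?_ rfl) ?_
    · ext i; simp
    · simp [sub_mul, Finset.sum_sub_distrib, mul_assoc, ← Finset.mul_sum]; ring

theorem heisShear_apply {m : ℕ} (b : Fin m → ℂ) (V : CSpace m × ℂ) :
    heisShear b V = ((V.1.1 + V.1.2 • b, V.1.2),
      V.2 - 2 * I * ∑ i, V.1.1 i * conj (b i) - I * (∑ i, b i * conj (b i)) * V.1.2) := rfl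

theorem preservesForm_heisShear {m : ℕ} (b : Fin m → ℂ) : PreservesForm (heisShear b) := by
  intro V
  simp only [heisShear_apply, heisForm]
  have e1 : ∀ i, ‖(V.1.1 + V.1.2 • b) i‖ ^ 2 = ‖V.1.1 i‖ ^ 2 + ‖V.1.2‖ ^ 2 * ‖b i‖ ^ 2 +
      2 * (V.1.1 i * conj (b i) * conj V.1.2).re := by
    intro i
    simp only [← Complex.normSq_eq_norm_sq, Complex.normSq_apply]
    simp
    ring
  have e0 : ∑ i, b i * conj (b i) = ((∑ i, ‖b i‖ ^ 2 : ℝ) : ℂ) := by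
    rw [Complex.ofReal_sum]
    exact Finset.sum_congr rfl fun i _ => by rw [Complex.mul_conj, Complex.normSq_eq_norm_sq]
  have e2 : (V.1.2 * conj (V.2 - 2 * I * ∑ i, V.1.1 i * conj (b i) -
      I * (∑ i, b i * conj (b i)) * V.1.2)).im = (V.1.2 * conj V.2).im +
        ‖V.1.2‖ ^ 2 * ∑ i, ‖b i‖ ^ 2 + 2 * (∑ i, V.1.1 i * conj (b i) * conj V.1.2).re := by
    rw [← Finset.sum_mul, e0]
    generalize ∑ i, V.1.1 i * conj (b i) = s
    generalize ∑ i, ‖b i‖ ^ 2 = u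
    simp only [← Complex.normSq_eq_norm_sq, Complex.normSq_apply]
    simp
    ring
  rw [e2]
  simp only [e1, Finset.sum_add_distrib, ← Finset.mul_sum, Complex.re_sum]
  ring

/-- The automorphism given by a linear map `U` and a real dilation. -/
def heisDilate {m : ℕ} (U : (Fin m → ℂ) ≃ₗ[ℂ] (Fin m → ℂ)) {l : ℂ} (hl : l ≠ 0) :
    (CSpace m × ℂ) ≃ₗ[ℂ] (CSpace m × ℂ) :=
  (U.prodCongr (LinearEquiv.smulOfNeZero ℂ ℂ l⁻¹ (inv_ne_zero hl))).prodCongr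
    (LinearEquiv.smulOfNeZero ℂ ℂ l hl)

theorem heisDilate_apply {m : ℕ} (U : (Fin m → ℂ) ≃ₗ[ℂ] (Fin m → ℂ)) {l : ℂ} (hl : l ≠ 0)
    (V : CSpace m × ℂ) : heisDilate U hl V = ((U V.1.1, l⁻¹ * V.1.2), l * V.2) := rfl

theorem preservesForm_heisDilate {m : ℕ} {U : (Fin m → ℂ) ≃ₗ[ℂ] (Fin m → ℂ)}
    (hU : ∀ x, ∑ i, ‖U x i‖ ^ 2 = ∑ i, ‖x i‖ ^ 2) {l : ℝ} (hl : (l : ℂ) ≠ 0) :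
    PreservesForm (heisDilate U hl) := by
  intro V
  simp only [heisDilate_apply, heisForm, hU, map_mul, Complex.conj_ofReal]
  congr 2
  field_simp

/-- The parabolic automorphism with real parameter `r`. -/
def heisParabolic {m : ℕ} (r : ℂ) : (CSpace m × ℂ) ≃ₗ[ℂ] (CSpace m × ℂ) where
  toFun V := (V.1, V.2 - r * V.1.2)
  invFun V := (V.1, V.2 + r * V.1.2)
  map_add' V W := by refine Prod.ext rfl ?_; simp; ring
  map_smul' c V := by refine Prod.ext rfl ?_; simp; ring
  left_inv V := by refine Prod.ext rfl ?_; simp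
  right_inv V := by refine Prod.ext rfl ?_; simp

theorem heisParabolic_apply {m : ℕ} (r : ℂ) (V : CSpace m × ℂ) :
    heisParabolic r V = (V.1, V.2 - r * V.1.2) := rfl

theorem preservesForm_heisParabolic {m : ℕ} (r : ℝ) :
    PreservesForm (heisParabolic (m := m) (r : ℂ)) := by
  intro V
  simp only [heisParabolic_apply, heisForm]
  congr 1
  simp
  ring

end

/-! ### Normalisation of the map at the origin. -/

noncomputable section

namespace smoothAlg

variable {m : ℕ}

/-- The tuple of values of a linear functional on the components of a map. -/
def tuple (L : smoothAlg →ₗ[ℂ] ℂ) (x : Fin m → smoothAlg) (y t : smoothAlg) : CSpace m × ℂ :=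
  ((fun i => L (x i), L y), L t)

/-- The composition of the map `(x, y, t)` with a linear functional. -/
def lin (φ : CSpace m × ℂ →ₗ[ℂ] ℂ) (x : Fin m → smoothAlg) (y t : smoothAlg) : smoothAlg :=
  ∑ i, φ ((Pi.single i 1, 0), 0) • x i + φ ((0, 1), 0) • y + φ ((0, 0), 1) • t

theorem map_lin (L : smoothAlg →ₗ[ℂ] ℂ) (φ : CSpace m × ℂ →ₗ[ℂ] ℂ) (x : Fin m → smoothAlg)
    (y t : smoothAlg) : L (lin φ x y t) = φ (tuple L x y t) := by
  have h : tuple L x y t = ∑ i, L (x i) • (((Pi.single i 1, 0), 0) : CSpace m × ℂ) +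
      L y • (((0, 1), 0) : CSpace m × ℂ) + L t • (((0, 0), 1) : CSpace m × ℂ) := by
    refine Prod.ext (Prod.ext ?_ ?_) ?_
    · ext j
      simp [tuple, Prod.fst_sum, Finset.sum_apply, Pi.single_apply]
    · simp [tuple, Prod.fst_sum, Prod.snd_sum]
    · simp [tuple, Prod.snd_sum]
  rw [h, lin]
  simp only [map_add, map_sum, map_smul, smul_eq_mul]
  simp only [mul_comm]

theorem derivation_lin (D : Derivation ℂ smoothAlg smoothAlg) (φ : CSpace m × ℂ →ₗ[ℂ] ℂ)
    {x : Fin m → smoothAlg} {y t : smoothAlg} (hx : ∀ i, D (x i) = 0) (hy : D y = 0)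
    (ht : D t = 0) : D (lin φ x y t) = 0 := by
  simp [lin, hx, hy, ht]

/-- The tangential components of `A ∘ (x, y, t)`. -/
def actX (A : (CSpace m × ℂ) ≃ₗ[ℂ] (CSpace m × ℂ)) (x : Fin m → smoothAlg) (y t : smoothAlg)
    (i : Fin m) : smoothAlg :=
  lin (LinearMap.proj i ∘ₗ LinearMap.fst ℂ _ _ ∘ₗ LinearMap.fst ℂ _ _ ∘ₗ A.toLinearMap) x y t

/-- The normal component of `A ∘ (x, y, t)`. -/
def actY (A : (CSpace m × ℂ) ≃ₗ[ℂ] (CSpace m × ℂ)) (x : Fin m → smoothAlg) (y t : smoothAlg) :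
    smoothAlg :=
  lin (LinearMap.snd ℂ _ _ ∘ₗ LinearMap.fst ℂ _ _ ∘ₗ A.toLinearMap) x y t

/-- The homogenising component of `A ∘ (x, y, t)`. -/
def actT (A : (CSpace m × ℂ) ≃ₗ[ℂ] (CSpace m × ℂ)) (x : Fin m → smoothAlg) (y t : smoothAlg) :
    smoothAlg :=
  lin (LinearMap.snd ℂ _ _ ∘ₗ A.toLinearMap) x y t

theorem tuple_act (L : smoothAlg →ₗ[ℂ] ℂ) (A : (CSpace m × ℂ) ≃ₗ[ℂ] (CSpace m × ℂ))
    (x : Fin m → smoothAlg) (y t : smoothAlg) :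
    tuple L (actX A x y t) (actY A x y t) (actT A x y t) = A (tuple L x y t) := by
  refine Prod.ext (Prod.ext (funext fun i => ?_) ?_) ?_
  · exact map_lin L _ x y t
  · exact map_lin L _ x y t
  · exact map_lin L _ x y t

/-- Evaluation at `p` as a linear functional. -/
def ev (p : ℂ × ℝ) : smoothAlg →ₗ[ℂ] ℂ := (evalAt p).toLinearMap

@[simp] theorem ev_apply (p : ℂ × ℝ) (h : smoothAlg) : ev p h = h.1 p := rfl

theorem nullCR_of_form {x : Fin m → smoothAlg} {y t : smoothAlg} (hx : ∀ i, Lb (x i) = 0)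
    (hy : Lb y = 0) (ht : Lb t = 0) (h : ∀ p, heisForm (tuple (ev p) x y t) = 0) :
    NullCR x y t := by
  refine ⟨hx, hy, ht, ext_apply fun p => ?_⟩
  have e : ((∑ i, x i * cj (x i) : smoothAlg) : ℂ × ℝ → ℂ) p =
      ((∑ i, ‖(x i).1 p‖ ^ 2 : ℝ) : ℂ) := by
    rw [coe_sum_apply, Complex.ofReal_sum]
    refine Finset.sum_congr rfl fun i _ => ?_
    rw [coe_mul_apply, cj_apply, Complex.mul_conj, Complex.normSq_eq_norm_sq]
  have h1 : (y.1 p * conj (t.1 p)).im = ∑ i, ‖(x i).1 p‖ ^ 2 := sub_eq_zero.1 (h p)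
  rw [coe_smul_apply, e, ← h1, coe_sub_apply, coe_mul_apply, coe_mul_apply, cj_apply, cj_apply]
  apply Complex.ext <;> simp
  ring

theorem NullCR.form {x : Fin m → smoothAlg} {y t : smoothAlg} (hX : NullCR x y t) (p : ℂ × ℝ) :
    heisForm (tuple (ev p) x y t) = 0 := sub_eq_zero.2 (hX.im_mul_conj p)

theorem NullCR.act {x : Fin m → smoothAlg} {y t : smoothAlg} (hX : NullCR x y t)
    {A : (CSpace m × ℂ) ≃ₗ[ℂ] (CSpace m × ℂ)} (hA : PreservesForm A) :
    NullCR (actX A x y t) (actY A x y t) (actT A x y t) :=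
  nullCR_of_form (fun _ => derivation_lin _ _ hX.crx hX.cry hX.crt)
    (derivation_lin _ _ hX.crx hX.cry hX.crt) (derivation_lin _ _ hX.crx hX.cry hX.crt)
    fun p => by rw [tuple_act, hA, hX.form]

/-- The functional `h ↦ ((sL b)^k h)(0)`. -/
def sLfun (b : ℂ) (k : ℕ) : smoothAlg →ₗ[ℂ] ℂ := ev 0 ∘ₗ (sLm b) ^ k

theorem sLfun_apply (b : ℂ) (k : ℕ) (h : smoothAlg) : sLfun b k h = ((sL b)^[k] h).1 0 := by
  rw [← sLm_pow_apply]; rfl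

/-- Unlike the tangential condition, the homogeneous one involves all components, so it is invariant
under linear changes of the target. -/
theorem RankOne.act {x : Fin m → smoothAlg} {y t : smoothAlg} (hR : RankOne x y t)
    (A : (CSpace m × ℂ) ≃ₗ[ℂ] (CSpace m × ℂ)) :
    RankOne (actX A x y t) (actY A x y t) (actT A x y t) := by
  intro b
  obtain ⟨v, v₁, v₂, hv⟩ := hR b
  refine ⟨(A ((v, v₁), v₂)).1.1, (A ((v, v₁), v₂)).1.2, (A ((v, v₁), v₂)).2, fun k hk => ?_⟩
  obtain ⟨c, h1, h2, h3⟩ := hv k hk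
  have h4 : tuple (sLfun b k) x y t = c • ((v, v₁), v₂) := by
    simp only [tuple, sLfun_apply, h1, h2, h3]
    rfl
  have h5 := tuple_act (sLfun b k) A x y t
  rw [h4, map_smul] at h5
  simp only [tuple, sLfun_apply] at h5
  refine ⟨c, fun i => ?_, ?_, ?_⟩
  · exact congrFun (congrArg (fun V => V.1.1) h5) i
  · exact congrArg (fun V => V.1.2) h5
  · exact congrArg (fun V => V.2) h5

theorem Lz_apply_zero (h : smoothAlg) : (Lz h).1 0 = (dz h).1 0 := by
  rw [Lz_eq_dz]
  simp

/-- The first derivatives of the null equation at the origin: the `Lz` derivative gives `dz y`, and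
the Levi identity gives `T y`. -/
theorem NullCR.first_order {x : Fin m → smoothAlg} {y : smoothAlg} (hX : NullCR x y 1)
    (hx : ∀ i, (x i).1 0 = 0) (hy : y.1 0 = 0) :
    (dz y).1 0 = 0 ∧ (T y).1 0 = ((∑ i, ‖(dz (x i)).1 0‖ ^ 2 : ℝ) : ℂ) := by
  have h1 := congrArg (evalAt 0) hX.Lz_null
  simp only [map_sub, map_mul, map_smul, map_sum, evalAt_apply, cj_apply, hx, hy, map_zero,
    mul_zero, zero_mul, Finset.sum_const_zero, smul_zero, sub_zero, map_one,
    mul_one, Lz_apply_zero] at h1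
  have h2 := congrArg (evalAt 0) hX.Lb_Lz_null
  simp only [map_add, map_mul, map_smul, map_sum, evalAt_apply, cj_apply, hx, map_zero,
    mul_zero, sub_zero, map_one, zero_add, add_zero,
    mul_one, Lz_apply_zero, smul_eq_mul, Derivation.map_one_eq_zero] at h2
  refine ⟨h1, ?_⟩
  have h3 := mul_left_cancel₀ (by simp : (2 * I : ℂ) ≠ 0) h2
  rw [h3, Complex.ofReal_sum]
  exact Finset.sum_congr rfl fun i _ => by rw [Complex.mul_conj, Complex.normSq_eq_norm_sq]

theorem sLfun_one (b : ℂ) {k : ℕ} (hk : 1 ≤ k) : sLfun b k 1 = 0 := by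
  obtain ⟨j, rfl⟩ : ∃ j, k = j + 1 := ⟨k - 1, by omega⟩
  have : sL b 1 = 0 := by simp [sL]
  rw [sLfun_apply, Function.iterate_succ_apply, this, ← sLm_pow_apply, map_zero]
  rfl

variable {n : ℕ}

/-- A smooth CR map of the Heisenberg hypersurface of tangential degeneracy one less than the
number of tangential components at the origin is, after a linear change of homogeneous coordinates
in the target, proportional to the linear embedding. -/
theorem exists_preservesForm_of_rank_one {f : Fin (n + 1) → smoothAlg} {g : smoothAlg}
    (hX : NullCR f g 1)
    (hf : ∀ b : ℂ, ∃ v : Fin (n + 1) → ℂ, ∀ k : ℕ, 1 ≤ k → ∃ c : ℂ,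
      ∀ i, ((sL b)^[k] (f i)).1 0 = c * v i)
    (hnz : ∃ (b : ℂ) (k : ℕ) (i : Fin (n + 1)), 1 ≤ k ∧ ((sL b)^[k] (f i)).1 0 ≠ 0) :
    ∃ A : (CSpace (n + 1) × ℂ) ≃ₗ[ℂ] (CSpace (n + 1) × ℂ), PreservesForm A ∧
      ∀ p, ∃ μ : ℂ, μ ≠ 0 ∧
        A (tuple (ev p) f g 1) = μ • ((Pi.single 0 p.1, wS.1 p), 1) := by
  have hR := rankOne_of_tangential hX hf
  set f₀ : Fin (n + 1) → ℂ := fun i => (f i).1 0 with hf₀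
  have him : (g.1 0).im = ∑ i, ‖f₀ i‖ ^ 2 := by simpa using hX.im_mul_conj 0
  set A₁ := heisTranslate f₀ (g.1 0) with hA₁
  have hP₁ : PreservesForm A₁ := preservesForm_heisTranslate him
  set x₁ := actX A₁ f g 1 with hx₁
  set y₁ := actY A₁ f g 1 with hy₁
  have hT₁ := fun L => tuple_act L A₁ f g 1
  have ht₁ : actT A₁ f g 1 = 1 := ext_apply fun p => congrArg (fun V => V.2) (hT₁ (ev p))
  rw [ht₁] at hT₁
  have hX₁ : NullCR x₁ y₁ 1 := by
    have := hX.act hP₁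
    rwa [ht₁] at this
  have hev₁ : tuple (ev 0) x₁ y₁ 1 = ((0, 0), 1) := by
    rw [hT₁, hA₁, heisTranslate_apply]
    refine Prod.ext (Prod.ext ?_ ?_) ?_
    · ext i; simp [tuple, hf₀]
    · simp [tuple, hf₀]
    · simp [tuple]
  have hx0 : ∀ i, (x₁ i).1 0 = 0 := fun i => congrFun (congrArg (fun V => V.1.1) hev₁) i
  have hy0 : y₁.1 0 = 0 := congrArg (fun V => V.1.2) hev₁
  obtain ⟨hdy, hTy⟩ := hX₁.first_order hx0 hy0
  set s : ℝ := ∑ i, ‖(dz (x₁ i)).1 0‖ ^ 2 with hs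
  have hs0 : 0 ≤ s := by positivity
  -- Transversality. If `s = 0`, then `T y₁` vanishes at the origin and `hopf` gives `x₁ = 0`. As
  -- `x₁` and `f` differ by constants, all positive Segre derivatives of `f` would vanish.
  have hspos : 0 < s := by
    refine lt_of_le_of_ne hs0 fun h => ?_
    rw [← h] at hTy
    obtain ⟨b, k, i, hk, hne⟩ := hnz
    have h1 : x₁ i = 0 := ext_apply fun p =>
      hopf hX₁.cry (fun p => by simpa using hX₁.im_mul_conj p) hy0 (by simpa using hTy) i p
    have h2 : sLfun b k (x₁ i) = sLfun b k (f i) - sLfun b k 1 * f₀ i :=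
      congrFun (congrArg (fun V => V.1.1) (hT₁ (sLfun b k))) i
    rw [h1, map_zero, sLfun_one b hk, zero_mul, sub_zero, sLfun_apply] at h2
    exact hne h2.symm
  set l := √s with hl
  have hlpos : 0 < l := Real.sqrt_pos.2 hspos
  have hl2 : l ^ 2 = s := Real.sq_sqrt hs0
  have hlC : (l : ℂ) ≠ 0 := by exact_mod_cast hlpos.ne'
  have hsC : (s : ℂ) ≠ 0 := by exact_mod_cast hspos.ne'
  obtain ⟨U, hU, hUa⟩ := exists_unitary (fun i => (dz (x₁ i)).1 0) hlpos (by rw [hl2])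
  -- As `T y₁` is `s` at the origin, adding this multiple of `y₁` cancels `T (x₁ i)` there.
  -- Afterwards `A₃` rotates `dz x₁` to `l e₀` and scales `T y₁` from `s = l ^ 2` to `l`.
  set A₂ := heisShear (fun i => -((T (x₁ i)).1 0 / s)) with hA₂
  set A₃ := heisDilate U hlC with hA₃
  set B := A₁.trans (A₂.trans A₃) with hB
  have hPB : PreservesForm B :=
    hP₁.trans ((preservesForm_heisShear _).trans (preservesForm_heisDilate hU hlC))
  set x := actX B f g 1 with hx
  set y := actY B f g 1 with hy
  set t := actT B f g 1 with ht
  have hT : ∀ L, tuple L x y t = A₃ (A₂ (tuple L x₁ y₁ 1)) := by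
    intro L
    rw [hT₁, hx, hy, ht, tuple_act]
    rfl
  have hXB : NullCR x y t := hX.act hPB
  have hRB : RankOne x y t := hR.act B
  have n0 : tuple (ev 0) x y t = ((0, 0), (l : ℂ)) := by
    rw [hT, hev₁, hA₂, heisShear_apply, hA₃, heisDilate_apply]
    simp
  have n1 : ((tuple (ev 0 ∘ₗ dz.toLinearMap) x y t).1 : CSpace (n + 1)) =
      (Pi.single 0 (l : ℂ), 0) := by
    have e : tuple (ev 0 ∘ₗ dz.toLinearMap) x₁ y₁ 1 = ((fun i => (dz (x₁ i)).1 0, 0), 0) := by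
      refine Prod.ext (Prod.ext rfl ?_) ?_
      · exact hdy
      · simp [tuple]
    rw [hT, e, hA₂, heisShear_apply, hA₃, heisDilate_apply]
    simp [hUa]
  have n2 : ((tuple (ev 0 ∘ₗ T.toLinearMap) x y t).1 : CSpace (n + 1)) = (0, (l : ℂ)) := by
    have e : tuple (ev 0 ∘ₗ T.toLinearMap) x₁ y₁ 1 = ((fun i => (T (x₁ i)).1 0, (s : ℂ)), 0) := by
      refine Prod.ext (Prod.ext rfl ?_) ?_
      · exact hTy
      · simp [tuple]
    rw [hT, e, hA₂, heisShear_apply, hA₃, heisDilate_apply]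
    have e2 : ((fun i => (T (x₁ i)).1 0) + (s : ℂ) • fun i => -((T (x₁ i)).1 0 / s) :
        Fin (n + 1) → ℂ) = 0 := by
      ext i
      simp only [Pi.add_apply, Pi.smul_apply, smul_eq_mul, Pi.zero_apply]
      field_simp
      ring
    refine Prod.ext ?_ ?_
    · change U _ = 0
      rw [e2, map_zero]
    · change (l : ℂ)⁻¹ * (s : ℂ) = l
      rw [← hl2]
      push_cast
      field_simp
  have hN : Normalised x y t (l : ℂ) :=
    { ne := hlC
      x0 := fun i => congrFun (congrArg (fun V => V.1.1) n0) i
      y0 := congrArg (fun V => V.1.2) n0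
      t0 := congrArg (fun V => V.2) n0
      dx0 := by
        have := congrFun (congrArg (fun V => V.1) n1) 0
        simp only [Pi.single_eq_same] at this
        exact this
      dxi := fun i hi => by simpa [tuple, hi] using congrFun (congrArg (fun V => V.1) n1) i
      Tx := fun i => congrFun (congrArg (fun V => V.1) n2) i
      dy := congrArg (fun V => V.2) n1
      Ty := congrArg (fun V => V.2) n2 }
  obtain ⟨r, hr⟩ := jet_T_t_eq hXB hN hRB
  have hjx := jet_T_x_eq_zero hN hRB
  have hjy := jet_T_y_eq hN hRB
  have hPA : PreservesForm (B.trans (heisParabolic (r : ℂ))) :=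
    hPB.trans (preservesForm_heisParabolic r)
  set A := B.trans (heisParabolic (r : ℂ)) with hA
  have hTA : ∀ L, tuple L (actX A f g 1) (actY A f g 1) (actT A f g 1) =
      (((fun i => L (x i)), L y), L t - r * L y) := by
    intro L
    rw [tuple_act, hA, LinearEquiv.trans_apply, ← tuple_act, heisParabolic_apply]
    rfl
  have ex : actX A f g 1 = x := funext fun i => ext_apply fun p =>
    congrFun (congrArg (fun V => V.1.1) (hTA (ev p))) i
  have ey : actY A f g 1 = y := ext_apply fun p => congrArg (fun V => V.1.2) (hTA (ev p))
  have et : actT A f g 1 = t - (r : ℂ) • y := ext_apply fun p =>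
    congrArg (fun V => V.2) (hTA (ev p))
  have hXA := hX.act hPA
  rw [ex, ey] at hXA
  have hq : jet T (dz (x 0)) ≠ 0 := by
    intro h
    have := congrArg PowerSeries.constantCoeff h
    rw [constantCoeff_jet, hN.dx0, map_zero] at this
    exact hlC this
  have hpt : ∀ p, A (tuple (ev p) f g 1) = tuple (ev p) x y (actT A f g 1) := by
    intro p
    rw [← tuple_act, ex, ey]
  refine ⟨A, hPA, fun p => ?_⟩
  -- The transformed vector has no zero because `A` is injective and the last entry of `(f, g, 1)`
  -- is `1`.
  obtain ⟨μ, hμ, m1, m2, m3, m4⟩ := proportional_of_jet hXA (fun p h1 h2 h3 => by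
      have h4 : A (tuple (ev p) f g 1) = 0 := by
        rw [hpt]
        refine Prod.ext (Prod.ext (funext h1) h2) h3
      have h5 := congrArg (fun V => V.2) (A.map_eq_zero_iff.1 h4)
      simp [tuple] at h5) (hjx 0) hq hjy (by
        rw [et, map_sub, jet_smul, hr, hjy, PowerSeries.smul_eq_C_mul]; ring) p
  refine ⟨μ, hμ, ?_⟩
  rw [hpt]
  refine Prod.ext (Prod.ext (funext fun i => ?_) m3) (by simpa [tuple] using m4)
  refine Fin.cases ?_ (fun i => ?_) i
  · simpa [tuple] using m1
  · simpa [tuple] using m2 i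

end smoothAlg
end

/-! ### Translation to the origin and conclusion. -/

noncomputable section

section Components

variable {E : Type*} [NormedAddCommGroup E] [NormedSpace ℂ E]
  {F : Type*} [NormedAddCommGroup F] [NormedSpace ℂ F]

theorem fderiv_comp_clm_apply (l : E →L[ℂ] F) {h : ℂ × ℝ → E} {p : ℂ × ℝ}
    (hh : DifferentiableAt ℝ h p) (v : ℂ × ℝ) :
    fderiv ℝ (fun q => l (h q)) p v = l (fderiv ℝ h p v) :=
  congrArg (fun S => S v)
    (((l.restrictScalars ℝ).hasFDerivAt (x := h p)).comp p hh.hasFDerivAt).fderiv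

theorem crL_clm_comp (l : E →L[ℂ] F) {h : ℂ × ℝ → E} {p : ℂ × ℝ}
    (hh : DifferentiableAt ℝ h p) : crL (fun q => l (h q)) p = l (crL h p) := by
  simp only [crL, dzbar, du, fderiv_comp_clm_apply l hh, map_sub, map_add, map_smul]

theorem segreL_clm_comp (l : E →L[ℂ] F) (a : ℂ) {h : ℂ × ℝ → E} {p : ℂ × ℝ}
    (hh : DifferentiableAt ℝ h p) : segreL a (fun q => l (h q)) p = l (segreL a h p) := by
  simp only [segreL, dchi, dtau, dzbar, du, fderiv_comp_clm_apply l hh, map_sub, map_add, map_smul]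

end Components

namespace smoothAlg

variable {m : ℕ}

/-- The field `segreL a` on smooth functions. -/
def segL (a : ℂ) (h : smoothAlg) : smoothAlg := dx h - (2 * I * a) • T h

theorem cj_sL (b : ℂ) (h : smoothAlg) : cj (sL b h) = segL (conj b) (cj h) := by
  simp [sL, segL, dx_cj, sub_eq_add_neg, Complex.conj_ofNat]

theorem cj_sL_iterate (b : ℂ) (k : ℕ) (h : smoothAlg) :
    cj ((sL b)^[k] h) = (segL (conj b))^[k] (cj h) :=
  Function.Semiconj.iterate_right (f := cj) (cj_sL b) k h

/-- The vector-valued function with the given components. -/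
def vec (h : Fin m → smoothAlg) (p : ℂ × ℝ) : Fin m → ℂ := fun i => (h i).1 p

theorem differentiable_vec (h : Fin m → smoothAlg) : Differentiable ℝ (vec h) :=
  differentiable_pi.2 fun i => differentiable (h i)

theorem segreL_vec (a : ℂ) (h : Fin m → smoothAlg) :
    segreL a (vec h) = vec fun i => segL a (h i) := by
  ext p i
  exact (segreL_clm_comp (ContinuousLinearMap.proj (R := ℂ) (φ := fun _ : Fin m => ℂ) i) a
    (differentiable_vec h p)).symm

theorem segreL_iterate_vec (a : ℂ) (k : ℕ) (h : Fin m → smoothAlg) :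
    (segreL a)^[k] (vec h) = vec fun i => (segL a)^[k] (h i) := by
  induction k generalizing h with
  | zero => rfl
  | succ k ih => rw [Function.iterate_succ_apply, segreL_vec, ih]; rfl

/-- The action of the Heisenberg translation taking the origin to `(c, s)`, in the chart. -/
def heisShift (c : ℂ) (s : ℝ) (p : ℂ × ℝ) : ℂ × ℝ :=
  (p.1 + c, p.2 + s - 2 * (p.1 * conj c).im)

/-- The differential of `heisShift`. -/
def heisShiftDeriv (c : ℂ) : ℂ × ℝ →L[ℝ] ℂ × ℝ :=
  (ContinuousLinearMap.fst ℝ ℂ ℝ).prod (ContinuousLinearMap.snd ℝ ℂ ℝ -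
    (2 : ℝ) • imCLM.comp ((ContinuousLinearMap.mul ℝ ℂ (conj c)).comp
      (ContinuousLinearMap.fst ℝ ℂ ℝ)))

theorem heisShift_eq (c : ℂ) (s : ℝ) :
    heisShift c s = fun p => heisShiftDeriv c p + (c, s) := by
  ext p
  · simp [heisShift, heisShiftDeriv]
  · simp [heisShift, heisShiftDeriv]
    ring

theorem contDiff_heisShift (c : ℂ) (s : ℝ) : ContDiff ℝ ∞ (heisShift c s) := by
  rw [heisShift_eq]
  exact (heisShiftDeriv c).contDiff.add contDiff_const

theorem hasFDerivAt_heisShift (c : ℂ) (s : ℝ) (p : ℂ × ℝ) :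
    HasFDerivAt (heisShift c s) (heisShiftDeriv c) p := by
  rw [heisShift_eq]
  exact (heisShiftDeriv c).hasFDerivAt.add_const _

theorem heisShift_zero (c : ℂ) (s : ℝ) : heisShift c s 0 = (c, s) := by
  simp [heisShift]

/-- Composition with `heisShift`. -/
def pull (c : ℂ) (s : ℝ) (h : smoothAlg) : smoothAlg :=
  ⟨fun p => h.1 (heisShift c s p), mem_iff.2 ((contDiff h).comp (contDiff_heisShift c s))⟩

theorem pull_apply (c : ℂ) (s : ℝ) (h : smoothAlg) (p : ℂ × ℝ) :
    (pull c s h).1 p = h.1 (heisShift c s p) := rfl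

theorem cj_pull (c : ℂ) (s : ℝ) (h : smoothAlg) : cj (pull c s h) = pull c s (cj h) := rfl

theorem dirD_pull (c : ℂ) (s : ℝ) (h : smoothAlg) (v p : ℂ × ℝ) :
    (dirD v (pull c s h)).1 p = fderiv ℝ h.1 (heisShift c s p) (heisShiftDeriv c v) :=
  congrArg (fun S => S v)
    ((differentiable h _).hasFDerivAt.comp p (hasFDerivAt_heisShift c s p)).fderiv

theorem T_pull (c : ℂ) (s : ℝ) (h : smoothAlg) : T (pull c s h) = pull c s (T h) := by
  refine ext_apply fun p => ?_
  rw [T_apply, dirD_pull, pull_apply, T_apply, dirD_apply]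
  simp [heisShiftDeriv]

theorem dbar_pull (c : ℂ) (s : ℝ) (h : smoothAlg) :
    dbar (pull c s h) = pull c s (dbar h - (I * c) • T h) := by
  refine ext_apply fun p => ?_
  have e (z : ℂ) : heisShiftDeriv c (z, 0) = (z, 0) + (-2 * (conj c * z).im) • ((0, 1) : ℂ × ℝ) := by
    ext <;> simp [heisShiftDeriv]
  simp only [dbar_apply, T_apply, pull_apply, coe_smul_apply, coe_add_apply, coe_sub_apply,
    dirD_pull, e, map_add, map_smul, Complex.real_smul]
  simp only [dirD_apply]
  set t := fderiv ℝ h.1 (heisShift c s p) (0, 1)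
  have hc := Complex.re_add_im c
  have e1 : (((-2 * (conj c * 1).im : ℝ)) : ℂ) = 2 * (c.im : ℂ) := by simp
  have e2 : (((-2 * (conj c * I).im : ℝ)) : ℂ) = -2 * (c.re : ℂ) := by simp
  rw [e1, e2]
  linear_combination (-I * t) * hc + (c.im : ℂ) * t * I_sq

theorem Lb_pull (c : ℂ) (s : ℝ) (h : smoothAlg) : Lb (pull c s h) = pull c s (Lb h) := by
  refine ext_apply fun p => ?_
  rw [Lb_apply, dbar_pull, T_pull]
  simp [pull_apply, Lb_apply, heisShift]
  ring

/-- Left translation moves the `z`-coordinate of the Segre point along with the base point: the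
parameter `a` seen from the origin is `a + c` seen from the original point. -/
theorem segL_pull (a c : ℂ) (s : ℝ) (h : smoothAlg) :
    segL a (pull c s h) = pull c s (segL (a + c) h) := by
  refine ext_apply fun p => ?_
  rw [segL, dx_apply, dbar_pull, T_pull]
  simp [pull_apply, segL, dx_apply, heisShift]
  ring

theorem segL_iterate_pull (a c : ℂ) (s : ℝ) (k : ℕ) (h : smoothAlg) :
    (segL a)^[k] (pull c s h) = pull c s ((segL (a + c))^[k] h) := by
  induction k generalizing h with
  | zero => rfl
  | succ k ih => rw [Function.iterate_succ_apply, segL_pull, ih]; rfl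

end smoothAlg

open smoothAlg

theorem heisPt_mem (p : ℂ × ℝ) : heisPt p ∈ heisenberg 1 := by
  simp [heisenberg, heisPt, -ofReal_pow]

theorem heisPt_of_mem {Z : CSpace 1} (hZ : Z ∈ heisenberg 1) : heisPt (Z.1 0, Z.2.re) = Z := by
  have h : Z.2.im = ‖Z.1 0‖ ^ 2 := by simpa [heisenberg] using hZ
  refine Prod.ext ?_ ?_
  · ext i
    rw [Subsingleton.elim i 0]
    rfl
  · change (Z.2.re : ℂ) + I * ((‖Z.1 0‖ ^ 2 : ℝ) : ℂ) = Z.2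
    rw [← h, mul_comm]
    exact Complex.re_add_im _

theorem heisTranslate_symm_heisPt (c : ℂ) (s : ℝ) (p : ℂ × ℝ) :
    (heisTranslate (heisPt (c, s)).1 (heisPt (c, s)).2).symm (heisPt p, 1) =
      (heisPt (heisShift c s p), 1) := by
  rw [LinearEquiv.symm_apply_eq, heisTranslate_apply]
  refine Prod.ext (Prod.ext ?_ ?_) rfl
  · ext i
    simp [heisPt, heisShift]
  · simp only [heisPt, heisShift, Finset.univ_unique, Finset.sum_singleton]
    have h (z : ℂ) : (((‖z‖ ^ 2 : ℝ)) : ℂ) = z * conj z := by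
      rw [Complex.mul_conj, Complex.normSq_eq_norm_sq]
    have h2 : ((2 * (p.1 * conj c).im : ℝ) : ℂ) = -I * (p.1 * conj c - conj p.1 * c) := by
      apply Complex.ext
      · simp; ring
      · simp
    rw [ofReal_sub, h2]
    simp only [h, map_add, ofReal_add]
    ring

theorem exists_segre_pt (q : CSpace 1) (a : ℂ) : ∃ P ∈ segreVariety q, P.1 0 = a :=
  ⟨(fun _ => a, conj q.2 + 2 * I * a * conj (q.1 0)), rfl, rfl⟩

/-- There are `n + 1` tangential components. The minimum `n` bounds the rank by `1` at every point,
and the point where it is attained has rank exactly `1`. -/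
theorem degeneracy_bounds {n : ℕ} {H : CSpace 1 → CSpace (n + 1)} {q : CSpace 1}
    (h : tdeg H q = n) :
    (∀ P ∈ segreVariety q, Module.finrank ℂ (segreSpan H P q) ≤ 1) ∧
      ∃ P ∈ segreVariety q, segreSpan H P q ≠ ⊥ := by
  have hle : ∀ P, Module.finrank ℂ (segreSpan H P q) ≤ n + 1 := fun P => by
    simpa using Submodule.finrank_le (segreSpan H P q)
  refine ⟨fun P hP => ?_, ?_⟩
  · have h1 : n ≤ degeneracyAt H P q := h.symm.trans_le (Nat.sInf_le (Set.mem_image_of_mem _ hP))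
    have := hle P
    unfold degeneracyAt at h1
    omega
  · obtain ⟨P₀, hP₀, -⟩ := exists_segre_pt q 0
    obtain ⟨P, hP, hPn⟩ := Nat.sInf_mem
      (s := (fun P => degeneracyAt H P q) '' segreVariety q) ⟨_, P₀, hP₀, rfl⟩
    refine ⟨P, hP, fun hb => ?_⟩
    have h1 : n + 1 - Module.finrank ℂ (segreSpan H P q) = n := hPn.trans h
    rw [hb, finrank_bot] at h1
    omega

theorem sphericallyEquivalent_linearEmbedding {n : ℕ} (H : CSpace 1 → CSpace (n + 1))
    (hH : IsSmoothCRMap H) {q : CSpace 1} (hq : q ∈ heisenberg 1) (hdeg : tdeg H q = n) :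
    SphericallyEquivalent (linearEmbedding (n + 1)) H := by
  obtain ⟨hrank, P₁, hP₁, hne⟩ := degeneracy_bounds hdeg
  set c := q.1 0 with hc
  set s := q.2.re with hs
  have hqs : heisPt (c, s) = q := heisPt_of_mem hq
  let F : Fin (n + 1) → smoothAlg := fun i =>
    ⟨fun p => (H (heisPt p)).1 i, mem_iff.2 (contDiff_pi.1 (contDiff_fst.comp hH.smooth) i)⟩
  let G : smoothAlg := ⟨fun p => (H (heisPt p)).2, mem_iff.2 (contDiff_snd.comp hH.smooth)⟩
  have hHd : Differentiable ℝ fun p => H (heisPt p) := hH.smooth.differentiable (by simp)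
  have hF : ∀ i, Lb (F i) = 0 := fun i => ext_apply fun p => by
    have := crL_clm_comp ((ContinuousLinearMap.proj (R := ℂ) (φ := fun _ : Fin (n + 1) => ℂ) i).comp
      (ContinuousLinearMap.fst ℂ (Fin (n + 1) → ℂ) ℂ)) (hHd p)
    rw [hH.cr p, map_zero] at this
    exact this
  have hG : Lb G = 0 := ext_apply fun p => by
    have := crL_clm_comp (ContinuousLinearMap.snd ℂ (Fin (n + 1) → ℂ) ℂ) (hHd p)
    rw [hH.cr p, map_zero] at this
    exact this
  have hpull0 : pull c s 0 = 0 := rfl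
  have hX : NullCR (fun i => pull c s (F i)) (pull c s G) 1 := by
    refine nullCR_of_form (fun i => ?_) ?_ Lb.map_one_eq_zero fun p => ?_
    · rw [Lb_pull, hF, hpull0]
    · rw [Lb_pull, hG, hpull0]
    · have h1 : tuple (ev p) (fun i => pull c s (F i)) (pull c s G) 1 =
          (H (heisPt (heisShift c s p)), 1) := rfl
      rw [h1, ← mem_heisenberg_iff]
      exact hH.mapsTo (heisPt_mem (heisShift c s p))
  -- Conjugation turns the parameter `b` into its conjugate and the translation adds `c`, so the
  -- point with coordinate `P.1 0` corresponds to `b = conj (P.1 0 - c)`.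
  have hjet : ∀ (P : CSpace 1) (k : ℕ) (i : Fin (n + 1)),
      ((sL (conj (P.1 0 - c)))^[k] (pull c s (F i))).1 0 =
        conj ((segreL (P.1 0))^[k] (conjTang H) (c, s) i) := by
    intro P k i
    have h1 : conjTang H = vec fun i => cj (F i) := rfl
    rw [h1, segreL_iterate_vec, ← Complex.conj_conj (((sL _)^[k] _).1 0), ← cj_apply,
      cj_sL_iterate, cj_pull, segL_iterate_pull, pull_apply, heisShift_zero, Complex.conj_conj,
      sub_add_cancel]
    rfl
  obtain ⟨A, hA, hAp⟩ := exists_preservesForm_of_rank_one hX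
    (fun b => by
      obtain ⟨P, hP, hPb⟩ := exists_segre_pt q (conj b + c)
      obtain ⟨v, hv⟩ := finrank_le_one_iff.1 (hrank P hP)
      refine ⟨fun i => conj (v.1 i), fun k hk => ?_⟩
      obtain ⟨r, hr⟩ := hv ⟨_, Submodule.subset_span ⟨k, hk, rfl⟩⟩
      refine ⟨conj r, fun i => ?_⟩
      have h1 := hjet P k i
      rw [hPb, add_sub_cancel_right, Complex.conj_conj] at h1
      have h2 := congrFun (congrArg Subtype.val hr) i
      rw [h1, ← map_mul, ← hPb]
      exact congrArg conj h2.symm)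
    (by
      by_contra! h0
      refine hne (Submodule.span_eq_bot.2 ?_)
      rintro _ ⟨k, hk, rfl⟩
      ext i
      have h1 := hjet P₁ k i
      rw [h0 _ k i hk] at h1
      simpa using h1.symm)
  have hT : PreservesForm (heisTranslate (heisPt (c, s)).1 (heisPt (c, s)).2).symm :=
    (preservesForm_heisTranslate (heisPt_mem (c, s))).symm
  -- The source automorphism is the translation taking the origin to `q`, and the target one is the
  -- inverse of the normalising isometry `A`; the factor `μ` drops out of the linear fractional map.
  refine ⟨_, A.symm, isHeisAut_of_preservesForm hT, isHeisAut_of_preservesForm hA.symm,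
    fun Z hZ _ => ?_⟩
  set p : ℂ × ℝ := (Z.1 0, Z.2.re) with hp
  have hZp : heisPt p = Z := heisPt_of_mem hZ
  obtain ⟨μ, hμ, hAμ⟩ := hAp p
  have hlin : linearEmbedding (n + 1) Z = (Pi.single 0 p.1, wS.1 p) := by
    refine Prod.ext ?_ ?_
    · ext i
      by_cases hi : i = 0
      · subst hi; simp [linearEmbedding, hp]
      · have : (i : ℕ) ≠ 0 := fun h => hi (Fin.ext h)
        simp [linearEmbedding, hi]
    · rw [wS_apply]
      exact (congrArg Prod.snd hZp).symm
  have hval : A.symm (linearEmbedding (n + 1) Z, 1) = μ⁻¹ • (H (heisPt (heisShift c s p)), 1) := by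
    rw [LinearEquiv.symm_apply_eq, map_smul, hlin]
    refine (?_ : _ = μ⁻¹ • μ • _).trans (congrArg (μ⁻¹ • ·) hAμ.symm)
    rw [inv_smul_smul₀ hμ]
  have hden : lfDen A.symm (linearEmbedding (n + 1) Z) = μ⁻¹ := by
    rw [lfDen, hval]; simp
  refine ⟨hden ▸ inv_ne_zero hμ, ?_⟩
  have hsrc : linFrac (heisTranslate (heisPt (c, s)).1 (heisPt (c, s)).2).symm Z =
      heisPt (heisShift c s p) := by
    rw [linFrac, lfDen, ← hZp, heisTranslate_symm_heisPt]
    simp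
  rw [hsrc, linFrac, hden, hval, inv_inv, Prod.smul_fst, smul_inv_smul₀ hμ]

end

theorem mainTheorem6 (N : ℕ) (hN : 2 ≤ N) (H : CSpace 1 → CSpace (N - 1))
    (hH : IsSmoothCRMap H)
    (hdeg : ∃ q ∈ heisenberg 1, tdeg H q = N - 2) :
    SphericallyEquivalent (linearEmbedding (N - 1)) H := by
  obtain ⟨n, rfl⟩ : ∃ n, N = n + 2 := ⟨N - 2, by omega⟩
  obtain ⟨q, hq, hqd⟩ := hdeg
  exact sphericallyEquivalent_linearEmbedding (n := n) H hH hq hqd
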